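/- Let $n\ge 1$, let $\Omega\subset\mathbb{R}^n$ be open and connected, and let $f\in W^{1,2}(\Omega,\mathcal{A}_Q(\mathbb{R}^m))$ be a $Q$-valued map that is not almost everywhere equal to $Q[\![0]\!]$ on $\Omega$. Assume that $f$ is Dir-stationary, i.e. that, with $Df=\sum_i[\![Df_i]\!]$ the approximate differential of $f=\sum_i[\![f_i]\!]$ and $|Df|^2=\sum_i|Df_i|^2$, $$\int_\Omega \sum_{i=1}^Q\big[\langle Df_i : D_x\psi(x,f_i)\rangle+\langle Df_i : D_u\psi(x,f_i)\cdot Df_i\rangle\big]\,dx=0$$ for every $\psi(x,u)\in C^\infty(\Omega\times\mathbb{R}^m;\mathbb{R}^m)$ with compact support in $x$ and $|D_u\psi|\le C<\infty$, $|\psi|+|D_x\psi|\le C(1+|u|)$ for some constant $C$, and $$2\int_\Omega\sum_{i=1}^Q\langle Df_i : Df_i\cdot D\phi\rangle\,dx-\int_\Omega|Df|^2\,\mathrm{div}\,\phi\,dx=0\qquad\text{for every }\phi\in C_c^\infty(\Omega,\mathbb{R}^n).$$ Define the vanishing order of $f$ at $x\in\Omega$ by $$\kappa_x=\limsup_{r\to0^+}\frac{\log\Big(\frac{1}{|B_{2r}(x)\setminus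 B_r(x)|}\int_{B_{2r}(x)\setminus B_r(x)}|f|^2\Big)}{2\log r}\in[-\infty,+\infty],\qquad \log 0:=-\infty,$$ where $|f|^2=\sum_i|f_i|^2$. Then, for every $x\in\Omega$, $\kappa_x$ is finite and the upper limit is a limit: $$\kappa_x=\lim_{r\to0^+}\frac{\log\Big(\frac{1}{|B_{2r}(x)\setminus B_r(x)|}\int_{B_{2r}(x)\setminus B_r(x)}|f|^2\Big)}{2\log r}.$$ -/

import Mathlib

open MeasureTheory Filter Topology Asymptotics
open scoped ContDiff ENNReal

noncomputable section

namespace QValued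

/-- Euclidean space `ℝ^n`. -/
abbrev E (n : ℕ) : Type := EuclideanSpace ℝ (Fin n)

/-- `𝒜_Q(ℝ^m)`: the unordered `Q`-tuples `∑ i, ⟦P_i⟧` of points of `ℝ^m`, with multiplicity. -/
abbrev AQ (m Q : ℕ) : Type := Sym (E m) Q

/-- `∑ P ∈ T, g P` over an unordered `Q`-tuple, counted with multiplicity. -/
def qsum {α : Type*} {Q : ℕ} (T : Sym α Q) (g : α → ℝ) : ℝ :=
  ((T : Multiset α).map g).sum

/-- The metric `𝒢(S, T) = min_σ (∑ i, |S_i - T_{σ(i)}|²)^{1/2}`, written as the least value of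
`(∑ i, |v_i - w_i|²)^{1/2}` over all enumerations `v` of `S` and `w` of `T`. -/
def gdist {m Q : ℕ} (S T : AQ m Q) : ℝ :=
  sInf {d : ℝ | ∃ v w : Fin Q → E m,
    (S : Multiset (E m)) = Finset.univ.val.map v ∧
    (T : Multiset (E m)) = Finset.univ.val.map w ∧
    d = Real.sqrt (∑ i, ‖v i - w i‖ ^ 2)}

/-- The point `Q⟦0⟧`. -/
def qzero (m Q : ℕ) : AQ m Q := Sym.replicate Q 0

/-- `|T| = 𝒢(T, Q⟦0⟧)`. -/
def qnorm {m Q : ℕ} (T : AQ m Q) : ℝ := gdist T (qzero m Q)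

/-- The `j`-th standard basis vector. -/
def e {n : ℕ} (j : Fin n) : E n := EuclideanSpace.single j 1

/-- `g'` is the weak partial derivative `∂_j g` on the open set `Ω`. -/
def HasWeakPartial {n : ℕ} (Ω : Set (E n)) (j : Fin n) (g g' : E n → ℝ) : Prop :=
  LocallyIntegrableOn g Ω ∧ LocallyIntegrableOn g' Ω ∧
  ∀ φ : E n → ℝ, ContDiff ℝ ∞ φ → HasCompactSupport φ → tsupport φ ⊆ Ω →
    ∫ x in Ω, g x * fderiv ℝ φ x (e j) = - ∫ x in Ω, g' x * φ x

/-- `f ∈ W^{1,2}(Ω, 𝒜_Q(ℝ^m))`. Since `𝒜_Q` is a separable metric space, `f` is (Lebesgue)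
measurable if and only if all the functions `𝒢(f, T)` are. On a set `Ω` of finite measure
`|f| ∈ L²` amounts to `𝒢(f, T) ∈ L²` for all `T`. -/
structure MemW12 {n m Q : ℕ} (Ω : Set (E n)) (f : E n → AQ m Q) : Prop where
  measurable : ∀ T : AQ m Q,
    AEStronglyMeasurable (fun x => gdist (f x) T) (volume.restrict Ω)
  memL2 : MemLp (fun x => qnorm (f x)) 2 (volume.restrict Ω)
  exists_bound : ∃ φ : Fin n → E n → ℝ,
    (∀ j, MemLp (φ j) 2 (volume.restrict Ω)) ∧
    ∀ (T : AQ m Q) (j : Fin n), ∃ g : E n → ℝ,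
      HasWeakPartial Ω j (fun x => gdist (f x) T) g ∧
      ∀ᵐ x ∂(volume.restrict Ω), |g x| ≤ φ j x

/-- A `Q`-valued 1-jet: an unordered `Q`-tuple of pairs `(P_i, L_i)` of a value and a
differential, `i = 1, …, Q`. -/
abbrev Jet (n m Q : ℕ) : Type := Sym (E m × (E n →L[ℝ] E m)) Q

/-- `S` has Lebesgue density one at `x`. -/
def HasDensityOne {n : ℕ} (S : Set (E n)) (x : E n) : Prop :=
  Tendsto (fun r : ℝ => volume (S ∩ Metric.ball x r) / volume (Metric.ball x r))
    (𝓝[>] 0) (𝓝 1)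

/-- `f` is approximately differentiable at `x`, with values and differentials
`∑ i, ⟦(f_i(x), Df_i(x))⟧ = J`: one has `∑ i, ⟦f_i(x)⟧ = f(x)`, `Df_i(x) = Df_k(x)` whenever
`f_i(x) = f_k(x)`, and `𝒢(f(y), ∑ i, ⟦f_i(x) + Df_i(x)(y - x)⟧) = o(|y - x|)` as `y → x` within
some measurable set that contains `x` and has density one there. -/
def HasApproxJet {n m Q : ℕ} (f : E n → AQ m Q) (x : E n) (J : Jet n m Q) : Prop :=
  J.map Prod.fst = f x ∧
  (∀ p ∈ J, ∀ q ∈ J, p.1 = q.1 → p.2 = q.2) ∧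
  ∃ S : Set (E n), NullMeasurableSet S volume ∧ x ∈ S ∧ HasDensityOne S x ∧
    (fun y => gdist (f y) (J.map fun p => p.1 + p.2 (y - x))) =o[𝓝[S] x] (fun y => y - x)

open Classical in
/-- The jet `∑ i, ⟦(f_i(x), Df_i(x))⟧` of `f` at `x`, given by the approximate differential; with
`Df_i(x) = 0` by convention at the points where `f` is not approximately differentiable (for
Sobolev maps, a null set). -/
def jet {n m Q : ℕ} (f : E n → AQ m Q) (x : E n) : Jet n m Q :=
  if h : ∃ J, HasApproxJet f x J then h.choose else (f x).map fun P => (P, 0)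

/-- The Hilbert-Schmidt product `⟨A : B⟩ = tr(Aᵀ B)`. -/
def hs {n m : ℕ} (A B : E n →L[ℝ] E m) : ℝ := ∑ j, inner ℝ (A (e j)) (B (e j))

/-- The divergence of a vector field. -/
def divergence {n : ℕ} (φ : E n → E n) (x : E n) : ℝ := ∑ j, (fderiv ℝ φ x (e j)) j

/-- Admissible `ψ(x, u)` in the outer variation formula: smooth, with compact support in `x`
inside `Ω`, `|D_u ψ| ≤ C` and `|ψ| + |D_x ψ| ≤ C (1 + |u|)`. -/
def OuterAdmissible {n m : ℕ} (Ω : Set (E n)) (ψ : E n → E m → E m) : Prop :=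
  ContDiff ℝ ∞ (Function.uncurry ψ) ∧
  (∃ K : Set (E n), IsCompact K ∧ K ⊆ Ω ∧ ∀ x, x ∉ K → ∀ u, ψ x u = 0) ∧
  ∃ C : ℝ, ∀ x u, ‖fderiv ℝ (fun v => ψ x v) u‖ ≤ C ∧
    ‖ψ x u‖ + ‖fderiv ℝ (fun y => ψ y u) x‖ ≤ C * (1 + ‖u‖)

/-- `𝒪(f, ψ) = ∫ ∑ i, ⟨Df_i : D_x ψ(x, f_i)⟩ + ⟨Df_i : D_u ψ(x, f_i) · Df_i⟩ dx`. -/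
def outerVariation {n m Q : ℕ} (Ω : Set (E n)) (f : E n → AQ m Q) (ψ : E n → E m → E m) : ℝ :=
  ∫ x in Ω, qsum (jet f x) fun p =>
    hs p.2 (fderiv ℝ (fun y => ψ y p.1) x) + hs p.2 ((fderiv ℝ (fun v => ψ x v) p.1).comp p.2)

/-- `ℐ(f, φ) = 2 ∫ ∑ i, ⟨Df_i : Df_i · Dφ⟩ - ∫ |Df|² div φ`, where `|Df|² = ∑ i, |Df_i|²`. -/
def innerVariation {n m Q : ℕ} (Ω : Set (E n)) (f : E n → AQ m Q) (φ : E n → E n) : ℝ :=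
  2 * (∫ x in Ω, qsum (jet f x) fun p => hs p.2 (p.2.comp (fderiv ℝ φ x))) -
    ∫ x in Ω, (qsum (jet f x) fun p => hs p.2 p.2) * divergence φ x

/-- `f ∈ W^{1,2}(Ω, 𝒜_Q(ℝ^m))` is Dir-stationary, with respect to outer and inner variations. -/
structure IsDirStationary {n m Q : ℕ} (Ω : Set (E n)) (f : E n → AQ m Q) : Prop where
  memW12 : MemW12 Ω f
  outer : ∀ ψ : E n → E m → E m, OuterAdmissible Ω ψ → outerVariation Ω f ψ = 0
  inner : ∀ φ : E n → E n, ContDiff ℝ ∞ φ → HasCompactSupport φ → tsupport φ ⊆ Ω →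
    innerVariation Ω f φ = 0

/-- `f` is not (almost everywhere) equal to `Q⟦0⟧` on `Ω`. -/
def IsNontrivial {n m Q : ℕ} (Ω : Set (E n)) (f : E n → AQ m Q) : Prop :=
  ¬ ∀ᵐ x ∂(volume.restrict Ω), f x = qzero m Q

/-- The average of `|f|²` over the annulus `B_{2r} \ B_r (x)`. -/
def annulusAverage {n m Q : ℕ} (f : E n → AQ m Q) (x : E n) (r : ℝ) : ℝ≥0∞ :=
  ⨍⁻ y in Metric.ball x (2 * r) \ Metric.ball x r, ENNReal.ofReal (qnorm (f y) ^ 2) ∂volume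

/-- `log (⨍ |f|²) / (2 log r)`, as an extended real number, with `log 0 = -∞`. -/
def vanishingQuotient {n m Q : ℕ} (f : E n → AQ m Q) (x : E n) (r : ℝ) : EReal :=
  ENNReal.log (annulusAverage f x r) / ((2 * Real.log r : ℝ) : EReal)

/-- The vanishing order `κ_{x,f}`, as an upper limit. -/
def vanishingOrder {n m Q : ℕ} (f : E n → AQ m Q) (x : E n) : EReal :=
  limsup (vanishingQuotient f x) (𝓝[>] 0)

end QValued

end

/-! The engine is Almgren's monotonicity of the frequency. Fix x, let s be the square of the scale,
and use the smooth weight `bump`, supported in [1,4], and `cutoff`, with `cutoff`' = -`bump`. With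
both weights evaluated at |y-x|²/s, set H = ∫ bump |f|², D = ∫ cutoff |Df|², I = ∫ bump ∑⟨f_i,
Df_i(y-x)⟩ and E = ∫ bump ∑|Df_i(y-x)|². Testing the weak derivative of |f|² with bump·(y-x) gives
2sH' = nH + 2I; the outer variation along cutoff·u gives sD = 2I; the inner variation along
cutoff·(y-x) gives 2sD' = (n-2)D + (4/s)E; and I² ≤ HE by Cauchy-Schwarz.

In the variable τ = log s, put h = e^{-nτ/2} H, d = e^{-nτ/2} sD and ε = e^{-nτ/2} E. The identities
become h' = d/2, d' = 2ε, (d/2)² ≤ hε. Hence d/h is nondecreasing (`frequency_mul_le`), so log h is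
convex and nondecreasing, and such a function has a finite asymptotic slope at -∞
(`exists_tendsto_div_atBot_of_convexOn`). This slope is the vanishing order: integrals over sharp
annuli are squeezed between multiples of H at comparable scales, constants are negligible against
log r, and the volume factor r^n cancels the exponent n/2 of the normalization.

Taking log h requires h > 0. Monotone frequency gives h' ≤ ch below a scale where h > 0, so
positivity propagates to smaller scales. Together with the monotonicity of H, a zero of H at one
scale forces f = Q⟦0⟧ a.e. on a ball, and connectedness of Ω spreads this to all of Ω
(`ae_eq_qzero_of_locally`), contradicting nontriviality.

The first half of the proof justifies the calculus from the metric definition of W^{1,2}. Increments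
of 𝒢(f,T) are line integrals of weak derivatives, dominated uniformly in T; a maximal function
argument makes f Lipschitz on sets exhausting a ball up to a null set; a Rademacher theorem provides
jets there. Difference quotients along well chosen sequences then give measurability and
integrability of |Df|², and the identity ∑⟨f_i, ∂_j f_i⟩ = |f| ∂_j|f|. The outcome is collected in
`HasLocalEnergy`. -/

noncomputable section

namespace QValued

/-! ### Unordered tuples and the matching metric -/

/-- The unordered tuple `∑ i, ⟦v i⟧`. -/
def ofVec {α : Type*} {Q : ℕ} (v : Fin Q → α) : Sym α Q :=
  ⟨Finset.univ.val.map v, by simp⟩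

lemma exists_ofVec {α : Type*} {Q : ℕ} (T : Sym α Q) : ∃ v, T = ofVec v := by
  obtain ⟨s, hs⟩ := T
  obtain ⟨l, rfl⟩ := Quot.exists_rep s
  have hl : l.length = Q := hs
  subst hl
  refine ⟨l.get, Subtype.ext ?_⟩
  simp [ofVec]

/-- Equal multisets have equinumerous fibres over each value, and bijections between the fibres glue
to a permutation. -/
lemma ofVec_eq_iff {α : Type*} {Q : ℕ} {v w : Fin Q → α} :
    ofVec v = ofVec w ↔ ∃ σ : Equiv.Perm (Fin Q), v = w ∘ σ := by
  classical
  constructor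
  · intro h
    have h1 : Finset.univ.val.map v = Finset.univ.val.map w := congrArg Subtype.val h
    have h2 : ∀ c, Nonempty ({a // v a = c} ≃ {b // w b = c}) := by
      intro c
      have := congrArg (Multiset.count c) h1
      rw [Multiset.count_map, Multiset.count_map] at this
      refine ⟨Fintype.equivOfCardEq ?_⟩
      rw [Fintype.card_subtype, Fintype.card_subtype]
      simpa [Finset.card, eq_comm] using this
    have e := fun c => (h2 c).some
    refine ⟨Equiv.ofFiberEquiv e, ?_⟩
    ext i
    exact (Equiv.ofFiberEquiv_map e i).symm
  · rintro ⟨σ, rfl⟩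
    apply Subtype.ext
    change Multiset.map (w ∘ σ) Finset.univ.val = _
    rw [← Multiset.map_map, Multiset.map_univ_val_equiv]
    rfl

lemma map_ofVec {α β : Type*} {Q : ℕ} (g : α → β) (v : Fin Q → α) :
    (ofVec v).map g = ofVec (g ∘ v) := by
  apply Subtype.ext
  exact Multiset.map_map g v Finset.univ.val

lemma qsum_ofVec {α : Type*} {Q : ℕ} (v : Fin Q → α) (g : α → ℝ) :
    qsum (ofVec v) g = ∑ i, g (v i) := by
  change (Multiset.map g (Multiset.map v Finset.univ.val)).sum = _
  rw [Multiset.map_map]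
  rfl

lemma mem_ofVec {α : Type*} {Q : ℕ} (v : Fin Q → α) (a : α) : a ∈ ofVec v ↔ ∃ i, v i = a := by
  change a ∈ Finset.univ.val.map v ↔ _
  simp

lemma qsum_nonneg {α : Type*} {Q : ℕ} (T : Sym α Q) {g : α → ℝ} (h : ∀ a, 0 ≤ g a) :
    0 ≤ qsum T g := by
  obtain ⟨v, rfl⟩ := exists_ofVec T
  rw [qsum_ofVec]
  exact Finset.sum_nonneg fun i _ => h _

lemma qsum_map {α β : Type*} {Q : ℕ} (T : Sym α Q) (f : α → β) (g : β → ℝ) :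
    qsum (T.map f) g = qsum T (g ∘ f) := by
  obtain ⟨v, rfl⟩ := exists_ofVec T
  simp [map_ofVec, qsum_ofVec]

/-- The `ℓ²` norm of a `Q`-tuple of vectors. -/
def ltwo {m Q : ℕ} (v : Fin Q → E m) : ℝ := Real.sqrt (∑ i, ‖v i‖ ^ 2)

lemma ltwo_eq_norm {m Q : ℕ} (v : Fin Q → E m) :
    ltwo v = ‖(WithLp.toLp 2 v : PiLp 2 fun _ : Fin Q => E m)‖ := by
  rw [PiLp.norm_eq_of_L2]; rfl

lemma ltwo_nonneg {m Q : ℕ} (v : Fin Q → E m) : 0 ≤ ltwo v := Real.sqrt_nonneg _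

lemma ltwo_sq {m Q : ℕ} (v : Fin Q → E m) : ltwo v ^ 2 = ∑ i, ‖v i‖ ^ 2 :=
  Real.sq_sqrt (Finset.sum_nonneg fun _ _ => sq_nonneg _)

lemma ltwo_add_le {m Q : ℕ} (v w : Fin Q → E m) : ltwo (v + w) ≤ ltwo v + ltwo w := by
  simp only [ltwo_eq_norm, WithLp.toLp_add]
  exact norm_add_le _ _

lemma ltwo_neg {m Q : ℕ} (v : Fin Q → E m) : ltwo (-v) = ltwo v := by
  simp [ltwo]

lemma ltwo_smul {m Q : ℕ} (c : ℝ) (v : Fin Q → E m) : ltwo (c • v) = |c| * ltwo v := by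
  simp only [ltwo_eq_norm, WithLp.toLp_smul, norm_smul, Real.norm_eq_abs]

lemma norm_le_ltwo {m Q : ℕ} (v : Fin Q → E m) (i : Fin Q) : ‖v i‖ ≤ ltwo v := by
  apply Real.le_sqrt_of_sq_le
  exact Finset.single_le_sum (f := fun i => ‖v i‖ ^ 2) (fun _ _ => sq_nonneg _) (Finset.mem_univ i)

lemma ltwo_le_sum {m Q : ℕ} (v : Fin Q → E m) : ltwo v ≤ ∑ i, ‖v i‖ := by
  apply Real.sqrt_le_iff.2
  exact ⟨Finset.sum_nonneg fun _ _ => norm_nonneg _,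
    Finset.sum_sq_le_sq_sum_of_nonneg fun _ _ => norm_nonneg _⟩

lemma ltwo_le_of_norm_le {m Q : ℕ} {v : Fin Q → E m} {c : ℝ} (h : ∀ i, ‖v i‖ ≤ c) :
    ltwo v ≤ Q * c := by
  refine (ltwo_le_sum v).trans ?_
  simpa using Finset.sum_le_sum fun i (_ : i ∈ Finset.univ) => h i

lemma ltwo_comp_perm {m Q : ℕ} (v : Fin Q → E m) (σ : Equiv.Perm (Fin Q)) :
    ltwo (v ∘ σ) = ltwo v := by
  unfold ltwo
  congr 1
  exact Equiv.sum_comp σ fun i => ‖v i‖ ^ 2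

/-- The ℓ² norm is permutation invariant, so the two reorderings merge into one permutation. The
infimum then runs over a finite set and is attained. -/
lemma gdist_set_eq {m Q : ℕ} (v w : Fin Q → E m) :
    {d : ℝ | ∃ v' w' : Fin Q → E m,
      ((ofVec v : AQ m Q) : Multiset (E m)) = Finset.univ.val.map v' ∧
      ((ofVec w : AQ m Q) : Multiset (E m)) = Finset.univ.val.map w' ∧
      d = Real.sqrt (∑ i, ‖v' i - w' i‖ ^ 2)} =
    Set.range fun σ : Equiv.Perm (Fin Q) => ltwo (v - w ∘ σ) := by
  ext d
  constructor
  · rintro ⟨v', w', hv, hw, rfl⟩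
    obtain ⟨σ, rfl⟩ := ofVec_eq_iff.1 (Subtype.ext hv : ofVec v = ofVec v')
    obtain ⟨τ, rfl⟩ := ofVec_eq_iff.1 (Subtype.ext hw.symm : ofVec w' = ofVec w)
    exact ⟨τ * σ, ltwo_comp_perm (v' - w ∘ τ) σ⟩
  · rintro ⟨σ, rfl⟩
    refine ⟨v, w ∘ σ, rfl, ?_, rfl⟩
    exact congrArg Subtype.val (ofVec_eq_iff.2 ⟨σ, rfl⟩ : ofVec (w ∘ σ) = ofVec w).symm

lemma gdist_ofVec_le_perm {m Q : ℕ} (v w : Fin Q → E m) (σ : Equiv.Perm (Fin Q)) :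
    gdist (ofVec v) (ofVec w) ≤ ltwo (v - w ∘ σ) := by
  unfold gdist
  rw [gdist_set_eq]
  exact csInf_le (Set.finite_range _).bddBelow ⟨σ, rfl⟩

lemma gdist_ofVec_le {m Q : ℕ} (v w : Fin Q → E m) :
    gdist (ofVec v) (ofVec w) ≤ ltwo (v - w) :=
  gdist_ofVec_le_perm v w 1

lemma exists_gdist_eq_perm {m Q : ℕ} (v w : Fin Q → E m) :
    ∃ σ : Equiv.Perm (Fin Q), gdist (ofVec v) (ofVec w) = ltwo (v - w ∘ σ) := by
  unfold gdist
  rw [gdist_set_eq]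
  obtain ⟨σ, hσ⟩ := (Set.range_nonempty _).csInf_mem
    (Set.finite_range fun σ : Equiv.Perm (Fin Q) => ltwo (v - w ∘ σ))
  exact ⟨σ, hσ.symm⟩

/-- Optimal matchings can be chained by enumerating each tuple relative to the preceding one, which
reduces the metric axioms to those of the ℓ² norm. -/
lemma exists_gdist_eq {m Q : ℕ} (v : Fin Q → E m) (T : AQ m Q) :
    ∃ w, T = ofVec w ∧ gdist (ofVec v) T = ltwo (v - w) := by
  obtain ⟨w, rfl⟩ := exists_ofVec T
  obtain ⟨σ, hσ⟩ := exists_gdist_eq_perm v w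
  exact ⟨w ∘ σ, (ofVec_eq_iff.2 ⟨σ, rfl⟩).symm, hσ⟩

lemma gdist_nonneg {m Q : ℕ} (S T : AQ m Q) : 0 ≤ gdist S T := by
  obtain ⟨v, rfl⟩ := exists_ofVec S
  obtain ⟨w, rfl, h⟩ := exists_gdist_eq v T
  exact h ▸ ltwo_nonneg _

lemma gdist_self {m Q : ℕ} (S : AQ m Q) : gdist S S = 0 := by
  obtain ⟨v, rfl⟩ := exists_ofVec S
  refine le_antisymm ((gdist_ofVec_le v v).trans ?_) (gdist_nonneg _ _)
  simp [ltwo]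

lemma gdist_comm {m Q : ℕ} (S T : AQ m Q) : gdist S T = gdist T S := by
  have key : ∀ S T : AQ m Q, gdist S T ≤ gdist T S := by
    intro S T
    obtain ⟨v, rfl⟩ := exists_ofVec T
    obtain ⟨w, rfl, h⟩ := exists_gdist_eq v S
    rw [h, ← ltwo_neg, neg_sub]
    exact gdist_ofVec_le _ _
  exact le_antisymm (key _ _) (key _ _)

lemma gdist_triangle {m Q : ℕ} (S T U : AQ m Q) : gdist S U ≤ gdist S T + gdist T U := by
  obtain ⟨v, rfl⟩ := exists_ofVec S
  obtain ⟨w, rfl, h⟩ := exists_gdist_eq v T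
  obtain ⟨z, rfl, h'⟩ := exists_gdist_eq w U
  rw [h, h']
  refine (gdist_ofVec_le _ _).trans ?_
  simpa using ltwo_add_le (v - w) (w - z)

lemma abs_gdist_sub_le {m Q : ℕ} (S T U : AQ m Q) :
    |gdist S U - gdist T U| ≤ gdist S T := by
  rw [abs_sub_le_iff]
  have h1 := gdist_triangle S T U
  have h2 := gdist_triangle T S U
  rw [gdist_comm T S] at h2
  constructor <;> linarith

lemma qzero_eq {m Q : ℕ} : qzero m Q = ofVec fun _ => 0 := by
  apply Subtype.ext
  change Multiset.replicate Q 0 = _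
  simp [ofVec]

lemma qnorm_ofVec {m Q : ℕ} (v : Fin Q → E m) : qnorm (ofVec v) = ltwo v := by
  unfold qnorm
  rw [qzero_eq]
  obtain ⟨σ, hσ⟩ := exists_gdist_eq_perm v (fun _ => 0)
  rw [hσ]
  congr 1
  ext1 i
  simp

lemma qnorm_sq {m Q : ℕ} (T : AQ m Q) : qnorm T ^ 2 = qsum T fun P => ‖P‖ ^ 2 := by
  obtain ⟨v, rfl⟩ := exists_ofVec T
  rw [qnorm_ofVec, ltwo_sq, qsum_ofVec]

lemma qnorm_eq_zero_iff {m Q : ℕ} (T : AQ m Q) : qnorm T = 0 ↔ T = qzero m Q := by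
  constructor
  · intro h
    obtain ⟨v, rfl⟩ := exists_ofVec T
    rw [qnorm_ofVec] at h
    rw [qzero_eq]
    congr 1
    ext1 i
    exact norm_le_zero_iff.1 (h ▸ norm_le_ltwo v i)
  · rintro rfl
    exact gdist_self _

/-- A countable family of points, dense in `𝒜_Q(ℝ^m)`. -/
def densePt (m Q : ℕ) (k : Fin Q → ℕ) : AQ m Q :=
  ofVec fun i => TopologicalSpace.denseSeq (E m) (k i)

lemma exists_densePt {m Q : ℕ} (T : AQ m Q) {ε : ℝ} (hε : 0 < ε) :
    ∃ k, gdist T (densePt m Q k) < ε := by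
  obtain ⟨v, rfl⟩ := exists_ofVec T
  have hδ : 0 < ε / (Q + 1) := by positivity
  have : ∀ i, ∃ k, dist (v i) (TopologicalSpace.denseSeq (E m) k) < ε / (Q + 1) := fun i =>
    (TopologicalSpace.denseRange_denseSeq (E m)).exists_dist_lt (v i) hδ
  choose k hk using this
  refine ⟨k, (gdist_ofVec_le _ _).trans_lt ?_⟩
  refine (ltwo_le_of_norm_le (c := ε / (Q + 1)) fun i => ?_).trans_lt ?_
  · have := (hk i).le
    rwa [dist_eq_norm] at this
  · rw [mul_div_assoc', div_lt_iff₀ (by positivity)]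
    nlinarith

/-- Testing with a dense point close to `T` nearly recovers the full distance. Thus the metric is a
supremum of countably many differences of real functions, the route by which scalar a.e. statements
pass to `f`. -/
lemma gdist_le_of_forall_densePt {m Q : ℕ} {S T : AQ m Q} {c : ℝ}
    (h : ∀ k, |gdist S (densePt m Q k) - gdist T (densePt m Q k)| ≤ c) : gdist S T ≤ c := by
  refine le_of_forall_pos_le_add fun ε hε => ?_
  obtain ⟨k, hk⟩ := exists_densePt T (half_pos hε)
  have h1 := gdist_triangle S (densePt m Q k) T
  rw [gdist_comm (densePt m Q k) T] at h1
  have h2 := (abs_le.1 (h k)).2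
  linarith

/-- Near `v`, the metric is computed by the trivial matching, provided that one of the two tuples
takes equal values wherever `v` does. -/
lemma exists_pos_gdist_eq {m Q : ℕ} (v : Fin Q → E m) : ∃ δ > 0, ∀ w w' : Fin Q → E m,
    (∀ i, ‖w i - v i‖ < δ) → (∀ i, ‖w' i - v i‖ < δ) → (∀ i k, v i = v k → w' i = w' k) →
    gdist (ofVec w) (ofVec w') = ltwo (w - w') := by
  have : ∃ g > 0, ∀ i k, v i ≠ v k → g ≤ ‖v i - v k‖ := by
    by_cases hne : (Finset.univ.filter fun p : Fin Q × Fin Q => v p.1 ≠ v p.2).Nonempty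
    · obtain ⟨p, hp, hmin⟩ := Finset.exists_min_image _ (fun p : Fin Q × Fin Q => ‖v p.1 - v p.2‖) hne
      refine ⟨‖v p.1 - v p.2‖, norm_pos_iff.2 (sub_ne_zero.2 (by simpa using hp)), fun i k hik => ?_⟩
      exact hmin (i, k) (by simpa using hik)
    · refine ⟨1, one_pos, fun i k hik => ?_⟩
      exact absurd ⟨(i, k), by simpa using hik⟩ hne
  obtain ⟨g, hg, hgap⟩ := this
  -- With δ this small, a matching that sends some index to a different value of `v` costs at least
  -- g - 2δ = (2Q+2)δ, whereas the trivial matching costs at most 2Qδ.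
  refine ⟨g / (2 * Q + 4), by positivity, fun w w' hw hw' hc => ?_⟩
  set δ := g / (2 * Q + 4)
  have hδ : δ * (2 * Q + 4) = g := div_mul_cancel₀ _ (by positivity)
  have hδ0 : 0 < δ := by positivity
  refine le_antisymm (gdist_ofVec_le _ _) ?_
  obtain ⟨σ, hσ⟩ := exists_gdist_eq_perm w w'
  rw [hσ]
  by_cases h : ∀ i, v (σ i) = v i
  · apply le_of_eq
    congr 1
    ext1 i
    simp [hc _ _ (h i)]
  · push Not at h
    obtain ⟨i, hi⟩ := h
    have h1 : ltwo (w - w') ≤ Q * (2 * δ) := by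
      refine ltwo_le_of_norm_le fun i => ?_
      have : (w - w') i = (w i - v i) - (w' i - v i) := by simp
      rw [this]
      exact (norm_sub_le _ _).trans (by linarith [hw i, hw' i])
    have h2 := norm_le_ltwo (w - w' ∘ σ) i
    have h3 := hgap _ _ hi
    have h4 : v (σ i) - v i = (w i - v i) - (w' (σ i) - v (σ i)) - (w - w' ∘ σ) i := by
      simp only [Pi.sub_apply, Function.comp_apply]
      abel
    have h5 : ‖v (σ i) - v i‖ ≤ δ + δ + ‖(w - w' ∘ σ) i‖ := by
      rw [h4]
      refine (norm_sub_le _ _).trans ?_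
      gcongr
      exact (norm_sub_le _ _).trans (by linarith [hw i, hw' (σ i)])
    nlinarith

/-! ### Approximate jets and points of density -/

/-- `f(x) = ∑ i, ⟦v_i⟧`, and `∑ i, ⟦v_i + L_i (y - x)⟧` approximates `f(y)` to first order as
`y → x` in `A`. -/
structure IsJetOn {n m Q : ℕ} (f : E n → AQ m Q) (A : Set (E n)) (x : E n) (v : Fin Q → E m)
    (L : Fin Q → E n →L[ℝ] E m) : Prop where
  eq_ofVec : f x = ofVec v
  consistent : ∀ i k, v i = v k → L i = L k
  isLittleO : (fun y => gdist (f y) (ofVec fun i => v i + L i (y - x))) =o[𝓝[A] x]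
    (fun y => y - x)

lemma hasDensityOne_iff_closedBall {n : ℕ} {S : Set (E n)} {x : E n} :
    HasDensityOne S x ↔ Tendsto (fun r : ℝ => volume (S ∩ Metric.closedBall x r) /
      volume (Metric.closedBall x r)) (𝓝[>] 0) (𝓝 1) := by
  refine tendsto_congr' ?_
  filter_upwards [self_mem_nhdsWithin] with r hr
  have hr' : 0 < r := hr
  have h : (Metric.ball x r : Set (E n)) =ᵐ[volume] Metric.closedBall x r :=
    ae_eq_of_subset_of_measure_ge Metric.ball_subset_closedBall
      (by rw [Measure.addHaar_ball_of_pos _ _ hr', Measure.addHaar_closedBall _ _ hr'.le])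
      measurableSet_ball.nullMeasurableSet measure_closedBall_lt_top.ne
  rw [measure_congr h, measure_congr (EventuallyEq.rfl.inter h)]

lemma ae_hasDensityOne {n : ℕ} (S : Set (E n)) (hS : NullMeasurableSet S) :
    ∀ᵐ x, x ∈ S → HasDensityOne S x := by
  rw [← ae_restrict_iff'₀ hS]
  filter_upwards [Besicovitch.ae_tendsto_measure_inter_div volume S] with x hx
  exact hasDensityOne_iff_closedBall.2 hx

lemma HasDensityOne.tendsto_diff {n : ℕ} {S : Set (E n)} {x : E n} (h : HasDensityOne S x)
    (hS : NullMeasurableSet S) :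
    Tendsto (fun r : ℝ => volume (Metric.ball x r \ S) / volume (Metric.ball x r))
      (𝓝[>] 0) (𝓝 0) := by
  have h1 := ENNReal.Tendsto.sub (tendsto_const_nhds (x := (1 : ℝ≥0∞))) h (Or.inl ENNReal.one_ne_top)
  rw [tsub_self] at h1
  refine h1.congr' ?_
  filter_upwards [self_mem_nhdsWithin] with r hr
  have hpos : volume (Metric.ball x r) ≠ 0 := (Metric.measure_ball_pos _ _ hr).ne'
  have hfin : volume (Metric.ball x r) ≠ ⊤ := measure_ball_lt_top.ne
  have h2 : volume (Metric.ball x r ∩ S) + volume (Metric.ball x r \ S) = volume (Metric.ball x r) :=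
    measure_inter_add_sdiff₀ _ hS
  rw [Set.inter_comm]
  refine ENNReal.sub_eq_of_eq_add ?_ ?_
  · exact (ENNReal.div_lt_top (measure_ne_top_of_subset Set.inter_subset_left hfin) hpos).ne
  · rw [← ENNReal.add_div, add_comm, h2, ENNReal.div_self hpos hfin]

/-- Two sets of density one at `x` have common points in any cone with vertex `x`. -/
lemma HasDensityOne.eventually_inter_ball_nonempty {n : ℕ} {S S' : Set (E n)} {x : E n}
    (h : HasDensityOne S x) (hS : NullMeasurableSet S) (h' : HasDensityOne S' x)
    (hS' : NullMeasurableSet S') (a : E n) {ε : ℝ} (hε : 0 < ε) :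
    ∀ᶠ t in 𝓝[>] (0 : ℝ), (S ∩ S' ∩ Metric.ball (x + t • a) (t * ε)).Nonempty := by
  set R := ‖a‖ + ε with hR
  have hR0 : 0 < R := by positivity
  -- Half of the volume fraction that the small ball occupies in the ball of radius tR around `x`.
  -- If both complements have fraction below `c`, they cannot cover the small ball.
  set c : ℝ≥0∞ := ENNReal.ofReal ((ε / R) ^ n) / 2 with hc
  have hc0 : 0 < c := by
    apply ENNReal.div_pos _ (by simp)
    have : 0 < (ε / R) ^ n := by positivity
    simpa using this
  have hlim : Tendsto (fun t : ℝ => t * R) (𝓝[>] 0) (𝓝[>] 0) := by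
    refine tendsto_nhdsWithin_iff.2 ⟨?_, ?_⟩
    · have : Tendsto (fun t : ℝ => t * R) (𝓝 0) (𝓝 (0 * R)) := tendsto_id.mul_const R
      rw [zero_mul] at this
      exact this.mono_left nhdsWithin_le_nhds
    · filter_upwards [self_mem_nhdsWithin] with t ht
      exact mul_pos ht hR0
  filter_upwards [self_mem_nhdsWithin, ((h.tendsto_diff hS).comp hlim).eventually_lt_const hc0,
    ((h'.tendsto_diff hS').comp hlim).eventually_lt_const hc0] with t ht h1 h2
  have ht : 0 < t := ht
  simp only [Function.comp_apply] at h1 h2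
  set B := Metric.ball x (t * R) with hB
  have hBpos : volume B ≠ 0 := (Metric.measure_ball_pos _ _ (mul_pos ht hR0)).ne'
  have hBfin : volume B ≠ ⊤ := measure_ball_lt_top.ne
  rw [ENNReal.div_lt_iff (Or.inl hBpos) (Or.inl hBfin)] at h1 h2
  by_contra hempty
  rw [Set.not_nonempty_iff_eq_empty] at hempty
  have hsub : Metric.ball (x + t • a) (t * ε) ⊆ (B \ S) ∪ (B \ S') := by
    intro y hy
    have hyB : y ∈ B := by
      rw [hB, Metric.mem_ball, dist_eq_norm]
      rw [Metric.mem_ball, dist_eq_norm] at hy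
      have : y - x = (y - (x + t • a)) + t • a := by abel
      rw [this]
      refine (norm_add_le _ _).trans_lt ?_
      rw [norm_smul, Real.norm_eq_abs, abs_of_pos ht]
      rw [hR]; linarith
    by_cases hyS : y ∈ S
    · by_cases hyS' : y ∈ S'
      · exact absurd (show y ∈ S ∩ S' ∩ Metric.ball (x + t • a) (t * ε) from ⟨⟨hyS, hyS'⟩, hy⟩)
          (by rw [hempty]; exact Set.notMem_empty _)
      · exact Or.inr ⟨hyB, hyS'⟩
    · exact Or.inl ⟨hyB, hyS⟩
  have hvol : volume (Metric.ball (x + t • a) (t * ε)) = (c + c) * volume B := by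
    rw [hc, ENNReal.add_halves, hB, Measure.addHaar_ball_of_pos _ _ (mul_pos ht hε),
      Measure.addHaar_ball_of_pos _ _ (mul_pos ht hR0), ← mul_assoc,
      ← ENNReal.ofReal_mul (by positivity)]
    congr 2
    simp only [finrank_euclideanSpace, Fintype.card_fin]
    rw [← mul_pow]
    congr 1
    field_simp
  have h3 := (measure_mono (μ := volume) hsub).trans (measure_union_le _ _)
  rw [hvol, add_mul] at h3
  exact absurd h3 (not_le.2 (ENNReal.add_lt_add h1 h2))

/-- Permits difference quotients in every direction `a` using only points of the two density sets.
-/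
lemma HasDensityOne.exists_seq {n : ℕ} {S S' : Set (E n)} {x : E n}
    (h : HasDensityOne S x) (hS : NullMeasurableSet S) (h' : HasDensityOne S' x)
    (hS' : NullMeasurableSet S') (a : E n) :
    ∃ (y : ℕ → E n) (t : ℕ → ℝ), (∀ k, 0 < t k) ∧ Tendsto t atTop (𝓝 0) ∧
      Tendsto y atTop (𝓝[S ∩ S'] x) ∧ Tendsto (fun k => (t k)⁻¹ • (y k - x)) atTop (𝓝 a) := by
  have key : ∀ k : ℕ, ∃ (t : ℝ) (y : E n), 0 < t ∧ t < 1 / ((k : ℝ) + 1) ∧ y ∈ S ∩ S' ∧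
      ‖y - (x + t • a)‖ ≤ t * (1 / ((k : ℝ) + 1)) := by
    intro k
    have hk : (0 : ℝ) < 1 / ((k : ℝ) + 1) := by positivity
    have h1 := h.eventually_inter_ball_nonempty hS h' hS' a hk
    obtain ⟨t, ⟨y, hy, hyb⟩, ht⟩ := (h1.and (Ioo_mem_nhdsGT hk)).exists
    refine ⟨t, y, ht.1, ht.2, hy, ?_⟩
    rw [← dist_eq_norm]
    exact (Metric.mem_ball.1 hyb).le
  choose t y ht0 ht hy hyt using key
  have hlim := tendsto_one_div_add_atTop_nhds_zero_nat (𝕜 := ℝ)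
  have htlim : Tendsto t atTop (𝓝 0) := squeeze_zero (fun k => (ht0 k).le) (fun k => (ht k).le) hlim
  have hd : Tendsto (fun k => (t k)⁻¹ • (y k - x)) atTop (𝓝 a) := by
    rw [tendsto_iff_norm_sub_tendsto_zero]
    refine squeeze_zero (fun k => norm_nonneg _) (fun k => ?_) hlim
    have h1 : (t k)⁻¹ • (y k - x) - a = (t k)⁻¹ • (y k - (x + t k • a)) := by
      rw [sub_add_eq_sub_sub, smul_sub _ (y k - x), smul_smul, inv_mul_cancel₀ (ht0 k).ne', one_smul]
    rw [h1, norm_smul, norm_inv, Real.norm_eq_abs, abs_of_pos (ht0 k), inv_mul_le_iff₀ (ht0 k)]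
    exact hyt k
  refine ⟨y, t, ht0, htlim, tendsto_nhdsWithin_iff.2 ⟨?_, .of_forall hy⟩, hd⟩
  have h2 := (htlim.smul hd).const_add x
  simp only [zero_smul, add_zero] at h2
  refine h2.congr fun k => ?_
  rw [smul_smul, mul_inv_cancel₀ (ht0 k).ne', one_smul]
  abel

lemma ofVec_comp_perm {α : Type*} {Q : ℕ} (v : Fin Q → α) (σ : Equiv.Perm (Fin Q)) :
    ofVec (v ∘ σ) = ofVec v := ofVec_eq_iff.2 ⟨σ, rfl⟩

lemma tendsto_jet_norm {n m Q : ℕ} (L : Fin Q → E n →L[ℝ] E m) :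
    Tendsto (fun h => ltwo fun i => L i h) (𝓝 0) (𝓝 0) := by
  have hcont : Continuous fun h => ltwo fun i => L i h := by
    unfold ltwo
    fun_prop
  have := hcont.tendsto 0
  simpa [ltwo] using this

/-- For small `h`, first order expansions with the same values are matched trivially. -/
lemma eventually_gdist_jet_eq {n m Q : ℕ} (v : Fin Q → E m) (L L' : Fin Q → E n →L[ℝ] E m)
    (hL' : ∀ i k, v i = v k → L' i = L' k) :
    ∀ᶠ h in 𝓝 (0 : E n), gdist (ofVec fun i => v i + L i h) (ofVec fun i => v i + L' i h) =
      ltwo fun i => L i h - L' i h := by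
  obtain ⟨δ, hδ, key⟩ := exists_pos_gdist_eq v
  filter_upwards [(tendsto_jet_norm L).eventually_lt_const hδ,
    (tendsto_jet_norm L').eventually_lt_const hδ] with h h1 h2
  rw [key (fun i => v i + L i h) (fun i => v i + L' i h)]
  · congr 1
    ext1 i
    simp
  · intro i
    simpa using (norm_le_ltwo (fun i => L i h) i).trans_lt h1
  · intro i
    simpa using (norm_le_ltwo (fun i => L' i h) i).trans_lt h2
  · intro i k hik
    simp only [hik, hL' i k hik]

lemma tendsto_inv_mul_of_isLittleO {n : ℕ} {g t : ℕ → ℝ} {d : ℕ → E n} {a : E n}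
    (h : g =o[atTop] d) (hd : Tendsto (fun k => (t k)⁻¹ • d k) atTop (𝓝 a)) :
    Tendsto (fun k => (t k)⁻¹ * g k) atTop (𝓝 0) := by
  have h1 := ((isBigO_refl (fun k => (t k)⁻¹) atTop).smul_isLittleO h).trans_isBigO
    (hd.isBigO_one ℝ)
  exact (isLittleO_one_iff ℝ).1 h1

/-- Approximate jets are unique. -/
lemma IsJetOn.unique {n m Q : ℕ} {f : E n → AQ m Q} {S S' : Set (E n)} {x : E n}
    {v v' : Fin Q → E m} {L L' : Fin Q → E n →L[ℝ] E m}
    (hJ : IsJetOn f S x v L) (hJ' : IsJetOn f S' x v' L')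
    (h : HasDensityOne S x) (hS : NullMeasurableSet S) (h' : HasDensityOne S' x)
    (hS' : NullMeasurableSet S') :
    ofVec (fun i => (v i, L i)) = ofVec (fun i => (v' i, L' i)) := by
  obtain ⟨σ, rfl⟩ := ofVec_eq_iff.1 (hJ.eq_ofVec.symm.trans hJ'.eq_ofVec)
  suffices hL : L = L' ∘ σ by
    have : (fun i => ((v' ∘ σ) i, L i)) = (fun i => (v' i, L' i)) ∘ σ := by
      ext1 i
      simp [hL]
    rw [this]
    exact (ofVec_comp_perm _ _)
  have hc : ∀ i k, v' (σ i) = v' (σ k) → (L' ∘ σ) i = (L' ∘ σ) k :=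
    fun i k hik => hJ'.consistent _ _ hik
  have hd : ∀ᶠ y in 𝓝[S ∩ S'] x, gdist (ofVec fun i => (v' ∘ σ) i + L i (y - x))
      (ofVec fun i => (v' ∘ σ) i + (L' ∘ σ) i (y - x)) =
      ltwo fun i => L i (y - x) - (L' ∘ σ) i (y - x) := by
    have h0 : Tendsto (fun y => y - x) (𝓝[S ∩ S'] x) (𝓝 0) := by
      have : Tendsto (fun y => y - x) (𝓝 x) (𝓝 (x - x)) := tendsto_id.sub_const x
      rw [sub_self] at this
      exact this.mono_left nhdsWithin_le_nhds
    exact h0.eventually (eventually_gdist_jet_eq (v' ∘ σ) L (L' ∘ σ) hc)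
  have ho : (fun y => ltwo fun i => L i (y - x) - (L' ∘ σ) i (y - x)) =o[𝓝[S ∩ S'] x]
      (fun y => y - x) := by
    have h1 := (hJ.isLittleO.mono (nhdsWithin_mono x Set.inter_subset_left)).add
      (hJ'.isLittleO.mono (nhdsWithin_mono x (Set.inter_subset_right (s := S))))
    refine IsBigO.trans_isLittleO (.of_bound 1 ?_) h1
    filter_upwards [hd] with y hy
    rw [← hy, one_mul, Real.norm_of_nonneg (gdist_nonneg _ _),
      Real.norm_of_nonneg (add_nonneg (gdist_nonneg _ _) (gdist_nonneg _ _))]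
    have h2 := gdist_triangle (ofVec fun i => (v' ∘ σ) i + L i (y - x)) (f y)
      (ofVec fun i => v' i + L' i (y - x))
    rw [gdist_comm _ (f y)] at h2
    have h3 : (ofVec fun i => (v' ∘ σ) i + (L' ∘ σ) i (y - x)) =
        ofVec fun i => v' i + L' i (y - x) :=
      ofVec_comp_perm (fun i => v' i + L' i (y - x)) σ
    rw [h3]
    exact h2
  -- The left side is homogeneous of degree one in y - x, so dividing by t_k along a sequence with
  -- limiting direction `a` evaluates it at `a`.
  obtain hz : ∀ a, (ltwo fun i => L i a - (L' ∘ σ) i a) = 0 := by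
    intro a
    obtain ⟨y, t, ht0, htlim, hy, hya⟩ := h.exists_seq hS h' hS' a
    have h4 := tendsto_inv_mul_of_isLittleO (ho.comp_tendsto hy) hya
    have hcont : Continuous fun a => ltwo fun i => L i a - (L' ∘ σ) i a := by
      unfold ltwo
      fun_prop
    refine tendsto_nhds_unique ((hcont.tendsto a).comp hya) (h4.congr fun k => ?_)
    have h5 := ltwo_smul (t k)⁻¹ fun i => L i (y k - x) - (L' ∘ σ) i (y k - x)
    rw [abs_of_pos (inv_pos.2 (ht0 k))] at h5
    simp only [Function.comp_apply] at h5 ⊢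
    rw [← h5]
    congr 1
    ext1 i
    simp [smul_sub]
  ext1 i
  ext1 a
  exact sub_eq_zero.1 (norm_le_zero_iff.1
    ((norm_le_ltwo (fun i => L i a - (L' ∘ σ) i a) i).trans_eq (hz a)))

/-- A nonnegative function that vanishes at a point of density and is differentiable there has
derivative zero. -/
lemma isLittleO_of_nonneg_of_hasDensityOne {n : ℕ} {A : Set (E n)} {x : E n} {g : E n → ℝ}
    (h : HasDensityOne A x) (hA : NullMeasurableSet A) (hg : ∀ y, 0 ≤ g y) (hgx : g x = 0)
    (hd : DifferentiableWithinAt ℝ g A x) : g =o[𝓝[A] x] fun y => y - x := by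
  obtain ⟨l, hl⟩ := hd
  have hl' : (fun y => g y - l (y - x)) =o[𝓝[A] x] fun y => y - x := by
    simpa [hgx] using hl.isLittleO
  -- The quotients g(y_k)/t_k are nonnegative and converge to l(a). Applying this to -a as well
  -- forces l = 0.
  have key : ∀ a, 0 ≤ l a := by
    intro a
    obtain ⟨y, t, ht0, htlim, hy, hya⟩ := h.exists_seq hA h hA a
    rw [Set.inter_self] at hy
    have h4 := tendsto_inv_mul_of_isLittleO (hl'.comp_tendsto hy) hya
    have h5 := h4.add ((l.continuous.tendsto a).comp hya)
    rw [zero_add] at h5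
    refine ge_of_tendsto' h5 fun k => ?_
    have : 0 ≤ (t k)⁻¹ * g (y k) := mul_nonneg (inv_pos.2 (ht0 k)).le (hg _)
    simpa [mul_sub] using this
  have hl0 : ∀ a, l a = 0 := by
    intro a
    have := key (-a)
    rw [map_neg] at this
    linarith [key a]
  simpa [hl0] using hl'

/-! ### Cluster functions and a Rademacher theorem -/

/-- A cutoff that localizes to the ball of radius `2ρ` around `q`. -/
def tent {m : ℕ} (q : E m) (ρ : ℝ) (p : E m) : ℝ := max 0 (2 * ρ - ‖p - q‖)

/-- The `j`-th coordinate of `p - q`, truncated outside of the ball of radius `ρ` around `q`. -/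
def truncCoord {m : ℕ} (q : E m) (ρ : ℝ) (j : Fin m) (p : E m) : ℝ :=
  max (-tent q ρ p) (min (tent q ρ p) ((p - q) j))

/-- The distance between two points close to `q`. -/
def truncDist {m : ℕ} (q : E m) (ρ : ℝ) (p p' : E m) : ℝ :=
  min (min ‖p - p'‖ (tent q ρ p)) (tent q ρ p')

lemma tent_nonneg {m : ℕ} (q : E m) (ρ : ℝ) (p : E m) : 0 ≤ tent q ρ p := le_max_left _ _

lemma abs_tent_sub_le {m : ℕ} (q : E m) (ρ : ℝ) (p r : E m) :
    |tent q ρ p - tent q ρ r| ≤ ‖p - r‖ := by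
  refine (abs_max_sub_max_le_max _ _ _ _).trans ?_
  rw [sub_self, abs_zero]
  refine max_le (norm_nonneg _) ?_
  have h1 : 2 * ρ - ‖p - q‖ - (2 * ρ - ‖r - q‖) = ‖r - q‖ - ‖p - q‖ := by ring
  rw [h1]
  refine (abs_norm_sub_norm_le _ _).trans_eq ?_
  rw [sub_sub_sub_cancel_right, norm_sub_rev]

lemma abs_truncCoord_sub_le {m : ℕ} (q : E m) (ρ : ℝ) (j : Fin m) (p r : E m) :
    |truncCoord q ρ j p - truncCoord q ρ j r| ≤ ‖p - r‖ := by
  have h := abs_tent_sub_le q ρ p r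
  refine (abs_max_sub_max_le_max _ _ _ _).trans (max_le ?_ ?_)
  · rwa [neg_sub_neg, abs_sub_comm]
  · refine (abs_min_sub_min_le_max _ _ _ _).trans (max_le h ?_)
    have : (p - q) j - (r - q) j = (p - r) j := by simp
    rw [this]
    exact PiLp.norm_apply_le (p - r) j

lemma truncDist_nonneg {m : ℕ} (q : E m) (ρ : ℝ) (p p' : E m) : 0 ≤ truncDist q ρ p p' :=
  le_min (le_min (norm_nonneg _) (tent_nonneg _ _ _)) (tent_nonneg _ _ _)

lemma abs_truncDist_sub_le {m : ℕ} (q : E m) (ρ : ℝ) (p p' r r' : E m) :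
    |truncDist q ρ p p' - truncDist q ρ r r'| ≤ ‖p - r‖ + ‖p' - r'‖ := by
  have h := abs_tent_sub_le q ρ p r
  have h' := abs_tent_sub_le q ρ p' r'
  have h1 := norm_nonneg (p - r)
  have h2 := norm_nonneg (p' - r')
  refine (abs_min_sub_min_le_max _ _ _ _).trans (max_le ?_ (by linarith))
  refine (abs_min_sub_min_le_max _ _ _ _).trans (max_le ?_ (by linarith))
  refine (abs_norm_sub_norm_le _ _).trans ?_
  have : p - p' - (r - r') = (p - r) - (p' - r') := by abel
  rw [this]
  exact norm_sub_le _ _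

/-- Compare the two values along an optimal matching, where each |v_i - w_i| is at most the distance
of the tuples. -/
lemma abs_sum_sub_le_gdist {m Q : ℕ} {F : (Fin Q → E m) → ℝ} {C : ℝ} (hC : 0 ≤ C)
    (hF : ∀ v w, |F v - F w| ≤ C * ∑ i, ‖v i - w i‖) {G : AQ m Q → ℝ}
    (hG : ∀ v, G (ofVec v) = F v) (S T : AQ m Q) : |G S - G T| ≤ C * Q * gdist S T := by
  obtain ⟨v, rfl⟩ := exists_ofVec S
  obtain ⟨w, rfl, h⟩ := exists_gdist_eq v T
  rw [hG, hG, h, mul_assoc]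
  refine (hF v w).trans ?_
  gcongr
  simpa using Finset.sum_le_sum fun i (_ : i ∈ Finset.univ) => norm_le_ltwo (v - w) i

/-- The sum of the `j`-th coordinates (centred at `q`) of the points close to `q`. -/
def clusterSum {m Q : ℕ} (q : E m) (ρ : ℝ) (j : Fin m) (T : AQ m Q) : ℝ :=
  qsum T (truncCoord q ρ j)

/-- The sum of the mutual distances of the points close to `q`. -/
def clusterSpread {m Q : ℕ} (q : E m) (ρ : ℝ) (T : AQ m Q) : ℝ :=
  qsum T fun p => qsum T fun p' => truncDist q ρ p p'

lemma abs_clusterSum_sub_le {m Q : ℕ} (q : E m) (ρ : ℝ) (j : Fin m) (S T : AQ m Q) :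
    |clusterSum q ρ j S - clusterSum q ρ j T| ≤ 1 * Q * gdist S T := by
  refine abs_sum_sub_le_gdist zero_le_one (F := fun v => ∑ i, truncCoord q ρ j (v i))
    (fun v w => ?_) (fun v => qsum_ofVec _ _) S T
  rw [one_mul, ← Finset.sum_sub_distrib]
  exact (Finset.abs_sum_le_sum_abs _ _).trans
    (Finset.sum_le_sum fun i _ => abs_truncCoord_sub_le _ _ _ _ _)

lemma clusterSpread_ofVec {m Q : ℕ} (q : E m) (ρ : ℝ) (v : Fin Q → E m) :
    clusterSpread q ρ (ofVec v) = ∑ i, ∑ k, truncDist q ρ (v i) (v k) := by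
  simp only [clusterSpread, qsum_ofVec]

lemma abs_clusterSpread_sub_le {m Q : ℕ} (q : E m) (ρ : ℝ) (S T : AQ m Q) :
    |clusterSpread q ρ S - clusterSpread q ρ T| ≤ (2 * Q) * Q * gdist S T := by
  refine abs_sum_sub_le_gdist (by positivity) (fun v w => ?_) (clusterSpread_ofVec q ρ) S T
  rw [← Finset.sum_sub_distrib]
  refine (Finset.abs_sum_le_sum_abs _ _).trans ?_
  calc ∑ i, |∑ k, truncDist q ρ (v i) (v k) - ∑ k, truncDist q ρ (w i) (w k)|
      ≤ ∑ i, ∑ k, (‖v i - w i‖ + ‖v k - w k‖) := by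
        refine Finset.sum_le_sum fun i _ => ?_
        rw [← Finset.sum_sub_distrib]
        exact (Finset.abs_sum_le_sum_abs _ _).trans
          (Finset.sum_le_sum fun k _ => abs_truncDist_sub_le _ _ _ _ _ _)
    _ = _ := by
        simp only [Finset.sum_add_distrib, Finset.sum_const, Finset.card_univ, Fintype.card_fin,
          nsmul_eq_mul, ← Finset.mul_sum]
        ring

lemma clusterSpread_nonneg {m Q : ℕ} (q : E m) (ρ : ℝ) (T : AQ m Q) : 0 ≤ clusterSpread q ρ T :=
  qsum_nonneg _ fun _ => qsum_nonneg _ fun _ => truncDist_nonneg _ _ _ _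

/-- Centres and radii come from countable families, so that the exceptional null sets can be united.
Under perturbations below ρ/4 the points of the cluster stay within 3ρ/4 of the centre, where the
tent exceeds their coordinates, and all others stay outside the radius 2ρ, where the tent vanishes.
-/
lemma exists_isolating_ball {m Q : ℕ} (v : Fin Q → E m) (p : E m) : ∃ a b : ℕ,
    ‖p - TopologicalSpace.denseSeq (E m) a‖ < 1 / ((b : ℝ) + 1) / 2 ∧
    ∀ l, v l ≠ p → 7 / 2 * (1 / ((b : ℝ) + 1)) ≤ ‖v l - TopologicalSpace.denseSeq (E m) a‖ := by
  have : ∃ g > 0, ∀ l, v l ≠ p → g ≤ ‖v l - p‖ := by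
    by_cases hne : (Finset.univ.filter fun l => v l ≠ p).Nonempty
    · obtain ⟨l, hl, hmin⟩ := Finset.exists_min_image _ (fun l => ‖v l - p‖) hne
      exact ⟨‖v l - p‖, norm_pos_iff.2 (sub_ne_zero.2 (by simpa using hl)), fun k hk =>
        hmin k (by simpa using hk)⟩
    · exact ⟨1, one_pos, fun l hl => absurd ⟨l, by simpa using hl⟩ hne⟩
  obtain ⟨g, hg, hgap⟩ := this
  obtain ⟨b, hb⟩ := exists_nat_one_div_lt (show 0 < g / 4 by positivity)
  set ρ := 1 / ((b : ℝ) + 1)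
  have hρ : 0 < ρ := by positivity
  obtain ⟨a, ha⟩ := (TopologicalSpace.denseRange_denseSeq (E m)).exists_dist_lt p (half_pos hρ)
  rw [dist_eq_norm] at ha
  refine ⟨a, b, ha, fun l hl => ?_⟩
  have h1 := hgap l hl
  have h2 : ‖v l - p‖ ≤ ‖v l - TopologicalSpace.denseSeq (E m) a‖ +
      ‖p - TopologicalSpace.denseSeq (E m) a‖ := by
    have : v l - p = (v l - TopologicalSpace.denseSeq (E m) a) -
      (p - TopologicalSpace.denseSeq (E m) a) := by abel
    rw [this]
    exact norm_sub_le _ _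
  linarith

/-- The points of a tuple `w` close to `v` that belong to the cluster of `v` at `p`. -/
lemma cluster_formulas {m Q : ℕ} {v w : Fin Q → E m} {p q : E m} {ρ : ℝ}
    (hp : ‖p - q‖ < ρ / 2) (hv : ∀ l, v l ≠ p → 7 / 2 * ρ ≤ ‖v l - q‖)
    (hw : ∀ l, ‖w l - v l‖ < ρ / 4) :
    (∀ j, clusterSum q ρ j (ofVec w) =
      ∑ l ∈ Finset.univ.filter (fun l => v l = p), (w l - q) j) ∧
    ∀ i, v i = p → ∑ l ∈ Finset.univ.filter (fun l => v l = p), ‖w i - w l‖ ≤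
      clusterSpread q ρ (ofVec w) := by
  have hρ : 0 < ρ := by linarith [norm_nonneg (p - q)]
  have hin : ∀ l, v l = p → ‖w l - q‖ < 3 / 4 * ρ := by
    intro l hl
    have : w l - q = (w l - v l) + (p - q) := by rw [hl]; abel
    rw [this]
    exact (norm_add_le _ _).trans_lt (by linarith [hw l])
  have htin : ∀ l, v l = p → 5 / 4 * ρ ≤ tent q ρ (w l) := fun l hl =>
    le_max_of_le_right (by linarith [hin l hl])
  have htout : ∀ l, v l ≠ p → tent q ρ (w l) = 0 := by
    intro l hl
    have h1 : ‖v l - q‖ ≤ ‖w l - q‖ + ‖w l - v l‖ := by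
      have : v l - q = (w l - q) - (w l - v l) := by abel
      rw [this]
      exact norm_sub_le _ _
    exact max_eq_left (by linarith [hv l hl, hw l])
  have hdist : ∀ i l, v i = p → v l = p → ‖w i - w l‖ ≤ ρ / 2 := by
    intro i l hi hl
    have : w i - w l = (w i - v i) - (w l - v l) := by rw [hi, hl]; abel
    rw [this]
    exact (norm_sub_le _ _).trans (by linarith [hw i, hw l])
  constructor
  · intro j
    rw [clusterSum, qsum_ofVec, Finset.sum_filter]
    refine Finset.sum_congr rfl fun l _ => ?_
    split_ifs with hl
    · have h1 : |(w l - q) j| ≤ ‖w l - q‖ := PiLp.norm_apply_le (w l - q) j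
      have h2 := abs_le.1 h1
      rw [truncCoord, min_eq_right (by linarith [hin l hl, htin l hl]),
        max_eq_right (by linarith [hin l hl, htin l hl])]
    · rw [truncCoord, htout l hl, neg_zero]
      rcases le_total ((w l - q) j) 0 with h | h
      · rw [min_eq_right h, max_eq_left h]
      · rw [min_eq_left h, max_self]
  · intro i hi
    rw [clusterSpread_ofVec]
    refine le_trans ?_ (Finset.single_le_sum (f := fun i => ∑ k, truncDist q ρ (w i) (w k))
      (fun i _ => Finset.sum_nonneg fun k _ => truncDist_nonneg _ _ _ _) (Finset.mem_univ i))
    rw [Finset.sum_filter]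
    refine Finset.sum_le_sum fun l _ => ?_
    split_ifs with hl
    · rw [truncDist, min_eq_left (a := ‖w i - w l‖), min_eq_left]
      · linarith [hdist i l hi hl, htin l hl]
      · linarith [hdist i l hi hl, htin i hi]
    · exact truncDist_nonneg _ _ _ _

/-- A `Q`-valued map that is Lipschitz on `A` is differentiable at every point of density of `A`
where countably many real functions of it are. -/
lemma exists_isJetOn_of_differentiableWithinAt {n m Q : ℕ} {f : E n → AQ m Q} {A : Set (E n)}
    {x : E n} {C : ℝ} (hA : NullMeasurableSet A) (hxA : HasDensityOne A x)
    (hx : x ∈ A) (hf : ∀ y ∈ A, ∀ z ∈ A, gdist (f y) (f z) ≤ C * ‖y - z‖)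
    (h1 : ∀ (a b : ℕ) (j : Fin m), DifferentiableWithinAt ℝ (fun y => clusterSum
      (TopologicalSpace.denseSeq (E m) a) (1 / ((b : ℝ) + 1)) j (f y)) A x)
    (h2 : ∀ (a b : ℕ), DifferentiableWithinAt ℝ (fun y => clusterSpread
      (TopologicalSpace.denseSeq (E m) a) (1 / ((b : ℝ) + 1)) (f y)) A x) :
    ∃ v L, IsJetOn f A x v L := by
  classical
  obtain ⟨v, hv⟩ := exists_ofVec (f x)
  choose a b hab hsep using exists_isolating_ball v
  set q : E m → E m := fun p => TopologicalSpace.denseSeq (E m) (a p) with hq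
  set ρ : E m → ℝ := fun p => 1 / ((b p : ℝ) + 1) with hρ
  have hρ0 : ∀ p, 0 < ρ p := fun p => by simp only [hρ]; positivity
  set M : E m → E n → E m := fun p y =>
    WithLp.toLp 2 fun j => clusterSum (q p) (ρ p) j (f y) with hM
  have hMd : ∀ p, DifferentiableWithinAt ℝ (M p) A x := fun p =>
    differentiableWithinAt_euclidean.2 fun j => h1 (a p) (b p) j
  choose M' hM' using hMd
  set N : E m → ℝ := fun p => (Finset.univ.filter fun l => v l = p).card with hN
  -- All sheets through the same value get the derivative of their barycentre: the derivative of the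
  -- cluster sum divided by the multiplicity.
  refine ⟨v, fun i => (N (v i))⁻¹ • M' (v i), hv, fun i k hik => by rw [hik], ?_⟩
  have hnear : ∀ δ : ℝ, 0 < δ → ∀ᶠ y in 𝓝[A] x, gdist (f x) (f y) < δ := by
    intro δ hδ
    have h0 : Tendsto (fun y => C * ‖x - y‖) (𝓝[A] x) (𝓝 0) := by
      have : Continuous fun y : E n => C * ‖x - y‖ := by fun_prop
      have := this.tendsto x
      simp only [sub_self, norm_zero, mul_zero] at this
      exact this.mono_left nhdsWithin_le_nhds
    filter_upwards [h0.eventually_lt_const hδ, self_mem_nhdsWithin] with y hy hyA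
    exact (hf x hx y hyA).trans_lt hy
  set err : E n → ℝ := fun y => ∑ i, (clusterSpread (q (v i)) (ρ (v i)) (f y) +
    ‖M (v i) y - M (v i) x - M' (v i) (y - x)‖) with herr
  have hsum : ∀ {w : Fin Q → E m}, (∀ i l, ‖w l - v l‖ < ρ (v i) / 4) → ∀ i,
      (WithLp.toLp 2 fun j => clusterSum (q (v i)) (ρ (v i)) j (ofVec w) : E m) =
        ∑ l ∈ Finset.univ.filter (fun l => v l = v i), (w l - q (v i)) := by
    intro w hw i
    ext j
    refine ((cluster_formulas (hab (v i)) (hsep (v i)) (hw i)).1 j).trans ?_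
    simp [hq]
  have herr0 : err =o[𝓝[A] x] fun y => y - x := by
    refine IsLittleO.fun_sum fun i _ => IsLittleO.add ?_ ?_
    · refine isLittleO_of_nonneg_of_hasDensityOne hxA hA (fun _ => clusterSpread_nonneg _ _ _) ?_
        (h2 _ _)
      rw [hv, clusterSpread_ofVec]
      refine Finset.sum_eq_zero fun k _ => Finset.sum_eq_zero fun l _ => ?_
      refine le_antisymm ?_ (truncDist_nonneg _ _ _ _)
      by_cases hkl : v k = v l
      · refine (min_le_left _ _).trans ((min_le_left _ _).trans ?_)
        rw [hkl, sub_self, norm_zero]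
      · have ht : ∀ l, v l ≠ v i → tent (q (v i)) (ρ (v i)) (v l) = 0 := fun l hl =>
          max_eq_left (by linarith [hsep (v i) l hl, hρ0 (v i)])
        by_cases hk : v k = v i
        · exact (min_le_right _ _).trans_eq (ht l fun h => hkl (hk.trans h.symm))
        · exact (min_le_left _ _).trans ((min_le_right _ _).trans_eq (ht k hk))
    · exact (hM' (v i)).isLittleO.norm_left
  refine IsBigO.trans_isLittleO (.of_bound 1 ?_) herr0
  have hmin : ∃ δ > 0, ∀ i, δ ≤ ρ (v i) / 4 := by
    rcases isEmpty_or_nonempty (Fin Q) with hQ | hQ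
    · exact ⟨1, one_pos, fun i => isEmptyElim i⟩
    · obtain ⟨i, hi⟩ := Finite.exists_min fun i => ρ (v i) / 4
      exact ⟨ρ (v i) / 4, by linarith [hρ0 (v i)], hi⟩
  obtain ⟨δ, hδ, hδle⟩ := hmin
  filter_upwards [hnear δ hδ] with y hy
  rw [hv] at hy
  obtain ⟨w, hw, hvw⟩ := exists_gdist_eq v (f y)
  have hwv : ∀ l, ‖w l - v l‖ < δ := by
    intro l
    rw [norm_sub_rev]
    exact (norm_le_ltwo (v - w) l).trans_lt (hvw ▸ hy)
  have hw4 : ∀ i l, ‖w l - v l‖ < ρ (v i) / 4 := fun i l => (hwv l).trans_le (hδle i)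
  have hv4 : ∀ i l, ‖v l - v l‖ < ρ (v i) / 4 := fun i l => by
    rw [sub_self, norm_zero]; linarith [hρ0 (v i)]
  rw [one_mul, Real.norm_of_nonneg (gdist_nonneg _ _)]
  refine le_trans ?_ (le_abs_self _)
  rw [hw]
  refine (gdist_ofVec_le _ _).trans ((ltwo_le_sum _).trans (Finset.sum_le_sum fun i _ => ?_))
  have hNi : 1 ≤ N (v i) := by
    have : 0 < (Finset.univ.filter fun l => v l = v i).card :=
      Finset.card_pos.2 ⟨i, by simp⟩
    exact Nat.one_le_cast.2 this
  -- The error of one sheet splits into its deviation from the other sheets of its cluster, bounded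
  -- by the spread, and the linearization error of the cluster sum. The spread is nonnegative and
  -- vanishes at `x`, so it is o(|y - x|).
  have hcl : N (v i) • (w i - (v i + ((N (v i))⁻¹ • M' (v i)) (y - x))) =
      ∑ l ∈ Finset.univ.filter (fun l => v l = v i), (w i - w l) +
        (M (v i) y - M (v i) x - M' (v i) (y - x)) := by
    have e1 : M (v i) y = ∑ l ∈ Finset.univ.filter (fun l => v l = v i), (w l - q (v i)) := by
      simp only [hM, hw]
      exact hsum hw4 i
    have e2 : M (v i) x = ∑ l ∈ Finset.univ.filter (fun l => v l = v i), (v i - q (v i)) := by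
      simp only [hM, hv]
      rw [hsum hv4 i]
      refine Finset.sum_congr rfl fun l hl => ?_
      rw [(Finset.mem_filter.1 hl).2]
    rw [e1, e2]
    simp only [Finset.sum_sub_distrib, Finset.sum_const, ← Nat.cast_smul_eq_nsmul ℝ,
      _root_.smul_apply, smul_sub, smul_add, smul_smul]
    rw [mul_inv_cancel₀ (by linarith), one_smul]
    simp only [hN]
    abel
  have hcl2 : ‖(w - fun i => v i + ((N (v i))⁻¹ • M' (v i)) (y - x)) i‖ ≤
      ‖N (v i) • (w i - (v i + ((N (v i))⁻¹ • M' (v i)) (y - x)))‖ := by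
    rw [norm_smul, Real.norm_of_nonneg (by linarith)]
    exact le_mul_of_one_le_left (norm_nonneg _) hNi
  refine hcl2.trans ?_
  rw [hcl]
  refine (norm_add_le _ _).trans (add_le_add ?_ le_rfl)
  refine (norm_sum_le _ _).trans ?_
  rw [hw]
  exact (cluster_formulas (hab (v i)) (hsep (v i)) (hw4 i)).2 i rfl

/-- Rademacher's theorem for `Q`-valued maps that are Lipschitz on `A`. -/
theorem ae_exists_isJetOn {n m Q : ℕ} {f : E n → AQ m Q} {A : Set (E n)} {C : ℝ}
    (hA : NullMeasurableSet A) (hC : 0 ≤ C)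
    (hf : ∀ y ∈ A, ∀ z ∈ A, gdist (f y) (f z) ≤ C * ‖y - z‖) :
    ∀ᵐ x, x ∈ A → HasDensityOne A x ∧ ∃ v L, IsJetOn f A x v L := by
  have hlip : ∀ (G : AQ m Q → ℝ) (K : ℝ), 0 ≤ K → (∀ S T, |G S - G T| ≤ K * gdist S T) →
      ∀ᵐ x, x ∈ A → DifferentiableWithinAt ℝ (fun y => G (f y)) A x := by
    intro G K hK hG
    have : LipschitzOnWith (K * C).toNNReal (fun y => G (f y)) A := by
      refine LipschitzOnWith.of_dist_le_mul fun y hy z hz => ?_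
      rw [Real.coe_toNNReal _ (by positivity), Real.dist_eq, dist_eq_norm, mul_assoc]
      exact (hG _ _).trans (by gcongr; exact hf y hy z hz)
    exact this.ae_differentiableWithinAt_of_mem
  have h1 : ∀ᵐ x, ∀ (a b : ℕ) (j : Fin m), x ∈ A → DifferentiableWithinAt ℝ (fun y => clusterSum
      (TopologicalSpace.denseSeq (E m) a) (1 / ((b : ℝ) + 1)) j (f y)) A x := by
    simp only [ae_all_iff]
    exact fun a b j => hlip _ _ (by positivity) (abs_clusterSum_sub_le _ _ j)
  have h2 : ∀ᵐ x, ∀ (a b : ℕ), x ∈ A → DifferentiableWithinAt ℝ (fun y => clusterSpread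
      (TopologicalSpace.denseSeq (E m) a) (1 / ((b : ℝ) + 1)) (f y)) A x := by
    simp only [ae_all_iff]
    exact fun a b => hlip _ _ (by positivity) (abs_clusterSpread_sub_le _ _)
  filter_upwards [h1, h2, ae_hasDensityOne A hA] with x hx1 hx2 hxd hx
  exact ⟨hxd hx, exists_isJetOn_of_differentiableWithinAt hA (hxd hx) hx hf
    (fun a b j => hx1 a b j hx) fun a b => hx2 a b hx⟩

open Classical in
/-- The jet given by the approximate differential is the one found on any set of density one. -/
lemma jet_eq_of_isJetOn {n m Q : ℕ} {f : E n → AQ m Q} {A : Set (E n)} {x : E n}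
    {v : Fin Q → E m} {L : Fin Q → E n →L[ℝ] E m} (hJ : IsJetOn f A x v L) (hx : x ∈ A)
    (hA : NullMeasurableSet A) (h : HasDensityOne A x) :
    jet f x = ofVec fun i => (v i, L i) := by
  have hex : ∃ J, HasApproxJet f x J := by
    refine ⟨ofVec fun i => (v i, L i), ?_, ?_, A, hA, hx, h, ?_⟩
    · rw [map_ofVec, hJ.eq_ofVec]
      rfl
    · intro p hp p' hp' hpp
      obtain ⟨i, rfl⟩ := (mem_ofVec _ _).1 hp
      obtain ⟨k, rfl⟩ := (mem_ofVec _ _).1 hp'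
      exact hJ.consistent i k hpp
    · refine hJ.isLittleO.congr_left fun y => ?_
      rw [map_ofVec]
      rfl
  rw [jet, dif_pos hex]
  -- The jet selected by choice may refer to another set of density one; uniqueness of approximate
  -- jets removes the ambiguity.
  obtain ⟨h1, h2, S, hS, hxS, hdS, h3⟩ := hex.choose_spec
  set J := hex.choose
  obtain ⟨u, hu⟩ := exists_ofVec J
  rw [hu] at h1 h2 h3 ⊢
  have hJ' : IsJetOn f S x (fun i => (u i).1) (fun i => (u i).2) := by
    refine ⟨by rw [← h1, map_ofVec]; rfl, fun i k hik => h2 _ ((mem_ofVec _ _).2 ⟨i, rfl⟩) _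
      ((mem_ofVec _ _).2 ⟨k, rfl⟩) hik, ?_⟩
    refine h3.congr_left fun y => ?_
    rw [map_ofVec]
    rfl
  exact hJ'.unique hJ hdS hS h hA

/-! ### Increments of Sobolev functions as line integrals -/

/-- Lebesgue measure on the unit interval. -/
abbrev unitMeasure : Measure ℝ := volume.restrict (Set.Icc 0 1)

instance : IsProbabilityMeasure unitMeasure := ⟨by simp⟩

/-- For fixed t the map is a translation. This makes (t, y) ↦ g(y + th) jointly integrable, so that
Fubini applies to line integrals. -/
lemma measurePreserving_shear {n : ℕ} (h : E n) :
    MeasurePreserving (fun p : ℝ × E n => p.2 + p.1 • h) (unitMeasure.prod volume) volume := by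
  have h1 : MeasurePreserving (fun p : ℝ × E n => (p.1, p.2 + p.1 • h))
      (unitMeasure.prod volume) (unitMeasure.prod volume) :=
    (MeasurePreserving.id _).skew_product (g := fun (t : ℝ) (y : E n) => y + t • h)
      (by fun_prop) (.of_forall fun t => (measurePreserving_add_right volume (t • h)).map_eq)
  exact measurePreserving_snd.comp h1

lemma integral_unitMeasure_fderiv {n : ℕ} {ζ : E n → ℝ} (hζ : ContDiff ℝ 1 ζ) (y h : E n) :
    ∫ t, fderiv ℝ ζ (y - t • h) h ∂unitMeasure = ζ y - ζ (y - h) := by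
  have hd : ∀ t : ℝ, HasDerivAt (fun t : ℝ => ζ (y - t • h)) (-(fderiv ℝ ζ (y - t • h) h)) t := by
    intro t
    have h1 : HasDerivAt (fun t : ℝ => y - t • h) (-h) t := by
      simpa using ((hasDerivAt_id t).smul_const h).const_sub y
    have h2 := ((hζ.differentiable one_ne_zero) (y - t • h)).hasFDerivAt.comp_hasDerivAt t h1
    rw [map_neg] at h2
    exact h2
  have hc : Continuous fun t : ℝ => fderiv ℝ ζ (y - t • h) h :=
    ((hζ.continuous_fderiv one_ne_zero).comp (by fun_prop)).clm_apply continuous_const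
  have h3 := intervalIntegral.integral_eq_sub_of_hasDerivAt (fun t _ => hd t)
    (hc.neg.intervalIntegrable 0 1)
  rw [intervalIntegral.integral_neg, intervalIntegral.integral_of_le zero_le_one,
    ← integral_Icc_eq_integral_Ioc] at h3
  simp only [one_smul, zero_smul, sub_zero] at h3
  linarith

/-- The increments of a Sobolev function are the line integrals of its weak derivative. -/
theorem ae_sub_eq_integral_of_weak {n : ℕ} {V : Set (E n)} (hV : IsOpen V) (hVc : Convex ℝ V)
    {U g : E n → ℝ} (hU : Integrable U) (hg : Integrable g) (h : E n)
    (hw : ∀ φ : E n → ℝ, ContDiff ℝ ∞ φ → HasCompactSupport φ → tsupport φ ⊆ V →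
      ∫ x, U x * fderiv ℝ φ x h = - ∫ x, g x * φ x) :
    ∀ᵐ y, y ∈ V → y + h ∈ V → U (y + h) - U y = ∫ t, g (y + t • h) ∂unitMeasure := by
  have hgs : Integrable (fun p : ℝ × E n => g (p.2 + p.1 • h)) (unitMeasure.prod volume) :=
    (measurePreserving_shear h).integrable_comp_of_integrable hg
  have hUh : Integrable fun y => U (y + h) := hU.comp_add_right h
  have hGi : Integrable fun y => ∫ t, g (y + t • h) ∂unitMeasure := hgs.integral_prod_right
  have hWo : IsOpen (V ∩ (· + h) ⁻¹' V) := hV.inter (hV.preimage (by fun_prop))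
  have key := hWo.ae_eq_zero_of_integral_contDiff_smul_eq_zero
    (f := fun y => U (y + h) - U y - ∫ t, g (y + t • h) ∂unitMeasure) (μ := volume)
    (((hUh.sub hU).sub hGi).locallyIntegrable.locallyIntegrableOn _) ?_
  · filter_upwards [key] with y hy h1 h2
    linarith [hy ⟨h1, h2⟩]
  intro ζ hζ hζc hζs
  have hζ1 : ContDiff ℝ 1 ζ := hζ.of_le (by simp)
  obtain ⟨C, hC⟩ := hζc.exists_bound_of_continuous hζ.continuous
  have hζm : AEStronglyMeasurable ζ volume := hζ.continuous.aestronglyMeasurable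
  have i1 : Integrable fun y => ζ y * U (y + h) := hUh.bdd_mul hζm (.of_forall hC)
  have i2 : Integrable fun y => ζ y * U y := hU.bdd_mul hζm (.of_forall hC)
  have i3 : Integrable fun y => ζ y * ∫ t, g (y + t • h) ∂unitMeasure :=
    hGi.bdd_mul hζm (.of_forall hC)
  have i4 : Integrable (fun p : ℝ × E n => ζ p.2 * g (p.2 + p.1 • h)) (unitMeasure.prod volume) :=
    hgs.bdd_mul ((hζ.continuous.comp continuous_snd).aestronglyMeasurable) (.of_forall fun p => hC _)
  set ζ' : E n → ℝ := fun y => fderiv ℝ ζ y h with hζ'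
  have hζ'c : Continuous ζ' := (hζ1.continuous_fderiv one_ne_zero).clm_apply continuous_const
  obtain ⟨C', hC'⟩ := (HasCompactSupport.fderiv_apply (𝕜 := ℝ) hζc h).exists_bound_of_continuous hζ'c
  have i5 : Integrable (fun p : ℝ × E n => ζ' (p.2 - p.1 • h) * U p.2)
      (unitMeasure.prod volume) := by
    refine (hU.comp_snd _).bdd_mul
      ((hζ'c.comp (by fun_prop)).aestronglyMeasurable) (.of_forall fun p => hC' _)
  have e1 : ∫ y, ζ y * U (y + h) = ∫ y, ζ (y - h) * U y := by
    rw [← integral_add_right_eq_self (fun y => ζ (y - h) * U y) h]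
    simp
  have e2 : ∀ t ∈ Set.Icc (0 : ℝ) 1, ∫ y, ζ y * g (y + t • h) = - ∫ y, ζ' (y - t • h) * U y := by
    intro t ht
    have hs : ∀ y, y ∈ tsupport (fun y => ζ (y - t • h)) → y - t • h ∈ tsupport ζ := by
      intro y hy
      exact tsupport_comp_subset_preimage ζ (f := fun y => y - t • h) (by fun_prop) hy
    have h1 := hw (fun y => ζ (y - t • h)) (hζ.comp (by fun_prop)) ?_ ?_
    · rw [← integral_add_right_eq_self (fun y => g y * ζ (y - t • h)) (t • h)] at h1
      simp only [add_sub_cancel_right, fderiv_comp_sub] at h1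
      have h2 : ∀ y, ζ' (y - t • h) * U y = U y * fderiv ℝ ζ (y - t • h) h := fun y => mul_comm _ _
      simp only [mul_comm (ζ _), h2]
      linarith
    · exact hζc.comp_homeomorph (Homeomorph.subRight (t • h))
    · intro y hy
      -- Convexity enters here: y lies on the segment from y - th to y - th + h, both of whose ends
      -- are in `V`, so the translated test function is admissible.
      obtain ⟨h3, h4⟩ := hζs (hs y hy)
      have h5 := hVc h3 h4 (sub_nonneg.2 ht.2) ht.1 (by ring)
      have : (1 - t) • (y - t • h) + t • (y - t • h + h) = y := by module
      rwa [this] at h5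
  -- Fubini, the weak derivative at each fixed t, and the fundamental theorem of calculus for ζ
  -- along the segment.
  have e3 : ∫ y, ζ y * ∫ t, g (y + t • h) ∂unitMeasure = ∫ y, (ζ (y - h) - ζ y) * U y := by
    calc ∫ y, ζ y * ∫ t, g (y + t • h) ∂unitMeasure
        = ∫ y, ∫ t, ζ y * g (y + t • h) ∂unitMeasure := by simp only [integral_const_mul]
      _ = ∫ t, ∫ y, ζ y * g (y + t • h) ∂volume ∂unitMeasure := by
          rw [integral_integral_swap]
          exact i4.swap
      _ = ∫ t, - ∫ y, ζ' (y - t • h) * U y ∂volume ∂unitMeasure :=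
          setIntegral_congr_fun measurableSet_Icc e2
      _ = - ∫ y, ∫ t, ζ' (y - t • h) * U y ∂unitMeasure := by
          rw [integral_neg, integral_integral_swap]
          exact i5
      _ = ∫ y, (ζ (y - h) - ζ y) * U y := by
          simp only [integral_mul_const, hζ', integral_unitMeasure_fderiv hζ1]
          rw [← integral_neg]
          congr 1
          ext1 y
          ring
  have i6 : Integrable fun y => ζ (y - h) * U y :=
    hU.bdd_mul ((hζ.continuous.comp (by fun_prop)).aestronglyMeasurable) (.of_forall fun y => hC _)
  simp only [smul_eq_mul, mul_sub]
  have i12 : Integrable fun y => ζ y * U (y + h) - ζ y * U y := i1.sub i2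
  rw [integral_sub i12 i3, integral_sub i1 i2, e1, e3]
  simp only [sub_mul]
  rw [integral_sub i6 i2]
  ring

lemma sum_smul_e {n : ℕ} (h : E n) : ∑ j, h j • e j = h := by
  simpa [e] using (EuclideanSpace.basisFun (Fin n) ℝ).sum_repr h

/-- The increments of `𝒢(f, T)` are line integrals of square integrable functions. -/
theorem MemW12.exists_increment {n m Q : ℕ} {Ω V : Set (E n)} {f : E n → AQ m Q}
    (hf : MemW12 Ω f) {φ : Fin n → E n → ℝ} (hφ : ∀ j, MemLp (φ j) 2 (volume.restrict Ω))
    (hV : IsOpen V) (hVc : Convex ℝ V) (hVΩ : V ⊆ Ω) (hVf : volume V ≠ ⊤) (T : AQ m Q)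
    (hT : ∀ j : Fin n, ∃ g : E n → ℝ, HasWeakPartial Ω j (fun x => gdist (f x) T) g ∧
      ∀ᵐ x ∂(volume.restrict Ω), |g x| ≤ φ j x) :
    ∃ g : Fin n → E n → ℝ, (∀ j, Integrable (g j)) ∧ (∀ j, MemLp (g j) 2) ∧
      (∀ j, ∀ᵐ x, |g j x| ≤ V.indicator (fun x => |φ j x|) x) ∧
      ∀ h, ∀ᵐ y, y ∈ V → y + h ∈ V → gdist (f (y + h)) T - gdist (f y) T =
        ∫ t, ∑ j, h j * g j (y + t • h) ∂unitMeasure := by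
  choose g hgw hgb using hT
  have hVm := hV.measurableSet
  have hle : volume.restrict V ≤ volume.restrict Ω := Measure.restrict_mono hVΩ le_rfl
  have : IsFiniteMeasure (volume.restrict V) := ⟨by simpa using hVf.lt_top⟩
  have hU : Integrable (V.indicator fun x => gdist (f x) T) := by
    rw [integrable_indicator_iff hVm]
    have h1 : MemLp (fun x => qnorm (f x) + qnorm T) 2 (volume.restrict V) :=
      (hf.memL2.mono_measure hle).add (memLp_const _)
    refine (h1.integrable one_le_two).mono' ((hf.measurable T).mono_measure hle)
      (.of_forall fun x => ?_)
    rw [Real.norm_of_nonneg (gdist_nonneg _ _)]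
    have := gdist_triangle (f x) (qzero m Q) T
    rwa [gdist_comm (qzero m Q) T] at this
  have hgV : ∀ j, MemLp (g j) 2 (volume.restrict V) := by
    intro j
    refine (MemLp.of_le (hφ j) ?_ ?_).mono_measure hle
    · exact (hgw j).2.1.aestronglyMeasurable
    · filter_upwards [hgb j] with x hx
      exact hx.trans (le_abs_self _)
  have hgI : ∀ j, Integrable (V.indicator (g j)) := fun j => by
    rw [integrable_indicator_iff hVm]
    exact (hgV j).integrable one_le_two
  refine ⟨fun j => V.indicator (g j), hgI, fun j => ?_, fun j => ?_, fun h => ?_⟩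
  · exact (memLp_indicator_iff_restrict hVm).2 (hgV j)
  · have := (ae_restrict_iff' hVm).1 (ae_mono hle (hgb j))
    filter_upwards [this] with x hx
    by_cases hxV : x ∈ V
    · simp only [Set.indicator_of_mem hxV]
      exact (hx hxV).trans (le_abs_self _)
    · simp [Set.indicator_of_notMem hxV]
  · have key := ae_sub_eq_integral_of_weak hV hVc hU
      (g := fun x => ∑ j, h j * V.indicator (g j) x)
      (integrable_finsetSum _ fun j _ => (hgI j).const_mul _) h ?_
    · filter_upwards [key] with y hy h1 h2
      rw [← hy h1 h2, Set.indicator_of_mem h1, Set.indicator_of_mem h2]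
    intro ζ hζ hζc hζs
    have hζ1 : ContDiff ℝ 1 ζ := hζ.of_le (by simp)
    have hfd : ∀ x, fderiv ℝ ζ x h = ∑ j, h j * fderiv ℝ ζ x (e j) := by
      intro x
      conv_lhs => rw [← sum_smul_e h]
      simp
    have hz : ∀ x, x ∉ V → fderiv ℝ ζ x = 0 := fun x hx =>
      image_eq_zero_of_notMem_tsupport fun hx' => hx (hζs (tsupport_fderiv_subset ℝ hx'))
    have hz' : ∀ x, x ∉ V → ζ x = 0 := fun x hx =>
      image_eq_zero_of_notMem_tsupport fun hx' => hx (hζs hx')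
    have hw : ∀ j, ∫ x, V.indicator (fun x => gdist (f x) T) x * fderiv ℝ ζ x (e j) =
        - ∫ x, V.indicator (g j) x * ζ x := by
      intro j
      have h1 := (hgw j).2.2 ζ hζ hζc (hζs.trans hVΩ)
      rw [setIntegral_eq_integral_of_forall_compl_eq_zero,
        setIntegral_eq_integral_of_forall_compl_eq_zero] at h1
      · convert h1 using 2
        · ext1 x
          by_cases hx : x ∈ V
          · simp [hx]
          · simp [hz x hx]
        · congr 1
          ext1 x
          by_cases hx : x ∈ V
          · simp [hx]
          · simp [hz' x hx]
      · intro x hx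
        rw [hz' x fun h => hx (hVΩ h), mul_zero]
      · intro x hx
        rw [hz x fun h => hx (hVΩ h)]
        simp
    obtain ⟨C, hC⟩ := hζc.exists_bound_of_continuous hζ.continuous
    have hI1 : ∀ j, Integrable fun x => V.indicator (fun x => gdist (f x) T) x *
        fderiv ℝ ζ x (e j) := by
      intro j
      obtain ⟨C', hC'⟩ := (HasCompactSupport.fderiv_apply (𝕜 := ℝ) hζc (e j)).exists_bound_of_continuous
        ((hζ1.continuous_fderiv one_ne_zero).clm_apply continuous_const)
      exact hU.mul_bdd (((hζ1.continuous_fderiv one_ne_zero).clm_apply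
        continuous_const).aestronglyMeasurable) (.of_forall hC')
    have hI2 : ∀ j, Integrable fun x => V.indicator (g j) x * ζ x := fun j =>
      (hgI j).mul_bdd hζ.continuous.aestronglyMeasurable (.of_forall hC)
    simp only [hfd, Finset.mul_sum, Finset.sum_mul]
    rw [integral_finsetSum _ fun j _ => ?_, integral_finsetSum _ fun j _ => ?_,
      ← Finset.sum_neg_distrib]
    · refine Finset.sum_congr rfl fun j _ => ?_
      simp only [mul_left_comm _ (h j), mul_assoc]
      rw [integral_const_mul, integral_const_mul, hw j]
      ring
    · simp only [mul_assoc]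
      exact (hI2 j).const_mul _
    · simp only [mul_left_comm _ (h j)]
      exact (hI1 j).const_mul _

/-! ### Increment bounds for `Q`-valued Sobolev maps -/

/-- A `Q`-valued map on a convex open set `V` whose increments are controlled by the line
integrals of the square integrable function `Φ`. -/
structure IsSobolevBounded {n m Q : ℕ} (V : Set (E n)) (f : E n → AQ m Q) (Φ : E n → ℝ≥0∞) :
    Prop where
  isOpen : IsOpen V
  measurable : Measurable Φ
  sq_finite : ∫⁻ x, Φ x ^ 2 ≠ ⊤
  int_finite : ∫⁻ x, Φ x ≠ ⊤
  aestronglyMeasurable : ∀ T, AEStronglyMeasurable (fun x => gdist (f x) T) (volume.restrict V)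
  increment : ∀ T h, ∀ᵐ y, y ∈ V → y + h ∈ V →
    ENNReal.ofReal |gdist (f (y + h)) T - gdist (f y) T| ≤
      ‖h‖ₑ * ∫⁻ t, Φ (y + t • h) ∂unitMeasure

/-- A single Φ serves every `T` because the φ_j in the definition of W^{1,2} do. It is the sum of
absolute values of measurable representatives of the φ_j, cut off to `V`. -/
theorem MemW12.exists_isSobolevBounded {n m Q : ℕ} {Ω V : Set (E n)} {f : E n → AQ m Q}
    (hf : MemW12 Ω f) (hV : IsOpen V) (hVc : Convex ℝ V) (hVΩ : V ⊆ Ω) (hVf : volume V ≠ ⊤) :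
    ∃ Φ, IsSobolevBounded V f Φ := by
  obtain ⟨φ, hφ, hb⟩ := hf.exists_bound
  have hVm := hV.measurableSet
  have hle : volume.restrict V ≤ volume.restrict Ω := Measure.restrict_mono hVΩ le_rfl
  have hfin : IsFiniteMeasure (volume.restrict V) := ⟨by simpa using hVf.lt_top⟩
  have hφV : ∀ j, MemLp (V.indicator (φ j)) 2 := fun j =>
    (memLp_indicator_iff_restrict hVm).2 ((hφ j).mono_measure hle)
  have hφV1 : ∀ j, Integrable (V.indicator (φ j)) := fun j =>
    (integrable_indicator_iff hVm).2 (((hφ j).mono_measure hle).integrable one_le_two)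
  set ψ : Fin n → E n → ℝ := fun j => (hφV j).1.mk _ with hψ
  have hψm : ∀ j, StronglyMeasurable (ψ j) := fun j => (hφV j).1.stronglyMeasurable_mk
  have hψe : ∀ j, V.indicator (φ j) =ᵐ[volume] ψ j := fun j => (hφV j).1.ae_eq_mk
  have hS : MemLp (fun x => ∑ j, ‖ψ j x‖) 2 := memLp_finsetSum _ fun j _ =>
    ((hφV j).ae_eq (hψe j)).norm
  have hS1 : Integrable (fun x => ∑ j, ‖ψ j x‖) := integrable_finsetSum _ fun j _ =>
    ((hφV1 j).congr (hψe j)).norm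
  have hnn : ∀ x, 0 ≤ ∑ j, ‖ψ j x‖ := fun x => Finset.sum_nonneg fun j _ => norm_nonneg _
  have hSm : Measurable fun x => ∑ j, ‖ψ j x‖ :=
    Finset.measurable_fun_sum _ fun j _ => (hψm j).measurable.norm
  refine ⟨fun x => ENNReal.ofReal (∑ j, ‖ψ j x‖), hV, hSm.ennreal_ofReal, ?_, ?_,
    fun T => (hf.measurable T).mono_measure hle, fun T h => ?_⟩
  · have := hS.integrable_sq.lintegral_lt_top
    simp only [← ENNReal.ofReal_pow (hnn _)]
    exact this.ne
  · exact hS1.lintegral_lt_top.ne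
  · obtain ⟨g, hgI, -, hgb, hginc⟩ := hf.exists_increment hφ hV hVc hVΩ hVf T (hb T)
    have h1 : ∀ᵐ x, |∑ j, h j * g j x| ≤ ‖h‖ * ∑ j, ‖ψ j x‖ := by
      filter_upwards [ae_all_iff.2 hgb, ae_all_iff.2 hψe] with x hx1 hx2
      rw [Finset.mul_sum]
      refine (Finset.abs_sum_le_sum_abs _ _).trans (Finset.sum_le_sum fun j _ => ?_)
      rw [abs_mul]
      gcongr
      · exact PiLp.norm_apply_le h j
      · rw [← hx2 j]
        refine (hx1 j).trans_eq ?_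
        by_cases hx : x ∈ V <;> simp [hx]
    -- The shear pulls null sets back to null sets, so for a.e. y the pointwise bound holds at a.e.
    -- point of the segment.
    have h2 := ((measurePreserving_shear h).quasiMeasurePreserving.comp
      Measure.measurePreserving_swap.quasiMeasurePreserving).ae h1
    filter_upwards [hginc h, Measure.ae_ae_of_ae_prod h2] with y hy1 hy2 hyV hyhV
    rw [hy1 hyV hyhV]
    simp only [Function.comp_apply, Prod.fst_swap, Prod.snd_swap] at hy2
    rw [← Real.enorm_eq_ofReal_abs]
    refine (enorm_integral_le_lintegral_enorm _).trans ?_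
    rw [← lintegral_const_mul' _ _ enorm_ne_top]
    refine lintegral_mono_ae ?_
    filter_upwards [hy2] with t ht
    rw [← ofReal_norm h, ← ENNReal.ofReal_mul (norm_nonneg _), Real.enorm_eq_ofReal_abs]
    exact ENNReal.ofReal_le_ofReal ht

namespace IsSobolevBounded

variable {n m Q : ℕ} {V : Set (E n)} {f : E n → AQ m Q} {Φ : E n → ℝ≥0∞}

lemma ofReal_gdist_le {S T : AQ m Q} {c : ℝ≥0∞}
    (h : ∀ k, ENNReal.ofReal |gdist S (densePt m Q k) - gdist T (densePt m Q k)| ≤ c) :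
    ENNReal.ofReal (gdist S T) ≤ c := by
  by_cases hc : c = ⊤
  · simp [hc]
  rw [ENNReal.ofReal_le_iff_le_toReal hc]
  exact gdist_le_of_forall_densePt fun k => (ENNReal.ofReal_le_iff_le_toReal hc).1 (h k)

lemma ae_gdist_le (hf : IsSobolevBounded V f Φ) (h : E n) : ∀ᵐ y, y ∈ V → y + h ∈ V →
    ENNReal.ofReal (gdist (f (y + h)) (f y)) ≤ ‖h‖ₑ * ∫⁻ t, Φ (y + t • h) ∂unitMeasure := by
  filter_upwards [ae_all_iff.2 fun k => hf.increment (densePt m Q k) h] with y hy h1 h2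
  exact ofReal_gdist_le fun k => hy k h1 h2

/-- Fubini exchanges the order of "every h, a.e. y". Fixing the base point first is what allows
averaging over balls around it; measurable representatives of 𝒢(f,T) make the exceptional set
measurable in the product. -/
lemma ae_ae_gdist_le (hf : IsSobolevBounded V f Φ) : ∀ᵐ y, y ∈ V → ∀ᵐ h, y + h ∈ V →
    ENNReal.ofReal (gdist (f (y + h)) (f y)) ≤ ‖h‖ₑ * ∫⁻ t, Φ (y + t • h) ∂unitMeasure := by
  have hVm := hf.isOpen.measurableSet
  have key : ∀ T, ∀ᵐ y, y ∈ V → ∀ᵐ h, y + h ∈ V →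
      ENNReal.ofReal |gdist (f (y + h)) T - gdist (f y) T| ≤
        ‖h‖ₑ * ∫⁻ t, Φ (y + t • h) ∂unitMeasure := by
    intro T
    set u := (hf.aestronglyMeasurable T).mk _ with hu
    have hum : Measurable u := (hf.aestronglyMeasurable T).stronglyMeasurable_mk.measurable
    have hue : ∀ᵐ x, x ∈ V → gdist (f x) T = u x :=
      (ae_restrict_iff' hVm).1 (hf.aestronglyMeasurable T).ae_eq_mk
    have hΦm := hf.measurable
    have h1 : ∀ h, ∀ᵐ y, y ∈ V ∧ y + h ∈ V → ENNReal.ofReal |u (y + h) - u y| ≤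
        ‖h‖ₑ * ∫⁻ t, Φ (y + t • h) ∂unitMeasure := by
      intro h
      filter_upwards [hf.increment T h, hue,
        (measurePreserving_add_right volume h).quasiMeasurePreserving.ae hue] with y hy1 hy2 hy3 hy
      rw [← hy2 hy.1, ← hy3 hy.2]
      exact hy1 hy.1 hy.2
    have hms : MeasurableSet {p : E n × E n | p.2 ∈ V ∧ p.2 + p.1 ∈ V →
        ENNReal.ofReal |u (p.2 + p.1) - u p.2| ≤
          ‖p.1‖ₑ * ∫⁻ t, Φ (p.2 + t • p.1) ∂unitMeasure} := by
      have hm : Measurable fun p : E n × E n => ∫⁻ t, Φ (p.2 + t • p.1) ∂unitMeasure := by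
        refine Measurable.lintegral_prod_right' (f := fun q : (E n × E n) × ℝ =>
          Φ (q.1.2 + q.2 • q.1.1)) ?_
        exact hΦm.comp (by fun_prop)
      refine MeasurableSet.imp ?_ (measurableSet_le ?_ ?_)
      · exact (measurable_snd hVm).inter ((measurable_snd.add measurable_fst) hVm)
      · exact (((hum.comp (measurable_snd.add measurable_fst)).sub
          (hum.comp measurable_snd)).abs).ennreal_ofReal
      · exact measurable_fst.enorm.mul hm
    have h2 := (Measure.ae_ae_comm (μ := (volume : Measure (E n))) (ν := (volume : Measure (E n)))
      (p := fun h y => y ∈ V ∧ y + h ∈ V → ENNReal.ofReal |u (y + h) - u y| ≤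
        ‖h‖ₑ * ∫⁻ t, Φ (y + t • h) ∂unitMeasure) hms).1 (.of_forall h1)
    filter_upwards [h2, hue] with y hy1 hy2 hyV
    filter_upwards [hy1, (measurePreserving_add_left volume y).quasiMeasurePreserving.ae hue]
      with h hh1 hh2 hyh
    rw [hy2 hyV, hh2 hyh]
    exact hh1 ⟨hyV, hyh⟩
  filter_upwards [ae_all_iff.2 fun k => key (densePt m Q k)] with y hy hyV
  filter_upwards [ae_all_iff.2 fun k => hy k hyV] with h hh hyh
  exact ofReal_gdist_le fun k => hh k hyh

end IsSobolevBounded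

/-! ### Maximal function and Lipschitz sets -/

/-- The set where the maximal function of `Φ` is at most `N`. -/
def maxSet {n : ℕ} (Φ : E n → ℝ≥0∞) (N : ℕ) : Set (E n) :=
  {y | ∀ ρ : ℝ, 0 < ρ → ∫⁻ z in Metric.ball y ρ, Φ z ≤ N * volume (Metric.ball (0 : E n) ρ)}

/-- For fixed radius, the integral over an open ball is lower semicontinuous in the centre, by
Fatou's lemma. -/
lemma isClosed_maxSet {n : ℕ} {Φ : E n → ℝ≥0∞} (hΦ : Measurable Φ) (N : ℕ) :
    IsClosed (maxSet Φ N) := by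
  have : maxSet Φ N = ⋂ (ρ : ℝ) (_ : 0 < ρ),
      {y | ∫⁻ z in Metric.ball y ρ, Φ z ≤ N * volume (Metric.ball (0 : E n) ρ)} := by
    ext y
    simp [maxSet]
  rw [this]
  refine isClosed_iInter fun ρ => isClosed_iInter fun _ => IsSeqClosed.isClosed ?_
  intro y y0 hy hlim
  simp only [Set.mem_ofPred_eq, ← lintegral_indicator measurableSet_ball] at hy ⊢
  calc ∫⁻ z, (Metric.ball y0 ρ).indicator Φ z
      ≤ ∫⁻ z, liminf (fun k => (Metric.ball (y k) ρ).indicator Φ z) atTop := by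
        refine lintegral_mono fun z => ?_
        by_cases hz : z ∈ Metric.ball y0 ρ
        · have h1 : ∀ᶠ k in atTop, z ∈ Metric.ball (y k) ρ := by
            have := (tendsto_const_nhds (x := z)).dist hlim
            exact this.eventually_lt_const hz
          have h2 : Tendsto (fun k => (Metric.ball (y k) ρ).indicator Φ z) atTop (𝓝 (Φ z)) := by
            refine tendsto_const_nhds.congr' ?_
            filter_upwards [h1] with k hk
            rw [Set.indicator_of_mem hk]
          rw [h2.liminf_eq, Set.indicator_of_mem hz]
        · rw [Set.indicator_of_notMem hz]
          exact zero_le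
    _ ≤ liminf (fun k => ∫⁻ z, (Metric.ball (y k) ρ).indicator Φ z) atTop :=
        lintegral_liminf_le fun k => hΦ.indicator measurableSet_ball
    _ ≤ N * volume (Metric.ball (0 : E n) ρ) := by
        refine liminf_le_of_frequently_le' (.of_forall hy)

lemma volume_ball_eq {n : ℕ} (x : E n) (r : ℝ) :
    volume (Metric.ball x r) = volume (Metric.ball (0 : E n) r) :=
  Measure.addHaar_ball_center _ _ _

/-- Lebesgue differentiation bounds the means at small radii, and the total integral over a fixed
ball volume bounds them at large radii. -/
lemma ae_exists_mem_maxSet {n : ℕ} {Φ : E n → ℝ≥0∞} (hΦ : Measurable Φ) (hfin : ∫⁻ x, Φ x ≠ ⊤) :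
    ∀ᵐ y, ∃ N, y ∈ maxSet Φ N := by
  filter_upwards [(Besicovitch.vitaliFamily (volume : Measure (E n))).ae_tendsto_lintegral_div
    hΦ.aemeasurable hfin, ae_lt_top hΦ hfin] with y hy hyf
  have h1 := hy.comp (Besicovitch.tendsto_filterAt volume y)
  have h2 : Φ y < Φ y + 1 := ENNReal.lt_add_right hyf.ne one_ne_zero
  have h3 := h1.eventually_lt_const h2
  obtain ⟨r0, hr0, hr⟩ := mem_nhdsGT_iff_exists_Ioo_subset.1 h3
  have hr0 : 0 < r0 := hr0
  have hv0 : volume (Metric.ball (0 : E n) r0) ≠ 0 := (Metric.measure_ball_pos _ _ hr0).ne'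
  have hvt : volume (Metric.ball (0 : E n) r0) ≠ ⊤ := measure_ball_lt_top.ne
  have hne : (Φ y + 1) + (∫⁻ x, Φ x) / volume (Metric.ball (0 : E n) r0) ≠ ⊤ :=
    ENNReal.add_ne_top.2 ⟨ENNReal.add_ne_top.2 ⟨hyf.ne, ENNReal.one_ne_top⟩,
      (ENNReal.div_lt_top hfin hv0).ne⟩
  obtain ⟨N, hN⟩ := ENNReal.exists_nat_gt hne
  refine ⟨N, fun ρ hρ => ?_⟩
  rcases lt_or_ge ρ r0 with hlt | hge
  · have h4 : (∫⁻ z in Metric.closedBall y ρ, Φ z) / volume (Metric.closedBall y ρ) < Φ y + 1 :=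
      hr ⟨hρ, hlt⟩
    rw [Measure.addHaar_closedBall _ _ hρ.le, ← Measure.addHaar_ball_of_pos _ (0 : E n) hρ] at h4
    rw [ENNReal.div_lt_iff (Or.inl (Metric.measure_ball_pos _ _ hρ).ne')
      (Or.inl measure_ball_lt_top.ne)] at h4
    refine (lintegral_mono_set Metric.ball_subset_closedBall).trans (h4.le.trans ?_)
    gcongr
    exact (le_self_add).trans hN.le
  · calc ∫⁻ z in Metric.ball y ρ, Φ z ≤ ∫⁻ z, Φ z := setLIntegral_le_lintegral _ _
      _ = (∫⁻ x, Φ x) / volume (Metric.ball (0 : E n) r0) * volume (Metric.ball (0 : E n) r0) :=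
          (ENNReal.div_mul_cancel hv0 hvt).symm
      _ ≤ _ := by
          gcongr
          exact (le_add_self).trans hN.le

lemma lintegral_comp_smul_ball {n : ℕ} {F : E n → ℝ≥0∞} (hF : Measurable F) {t r : ℝ}
    (ht : 0 < t) : ∫⁻ h in Metric.ball (0 : E n) r, F (t • h) =
      ENNReal.ofReal ((t ^ n)⁻¹) * ∫⁻ h in Metric.ball (0 : E n) (t * r), F h := by
  have h1 : ∫⁻ h in Metric.ball (0 : E n) (t * r), F h ∂(Measure.map (t • ·) volume) =
      ∫⁻ h in Metric.ball (0 : E n) r, F (t • h) := by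
    rw [setLIntegral_map measurableSet_ball hF (measurable_const_smul t)]
    congr 2
    ext h
    simp only [Set.mem_preimage, mem_ball_zero_iff, norm_smul, Real.norm_eq_abs, abs_of_pos ht,
      mul_lt_mul_iff_right₀ ht]
  rw [← h1, Measure.map_addHaar_smul _ ht.ne', Measure.restrict_smul, lintegral_smul_measure]
  simp only [finrank_euclideanSpace, Fintype.card_fin, abs_inv, smul_eq_mul]
  rw [abs_of_pos (by positivity)]

namespace IsSobolevBounded

variable {n m Q : ℕ} {V : Set (E n)} {f : E n → AQ m Q} {Φ : E n → ℝ≥0∞}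

/-- Integrate the segment bound over h and substitute th: each t contributes an integral of Φ over a
ball of radius tr, at most N times its volume, and the Jacobian t⁻ⁿ cancels the shrinking of that
volume. -/
lemma lintegral_gdist_le (hf : IsSobolevBounded V f Φ) {y : E n} {N : ℕ} {r : ℝ}
    (hy : ∀ᵐ h, y + h ∈ V →
      ENNReal.ofReal (gdist (f (y + h)) (f y)) ≤ ‖h‖ₑ * ∫⁻ t, Φ (y + t • h) ∂unitMeasure)
    (hyN : y ∈ maxSet Φ N) (hr : 0 < r) (hV : Metric.ball y r ⊆ V) :
    ∫⁻ z in Metric.ball y r, ENNReal.ofReal (gdist (f z) (f y)) ≤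
      ENNReal.ofReal r * (N * volume (Metric.ball (0 : E n) r)) := by
  have hΦm := hf.measurable
  have e1 : ∫⁻ z in Metric.ball y r, ENNReal.ofReal (gdist (f z) (f y)) =
      ∫⁻ h in Metric.ball (0 : E n) r, ENNReal.ofReal (gdist (f (y + h)) (f y)) := by
    rw [← lintegral_indicator measurableSet_ball, ← lintegral_indicator measurableSet_ball,
      ← lintegral_add_left_eq_self _ y]
    congr 1
    ext1 h
    simp only [Set.indicator, Metric.mem_ball, dist_self_add_left, dist_zero_right]
  have hmeas : Measurable fun q : E n × ℝ => Φ (y + q.2 • q.1) := hΦm.comp (by fun_prop)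
  rw [e1]
  calc ∫⁻ h in Metric.ball (0 : E n) r, ENNReal.ofReal (gdist (f (y + h)) (f y))
      ≤ ∫⁻ h in Metric.ball (0 : E n) r, ENNReal.ofReal r * ∫⁻ t, Φ (y + t • h) ∂unitMeasure := by
        refine setLIntegral_mono_ae' measurableSet_ball ?_
        filter_upwards [hy] with h hh hhr
        refine (hh (hV ?_)).trans ?_
        · simpa using hhr
        · gcongr
          rw [← ofReal_norm h]
          exact ENNReal.ofReal_le_ofReal (mem_ball_zero_iff.1 hhr).le
    _ = ENNReal.ofReal r * ∫⁻ t, ∫⁻ h in Metric.ball (0 : E n) r, Φ (y + t • h) ∂volume ∂unitMeasure := by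
        rw [lintegral_const_mul' _ _ ENNReal.ofReal_ne_top, lintegral_lintegral_swap]
        exact hmeas.aemeasurable
    _ ≤ ENNReal.ofReal r * ∫⁻ _t, N * volume (Metric.ball (0 : E n) r) ∂unitMeasure := by
        refine mul_le_mul' le_rfl ?_
        have h0 : ∀ᵐ t ∂unitMeasure, t ≠ 0 := by
          exact ae_restrict_of_ae (Measure.ae_ne volume 0)
        have h1 : ∀ᵐ t ∂unitMeasure, t ∈ Set.Icc (0 : ℝ) 1 := ae_restrict_mem measurableSet_Icc
        refine lintegral_mono_ae ?_
        filter_upwards [h0, h1] with t ht0 ht1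
        have ht : 0 < t := lt_of_le_of_ne ht1.1 ht0.symm
        rw [lintegral_comp_smul_ball (F := fun h => Φ (y + h)) (hΦm.comp (by fun_prop)) ht]
        have e2 : ∫⁻ h in Metric.ball (0 : E n) (t * r), Φ (y + h) =
            ∫⁻ z in Metric.ball y (t * r), Φ z := by
          rw [← lintegral_indicator measurableSet_ball, ← lintegral_indicator measurableSet_ball,
            ← lintegral_add_left_eq_self ((Metric.ball y (t * r)).indicator Φ) y]
          congr 1
          ext1 h
          simp only [Set.indicator, Metric.mem_ball, dist_self_add_left, dist_zero_right]
        rw [e2]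
        refine (mul_le_mul' le_rfl (hyN (t * r) (mul_pos ht hr))).trans ?_
        rw [Measure.addHaar_ball_of_pos _ _ (mul_pos ht hr), Measure.addHaar_ball_of_pos _ _ hr]
        simp only [finrank_euclideanSpace, Fintype.card_fin]
        rw [mul_pow, ENNReal.ofReal_mul (by positivity), mul_assoc (ENNReal.ofReal (t ^ n)),
          mul_left_comm (N : ℝ≥0∞), ← mul_assoc (ENNReal.ofReal ((t ^ n)⁻¹)),
          ← ENNReal.ofReal_mul (by positivity), inv_mul_cancel₀ (by positivity),
          ENNReal.ofReal_one, one_mul]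
    _ = _ := by simp

/-- The map is Lipschitz where the maximal function of its gradient bound is bounded. -/
lemma gdist_le_of_mem_maxSet (hf : IsSobolevBounded V f Φ) {y z : E n} {N : ℕ}
    (hy : ∀ᵐ h, y + h ∈ V →
      ENNReal.ofReal (gdist (f (y + h)) (f y)) ≤ ‖h‖ₑ * ∫⁻ t, Φ (y + t • h) ∂unitMeasure)
    (hz : ∀ᵐ h, z + h ∈ V →
      ENNReal.ofReal (gdist (f (z + h)) (f z)) ≤ ‖h‖ₑ * ∫⁻ t, Φ (z + t • h) ∂unitMeasure)
    (hyN : y ∈ maxSet Φ N) (hzN : z ∈ maxSet Φ N) (hyV : Metric.ball y ‖y - z‖ ⊆ V)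
    (hzV : Metric.ball z ‖y - z‖ ⊆ V) :
    gdist (f y) (f z) ≤ 2 ^ (n + 1) * N * ‖y - z‖ := by
  rcases eq_or_ne y z with rfl | hne
  · simp [gdist_self]
  set r := ‖y - z‖ with hr
  have hr0 : 0 < r := norm_pos_iff.2 (sub_ne_zero.2 hne)
  -- The ball around the midpoint lies in both balls of radius r, so the triangle inequality can be
  -- averaged over it. The two terms and the volume ratio 2ⁿ produce the constant 2ⁿ⁺¹.
  set W := Metric.ball ((1 / 2 : ℝ) • (y + z)) (r / 2) with hW
  have hWy : W ⊆ Metric.ball y r := by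
    refine Metric.ball_subset_ball' ?_
    rw [dist_eq_norm, show (1 / 2 : ℝ) • (y + z) - y = (-(1 / 2) : ℝ) • (y - z) by module, norm_smul]
    norm_num
    linarith
  have hWz : W ⊆ Metric.ball z r := by
    refine Metric.ball_subset_ball' ?_
    rw [dist_eq_norm, show (1 / 2 : ℝ) • (y + z) - z = (1 / 2 : ℝ) • (y - z) by module, norm_smul]
    norm_num
    linarith
  have hWv : volume W = volume (Metric.ball (0 : E n) (r / 2)) := volume_ball_eq _ _
  have hv : volume (Metric.ball (0 : E n) r) = 2 ^ n * volume W := by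
    rw [hWv, Measure.addHaar_ball_of_pos _ _ hr0, Measure.addHaar_ball_of_pos _ _ (half_pos hr0),
      ← mul_assoc]
    congr 1
    simp only [finrank_euclideanSpace, Fintype.card_fin]
    rw [show (2 : ℝ≥0∞) ^ n = ENNReal.ofReal (2 ^ n) by
      rw [ENNReal.ofReal_pow (by norm_num)]; simp, ← ENNReal.ofReal_mul (by positivity), ← mul_pow]
    congr 2
    ring
  have hW0 : volume W ≠ 0 := (Metric.measure_ball_pos _ _ (half_pos hr0)).ne'
  have hWt : volume W ≠ ⊤ := measure_ball_lt_top.ne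
  have key : ENNReal.ofReal (gdist (f y) (f z)) * volume W ≤
      ENNReal.ofReal (2 ^ (n + 1) * N * r) * volume W := by
    calc ENNReal.ofReal (gdist (f y) (f z)) * volume W
        = ∫⁻ _w in W, ENNReal.ofReal (gdist (f y) (f z)) := by simp
      _ ≤ ∫⁻ w in W, (ENNReal.ofReal (gdist (f w) (f y)) + ENNReal.ofReal (gdist (f w) (f z))) := by
          refine lintegral_mono fun w => ?_
          rw [← ENNReal.ofReal_add (gdist_nonneg _ _) (gdist_nonneg _ _), gdist_comm (f w) (f y)]
          exact ENNReal.ofReal_le_ofReal (gdist_triangle _ _ _)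
      _ = (∫⁻ w in W, ENNReal.ofReal (gdist (f w) (f y))) +
          ∫⁻ w in W, ENNReal.ofReal (gdist (f w) (f z)) := by
          refine lintegral_add_left' ?_ _
          exact ((hf.aestronglyMeasurable (f y)).aemeasurable.mono_measure
            (Measure.restrict_mono (hWy.trans hyV) le_rfl)).ennreal_ofReal
      _ ≤ ENNReal.ofReal r * (N * volume (Metric.ball (0 : E n) r)) +
          ENNReal.ofReal r * (N * volume (Metric.ball (0 : E n) r)) := by
          refine add_le_add ?_ ?_
          · exact (lintegral_mono_set hWy).trans (hf.lintegral_gdist_le hy hyN hr0 hyV)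
          · exact (lintegral_mono_set hWz).trans (hf.lintegral_gdist_le hz hzN hr0 hzV)
      _ = _ := by
          rw [hv, ← two_mul, ENNReal.ofReal_mul (by positivity), ENNReal.ofReal_mul (by positivity),
            ENNReal.ofReal_natCast, ENNReal.ofReal_pow (by norm_num)]
          simp only [ENNReal.ofReal_ofNat]
          ring
  rw [ENNReal.mul_le_mul_iff_left hW0 hWt, ENNReal.ofReal_le_ofReal_iff (by positivity)] at key
  exact key

/-- A set on which `f` is Lipschitz. -/
def lipSet (V : Set (E n)) (f : E n → AQ m Q) (Φ : E n → ℝ≥0∞) (K : Set (E n)) (N : ℕ) :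
    Set (E n) :=
  {y | y ∈ K ∧ y ∈ maxSet Φ N ∧ ∀ᵐ h, y + h ∈ V →
    ENNReal.ofReal (gdist (f (y + h)) (f y)) ≤ ‖h‖ₑ * ∫⁻ t, Φ (y + t • h) ∂unitMeasure}

/-- The segment condition holds at a.e. point of `V`, so up to a null set only `K` and the closed
maximal set remain. -/
lemma nullMeasurableSet_lipSet (hf : IsSobolevBounded V f Φ) {K : Set (E n)} (hK : MeasurableSet K)
    (hKV : K ⊆ V) (N : ℕ) : NullMeasurableSet (lipSet V f Φ K N) := by
  refine NullMeasurableSet.congr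
    (hK.inter (isClosed_maxSet hf.measurable N).measurableSet).nullMeasurableSet ?_
  filter_upwards [hf.ae_ae_gdist_le] with y hy
  apply propext
  exact ⟨fun h => ⟨h.1, h.2, hy (hKV h.1)⟩, fun h => ⟨h.1, h.2.1⟩⟩

lemma ae_exists_mem_lipSet (hf : IsSobolevBounded V f Φ) {K : Set (E n)} (hKV : K ⊆ V) :
    ∀ᵐ y, y ∈ K → ∃ N, y ∈ lipSet V f Φ K N := by
  filter_upwards [hf.ae_ae_gdist_le, ae_exists_mem_maxSet hf.measurable hf.int_finite]
    with y hy1 ⟨N, hN⟩ hyK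
  exact ⟨N, hyK, hN, hy1 (hKV hyK)⟩

/-- Two points of B_R are less than 2R apart, so the balls needed around them stay in B_{3R}; this
explains the factor 3 throughout. -/
lemma gdist_le_of_mem_lipSet (hf : IsSobolevBounded V f Φ) {x : E n} {R : ℝ}
    (hV : Metric.ball x (3 * R) ⊆ V) {N : ℕ} :
    ∀ y ∈ lipSet V f Φ (Metric.ball x R) N, ∀ z ∈ lipSet V f Φ (Metric.ball x R) N,
      gdist (f y) (f z) ≤ 2 ^ (n + 1) * N * ‖y - z‖ := by
  intro y hy z hz
  have hsub : ∀ w ∈ Metric.ball x R, Metric.ball w ‖y - z‖ ⊆ V := by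
    intro w hw
    refine (Metric.ball_subset_ball' ?_).trans hV
    have h1 := dist_triangle y x z
    rw [dist_comm x z, dist_eq_norm] at h1
    linarith [Metric.mem_ball.1 hw, Metric.mem_ball.1 hy.1, Metric.mem_ball.1 hz.1]
  exact hf.gdist_le_of_mem_maxSet hy.2.2 hz.2.2 hy.2.1 hz.2.1 (hsub y hy.1) (hsub z hz.1)

end IsSobolevBounded

/-! ### Translations in L² and difference quotients of jets -/

lemma eLpNorm_two_sq {α F : Type*} [MeasurableSpace α] [NormedAddCommGroup F] {μ : Measure α}
    (f : α → F) : eLpNorm f 2 μ ^ 2 = ∫⁻ x, ‖f x‖ₑ ^ 2 ∂μ := by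
  rw [eLpNorm_eq_lintegral_rpow_enorm_toReal two_ne_zero ENNReal.ofNat_ne_top]
  simp only [ENNReal.toReal_ofNat, ENNReal.rpow_ofNat]
  rw [← ENNReal.rpow_natCast, ← ENNReal.rpow_mul]
  simp

lemma sq_lintegral_le {α : Type*} [MeasurableSpace α] {μ : Measure α} [IsProbabilityMeasure μ]
    {f : α → ℝ≥0∞} (hf : AEMeasurable f μ) : (∫⁻ x, f x ∂μ) ^ 2 ≤ ∫⁻ x, f x ^ 2 ∂μ := by
  have h := ENNReal.lintegral_mul_le_Lp_mul_Lq μ Real.HolderConjugate.two_two hf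
    (aemeasurable_const (b := (1 : ℝ≥0∞)))
  simp only [Pi.mul_apply, mul_one, one_pow, ENNReal.one_rpow, lintegral_const, measure_univ,
    ENNReal.rpow_ofNat] at h
  refine (pow_le_pow_left' h 2).trans_eq ?_
  rw [← ENNReal.rpow_natCast, ← ENNReal.rpow_mul]
  simp

lemma tendsto_eLpNorm_translate {n : ℕ} {g : E n → ℝ} (hg : MemLp g 2) :
    Tendsto (fun h : E n => eLpNorm (fun y => g (y + h) - g y) 2 volume) (𝓝 0) (𝓝 0) := by
  have hp : ∀ h : E n, MeasurePreserving (fun y => y + h) volume volume :=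
    fun h => measurePreserving_add_right volume h
  have hgh : ∀ h : E n, MemLp (fun y => g (y + h)) 2 := fun h =>
    hg.comp_measurePreserving (hp h)
  set C : C(E n, C(E n, E n)) := ContinuousMap.curry ⟨fun p : E n × E n => p.2 + p.1, by fun_prop⟩
  have h1 := Filter.Tendsto.compMeasurePreservingLp (μ := (volume : Measure (E n)))
    (ν := (volume : Measure (E n))) (l := 𝓝 (0 : E n))
    (tendsto_const_nhds (x := hg.toLp g)) (C.continuous.tendsto 0) hp (hp 0) ENNReal.ofNat_ne_top
  have h2 : Tendsto (fun h : E n => (hgh h).toLp _) (𝓝 0) (𝓝 ((hgh 0).toLp _)) := h1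
  rw [Lp.tendsto_Lp_iff_tendsto_eLpNorm''] at h2
  refine h2.congr fun h => ?_
  congr 1
  ext1 y
  simp

/-- Jensen's inequality in t and Fubini bound the squared norm by an average of squared norms of
translation differences with steps no longer than |sa|. -/
lemma tendsto_eLpNorm_average {n : ℕ} {g : E n → ℝ} (hg : MemLp g 2) (hg1 : Integrable g)
    (a : E n) : Tendsto (fun s : ℝ => eLpNorm
      (fun y => ∫ t, g (y + t • s • a) ∂unitMeasure - g y) 2 volume) (𝓝 0) (𝓝 0) := by
  rw [ENNReal.tendsto_nhds_zero]
  intro ε hε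
  have h1 := (ENNReal.tendsto_nhds_zero.1 (tendsto_eLpNorm_translate hg)) ε hε
  obtain ⟨δ, hδ, hδ'⟩ := Metric.eventually_nhds_iff.1 h1
  have h2 : Tendsto (fun s : ℝ => ‖s • a‖) (𝓝 0) (𝓝 0) := by
    have : Continuous fun s : ℝ => ‖s • a‖ := by fun_prop
    simpa using this.tendsto 0
  filter_upwards [h2.eventually_lt_const hδ] with s hs
  have hsh := measurePreserving_shear (s • a)
  have hint : Integrable (fun p : ℝ × E n => g (p.2 + p.1 • s • a)) (unitMeasure.prod volume) :=
    hsh.integrable_comp_of_integrable hg1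
  have hm : AEStronglyMeasurable (fun p : ℝ × E n => g (p.2 + p.1 • s • a) - g p.2)
      (unitMeasure.prod volume) := hint.aestronglyMeasurable.sub hg.1.comp_snd
  have hme : AEMeasurable (fun p : ℝ × E n => ‖g (p.2 + p.1 • s • a) - g p.2‖ₑ)
      (unitMeasure.prod volume) := hm.enorm
  refine (ENNReal.pow_le_pow_left_iff two_ne_zero).1 ?_
  rw [eLpNorm_two_sq]
  calc ∫⁻ y, ‖∫ t, g (y + t • s • a) ∂unitMeasure - g y‖ₑ ^ 2
      ≤ ∫⁻ y, ∫⁻ t, ‖g (y + t • s • a) - g y‖ₑ ^ 2 ∂unitMeasure := by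
        refine lintegral_mono_ae ?_
        filter_upwards [hint.prod_left_ae, hm.prod_swap.prodMk_left] with y hy1 hy2
        have e1 : ∫ t, g (y + t • s • a) ∂unitMeasure - g y =
            ∫ t, (g (y + t • s • a) - g y) ∂unitMeasure := by
          rw [integral_sub hy1 (integrable_const _)]
          simp
        rw [e1]
        exact (pow_le_pow_left' (enorm_integral_le_lintegral_enorm _) 2).trans (sq_lintegral_le hy2.enorm)
    _ = ∫⁻ t, ∫⁻ y, ‖g (y + t • s • a) - g y‖ₑ ^ 2 ∂volume ∂unitMeasure := by
        rw [lintegral_lintegral_swap]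
        exact (hme.prod_swap.pow_const 2)
    _ ≤ ∫⁻ _t, ε ^ 2 ∂unitMeasure := by
        refine setLIntegral_mono' measurableSet_Icc fun t ht => ?_
        rw [← eLpNorm_two_sq]
        refine pow_le_pow_left' (hδ' ?_) 2
        rw [dist_zero_right, norm_smul, Real.norm_of_nonneg ht.1]
        exact (mul_le_of_le_one_left (norm_nonneg _) ht.2).trans_lt hs
    _ = ε ^ 2 := by simp

lemma tendsto_integral_mul {α ι : Type*} [MeasurableSpace α] {μ : Measure α} {l : Filter ι}
    {F G : ι → α → ℝ} {f g : α → ℝ} (hF : ∀ i, MemLp (F i) 2 μ) (hG : ∀ i, MemLp (G i) 2 μ)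
    (hf : MemLp f 2 μ) (hg : MemLp g 2 μ) (hFf : Tendsto (fun i => eLpNorm (F i - f) 2 μ) l (𝓝 0))
    (hGg : Tendsto (fun i => eLpNorm (G i - g) 2 μ) l (𝓝 0)) :
    Tendsto (fun i => ∫ x, F i x * G i x ∂μ) l (𝓝 (∫ x, f x * g x ∂μ)) := by
  have key : ∀ {u v : α → ℝ} (hu : MemLp u 2 μ) (hv : MemLp v 2 μ),
      ∫ x, u x * v x ∂μ = inner ℝ (hu.toLp u) (hv.toLp v) := by
    intro u v hu hv
    rw [L2.inner_def]
    refine integral_congr_ae ?_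
    filter_upwards [hu.coeFn_toLp, hv.coeFn_toLp] with x h1 h2
    rw [h1, h2]
    simp [mul_comm]
  simp only [key (hF _) (hG _), key hf hg]
  exact ((Lp.tendsto_Lp_iff_tendsto_eLpNorm'' F hF f hf).2 hFf).inner
    ((Lp.tendsto_Lp_iff_tendsto_eLpNorm'' G hG g hg).2 hGg)

/-- There is a sequence of small steps in the direction `a` which almost surely stay in `A`, and
along which the means of `g` converge. -/
lemma exists_seq_translate {n : ℕ} {A : Set (E n)} (hA : NullMeasurableSet A)
    (hAf : volume A ≠ ⊤)
    {g : E n → ℝ} (hg : MemLp g 2) (hg1 : Integrable g) (a : E n) :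
    ∃ s : ℕ → ℝ, (∀ k, 0 < s k) ∧ Tendsto s atTop (𝓝 0) ∧
      (∀ᵐ y, y ∈ A → ∀ᶠ k in atTop, y + s k • a ∈ A) ∧
      ∀ᵐ y, Tendsto (fun k => ∫ t, g (y + t • s k • a) ∂unitMeasure) atTop (𝓝 (g y)) := by
  set χ : E n → ℝ := A.indicator fun _ => 1
  have hχ : MemLp χ 2 := by
    obtain ⟨A', -, hA', hAA'⟩ := hA.exists_measurable_superset_ae_eq
    exact (memLp_indicator_const 2 hA' (1 : ℝ) (Or.inr (measure_congr hAA' ▸ hAf))).ae_eq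
      (indicator_ae_eq_of_ae_eq_set hAA')
  have hlim : Tendsto (fun s : ℝ => s • a) (𝓝[>] 0) (𝓝 0) := by
    have : Continuous fun s : ℝ => s • a := by fun_prop
    have := this.tendsto 0
    rw [zero_smul] at this
    exact this.mono_left nhdsWithin_le_nhds
  have h1 : TendstoInMeasure volume (fun (s : ℝ) y => χ (y + s • a)) (𝓝[>] 0) χ :=
    tendstoInMeasure_of_tendsto_eLpNorm two_ne_zero
      (fun s => hχ.1.comp_measurePreserving (measurePreserving_add_right volume (s • a))) hχ.1
      ((tendsto_eLpNorm_translate hχ).comp hlim)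
  obtain ⟨s, hs0, hs⟩ := h1.exists_seq_tendsto_ae'
  have hs1 : Tendsto s atTop (𝓝 0) := hs0.mono_right nhdsWithin_le_nhds
  have h2 : TendstoInMeasure volume (fun (k : ℕ) y => ∫ t, g (y + t • s k • a) ∂unitMeasure)
      atTop g :=
    tendstoInMeasure_of_tendsto_eLpNorm two_ne_zero
      (fun k => ((measurePreserving_shear (s k • a)).integrable_comp_of_integrable
        hg1).integral_prod_right.aestronglyMeasurable) hg.1
      ((tendsto_eLpNorm_average hg hg1 a).comp hs1)
  obtain ⟨ns, hns, hg2⟩ := h2.exists_seq_tendsto_ae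
  have hpos : ∀ᶠ k in atTop, 0 < s (ns k) :=
    (hs0.comp hns.tendsto_atTop).eventually self_mem_nhdsWithin
  obtain ⟨k0, hk0⟩ := eventually_atTop.1 hpos
  have hshift : Tendsto (fun k => ns (k + k0)) atTop atTop :=
    hns.tendsto_atTop.comp (tendsto_add_atTop_nat k0)
  refine ⟨fun k => s (ns (k + k0)), fun k => hk0 _ (by omega), hs1.comp hshift, ?_, ?_⟩
  · filter_upwards [hs] with y hy hyA
    -- The indicator takes only the values 0 and 1, so convergence to 1 means that the translated
    -- points are eventually in `A`.
    have h3 := (hy.comp hshift).eventually (lt_mem_nhds (show (1 / 2 : ℝ) < χ y by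
      simp only [χ, Set.indicator_of_mem hyA]; norm_num))
    filter_upwards [h3] with k hk
    by_contra hn
    simp only [Function.comp_apply, χ, Set.indicator_of_notMem hn] at hk
    norm_num at hk
  · filter_upwards [hg2] with y hy
    exact hy.comp (tendsto_add_atTop_nat k0)

namespace IsJetOn

variable {n m Q : ℕ} {f : E n → AQ m Q} {A : Set (E n)} {y : E n} {v : Fin Q → E m}
  {L : Fin Q → E n →L[ℝ] E m} {s : ℕ → ℝ} {a : E n}

lemma tendsto_error (hJ : IsJetOn f A y v L) (hs0 : ∀ k, 0 < s k) (hs : Tendsto s atTop (𝓝 0))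
    (hA : ∀ᶠ k in atTop, y + s k • a ∈ A) :
    Tendsto (fun k => (s k)⁻¹ * gdist (f (y + s k • a)) (ofVec fun i => v i + L i (s k • a)))
      atTop (𝓝 0) := by
  have h1 : Tendsto (fun k => y + s k • a) atTop (𝓝[A] y) := by
    refine tendsto_nhdsWithin_iff.2 ⟨?_, hA⟩
    have := (hs.smul_const a).const_add y
    simpa using this
  have h2 := tendsto_inv_mul_of_isLittleO (t := s) (a := a) (hJ.isLittleO.comp_tendsto h1) ?_
  · refine h2.congr fun k => ?_
    simp only [Function.comp_apply, add_sub_cancel_left]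
  · refine tendsto_const_nhds.congr fun k => ?_
    simp only [Function.comp_apply, add_sub_cancel_left]
    rw [smul_smul, inv_mul_cancel₀ (hs0 k).ne', one_smul]

/-- Compare the expansion with the constant tuple, viewed as an expansion with zero differentials:
for small steps their distance is exactly s_k times the ℓ² norm of (L_i a). -/
lemma tendsto_gdist (hJ : IsJetOn f A y v L) (hs0 : ∀ k, 0 < s k) (hs : Tendsto s atTop (𝓝 0))
    (hA : ∀ᶠ k in atTop, y + s k • a ∈ A) :
    Tendsto (fun k => (s k)⁻¹ * gdist (f (y + s k • a)) (f y)) atTop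
      (𝓝 (ltwo fun i => L i a)) := by
  rw [tendsto_iff_norm_sub_tendsto_zero]
  refine squeeze_zero' (.of_forall fun k => norm_nonneg _) ?_ (hJ.tendsto_error hs0 hs hA)
  have h1 : Tendsto (fun k => s k • a) atTop (𝓝 0) := by
    simpa using hs.smul_const a
  filter_upwards [h1.eventually (eventually_gdist_jet_eq v L 0 fun _ _ _ => rfl)] with k hk
  have h2 : (fun i => L i (s k • a) - (0 : Fin Q → E n →L[ℝ] E m) i (s k • a)) =
      s k • fun i => L i a := by
    ext1 i
    simp
  have h3 : (ofVec fun i => v i + (0 : Fin Q → E n →L[ℝ] E m) i (s k • a)) = f y := by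
    rw [hJ.eq_ofVec]
    simp
  rw [h2, h3, ltwo_smul, abs_of_pos (hs0 k)] at hk
  have h4 : (ltwo fun i => L i a) = (s k)⁻¹ *
      gdist (ofVec fun i => v i + L i (s k • a)) (f y) := by
    rw [hk, inv_mul_cancel_left₀ (hs0 k).ne']
  rw [h4, ← mul_sub, norm_mul, Real.norm_of_nonneg (inv_pos.2 (hs0 k)).le]
  exact mul_le_mul_of_nonneg_left (abs_gdist_sub_le _ _ _) (inv_pos.2 (hs0 k)).le

/-- The norm of the linearized tuple squares to an explicit quadratic polynomial in s_k, and it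
differs from |f| by o(s_k). -/
lemma tendsto_qnorm_sq (hJ : IsJetOn f A y v L) (hs0 : ∀ k, 0 < s k)
    (hs : Tendsto s atTop (𝓝 0)) (hA : ∀ᶠ k in atTop, y + s k • a ∈ A) :
    Tendsto (fun k => (s k)⁻¹ * (qnorm (f (y + s k • a)) ^ 2 - qnorm (f y) ^ 2)) atTop
      (𝓝 (2 * ∑ i, inner ℝ (v i) (L i a))) := by
  set l : ℕ → ℝ := fun k => ltwo fun i => v i + L i (s k • a) with hl
  have hlsq : ∀ k, l k ^ 2 = qnorm (f y) ^ 2 + s k * (2 * ∑ i, inner ℝ (v i) (L i a)) +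
      s k ^ 2 * ∑ i, ‖L i a‖ ^ 2 := by
    intro k
    simp only [hl]
    rw [ltwo_sq, hJ.eq_ofVec, qnorm_ofVec, ltwo_sq]
    simp only [Finset.mul_sum, ← Finset.sum_add_distrib]
    refine Finset.sum_congr rfl fun i _ => ?_
    rw [map_smul, norm_add_sq_real, inner_smul_right, norm_smul, Real.norm_of_nonneg (hs0 k).le]
    ring
  have hl1 : Tendsto l atTop (𝓝 (ltwo v)) := by
    have hc : Continuous fun h : E n => ltwo fun i => v i + L i h := by
      unfold ltwo
      fun_prop
    have h1 : Tendsto (fun k => s k • a) atTop (𝓝 0) := by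
      simpa using hs.smul_const a
    have h2 := (hc.tendsto 0).comp h1
    simp only [map_zero, add_zero] at h2
    exact h2
  have herr := hJ.tendsto_error hs0 hs hA
  have hdiff : Tendsto (fun k => (s k)⁻¹ * (qnorm (f (y + s k • a)) - l k)) atTop (𝓝 0) := by
    refine squeeze_zero_norm (fun k => ?_) herr
    rw [norm_mul, Real.norm_of_nonneg (inv_pos.2 (hs0 k)).le]
    refine mul_le_mul_of_nonneg_left ?_ (inv_pos.2 (hs0 k)).le
    simp only [hl]
    rw [← qnorm_ofVec]
    exact abs_gdist_sub_le _ _ _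
  have hdiff0 : Tendsto (fun k => qnorm (f (y + s k • a)) - l k) atTop (𝓝 0) := by
    have := hs.mul hdiff
    rw [zero_mul] at this
    refine this.congr fun k => ?_
    rw [mul_inv_cancel_left₀ (hs0 k).ne']
  have hsum : Tendsto (fun k => (qnorm (f (y + s k • a)) - l k) + 2 * l k) atTop
      (𝓝 (0 + 2 * ltwo v)) := hdiff0.add (hl1.const_mul 2)
  have h2 := (hdiff.mul hsum).add ((tendsto_const_nhds (x := 2 * ∑ i, inner ℝ (v i) (L i a))).add
    (hs.mul_const (∑ i, ‖L i a‖ ^ 2)))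
  rw [zero_mul, zero_mul, zero_add, add_zero] at h2
  refine h2.congr fun k => ?_
  have h3 : qnorm (f (y + s k • a)) ^ 2 - qnorm (f y) ^ 2 =
      (qnorm (f (y + s k • a)) - l k) * ((qnorm (f (y + s k • a)) - l k) + 2 * l k) +
      (s k * (2 * ∑ i, inner ℝ (v i) (L i a)) + s k ^ 2 * ∑ i, ‖L i a‖ ^ 2) := by
    have := hlsq k
    linear_combination this
  rw [h3]
  have := (hs0 k).ne'
  field_simp

lemma tendsto_qnorm (hJ : IsJetOn f A y v L) (hs0 : ∀ k, 0 < s k)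
    (hs : Tendsto s atTop (𝓝 0)) (hA : ∀ᶠ k in atTop, y + s k • a ∈ A) :
    Tendsto (fun k => qnorm (f (y + s k • a))) atTop (𝓝 (qnorm (f y))) := by
  rw [tendsto_iff_norm_sub_tendsto_zero]
  have h1 := hs.mul (hJ.tendsto_gdist hs0 hs hA)
  rw [zero_mul] at h1
  refine squeeze_zero (fun k => norm_nonneg _) (fun k => ?_) h1
  rw [mul_inv_cancel_left₀ (hs0 k).ne']
  exact abs_gdist_sub_le _ _ _

end IsJetOn

/-! ### Integrability of the jet and the weak derivative of |f|² -/

namespace IsSobolevBounded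

variable {n m Q : ℕ} {V : Set (E n)} {f : E n → AQ m Q} {Φ : E n → ℝ≥0∞} {x : E n} {R : ℝ}

/-- Only the functions 𝒢(f,T) are known to be measurable, so the distance is written as a countable
supremum of their differences. -/
lemma aemeasurable_gdist_translate (hf : IsSobolevBounded V f Φ) {K : Set (E n)}
    (hKV : K ⊆ V) {h : E n} (hKh : ∀ y ∈ K, y + h ∈ V) :
    AEMeasurable (fun y => ENNReal.ofReal (gdist (f (y + h)) (f y))) (volume.restrict K) := by
  have e1 : (fun y => ENNReal.ofReal (gdist (f (y + h)) (f y))) = fun y => ⨆ k,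
      ENNReal.ofReal |gdist (f (y + h)) (densePt m Q k) - gdist (f y) (densePt m Q k)| := by
    ext1 y
    refine le_antisymm (ofReal_gdist_le fun k => le_iSup (fun k => ENNReal.ofReal
      |gdist (f (y + h)) (densePt m Q k) - gdist (f y) (densePt m Q k)|) k) ?_
    exact iSup_le fun k => ENNReal.ofReal_le_ofReal (abs_gdist_sub_le _ _ _)
  rw [e1]
  refine AEMeasurable.iSup fun k => ?_
  have hq : Measure.QuasiMeasurePreserving (fun y => y + h) (volume.restrict K)
      (volume.restrict V) :=
    (measurePreserving_add_right volume h).quasiMeasurePreserving.restrict hKh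
  have h1 := (hf.aestronglyMeasurable (densePt m Q k)).comp_quasiMeasurePreserving hq
  have h2 := (hf.aestronglyMeasurable (densePt m Q k)).mono_measure
    (Measure.restrict_mono hKV le_rfl)
  exact (h1.sub h2).norm.aemeasurable.ennreal_ofReal

/-- Jensen on the segment and translation invariance bound the difference quotients in L² uniformly
in the step, as needed for Fatou's lemma. -/
lemma lintegral_gdist_translate_sq_le (hf : IsSobolevBounded V f Φ) {K : Set (E n)}
    (hK : MeasurableSet K) (hKV : K ⊆ V) {h : E n} (hKh : ∀ y ∈ K, y + h ∈ V) :
    ∫⁻ y in K, ENNReal.ofReal (gdist (f (y + h)) (f y)) ^ 2 ≤ ‖h‖ₑ ^ 2 * ∫⁻ y, Φ y ^ 2 := by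
  have hΦm := hf.measurable
  have hm : Measurable fun p : ℝ × E n => Φ (p.2 + p.1 • h) := hΦm.comp (by fun_prop)
  calc ∫⁻ y in K, ENNReal.ofReal (gdist (f (y + h)) (f y)) ^ 2
      ≤ ∫⁻ y in K, ‖h‖ₑ ^ 2 * ∫⁻ t, Φ (y + t • h) ^ 2 ∂unitMeasure := by
        refine setLIntegral_mono_ae' hK ?_
        filter_upwards [hf.ae_gdist_le h] with y hy hyK
        refine (pow_le_pow_left' (hy (hKV hyK) (hKh y hyK)) 2).trans ?_
        rw [mul_pow]
        gcongr
        exact sq_lintegral_le (hΦm.comp (by fun_prop)).aemeasurable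
    _ ≤ ∫⁻ y, ‖h‖ₑ ^ 2 * ∫⁻ t, Φ (y + t • h) ^ 2 ∂unitMeasure := setLIntegral_le_lintegral _ _
    _ = ‖h‖ₑ ^ 2 * ∫⁻ t, ∫⁻ y, Φ (y + t • h) ^ 2 ∂volume ∂unitMeasure := by
        rw [lintegral_const_mul' _ _ (by simp), lintegral_lintegral_swap]
        exact ((hm.comp measurable_swap).pow_const 2).aemeasurable
    _ = ‖h‖ₑ ^ 2 * ∫⁻ y, Φ y ^ 2 := by
        have : ∀ t : ℝ, ∫⁻ y, Φ (y + t • h) ^ 2 = ∫⁻ y, Φ y ^ 2 := fun t =>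
          lintegral_add_right_eq_self (fun y => Φ y ^ 2) (t • h)
        simp only [this, lintegral_const, measure_univ, mul_one]

lemma ae_isJetOn (hf : IsSobolevBounded V f Φ) (hV : Metric.ball x (3 * R) ⊆ V)
    (hRV : Metric.ball x R ⊆ V) (N : ℕ) :
    ∀ᵐ y, y ∈ lipSet V f Φ (Metric.ball x R) N → ∃ v L,
      IsJetOn f (lipSet V f Φ (Metric.ball x R) N) y v L ∧ jet f y = ofVec fun i => (v i, L i) := by
  have hA := hf.nullMeasurableSet_lipSet measurableSet_ball hRV N
  filter_upwards [ae_exists_isJetOn hA (by positivity) (hf.gdist_le_of_mem_lipSet hV)] with y hy hyA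
  obtain ⟨hd, v, L, hJ⟩ := hy hyA
  exact ⟨v, L, hJ, jet_eq_of_isJetOn hJ hyA hA hd⟩

lemma lipSet_mono {K : Set (E n)} : Monotone (lipSet V f Φ K) := by
  intro N M hNM y hy
  refine ⟨hy.1, fun ρ hρ => (hy.2.1 ρ hρ).trans ?_, hy.2.2⟩
  gcongr

lemma iUnion_lipSet_ae_eq (hf : IsSobolevBounded V f Φ) {K : Set (E n)} (hKV : K ⊆ V) :
    (⋃ N, lipSet V f Φ K N : Set (E n)) =ᵐ[volume] K := by
  filter_upwards [hf.ae_exists_mem_lipSet hKV] with y hy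
  apply propext
  constructor
  · intro h
    obtain ⟨N, hN⟩ := Set.mem_iUnion.1 h
    exact hN.1
  · intro h
    exact Set.mem_iUnion.2 (hy h)

/-- The squared directional derivative of the jet is measurable and integrable. -/
theorem aemeasurable_qsum_sq (hf : IsSobolevBounded V f Φ) (hR : 0 < R)
    (hV : Metric.ball x (3 * R) ⊆ V) (a : E n) :
    AEMeasurable (fun y => ENNReal.ofReal (qsum (jet f y) fun p => ‖p.2 a‖ ^ 2))
      (volume.restrict (Metric.ball x R)) ∧
    ∫⁻ y in Metric.ball x R, ENNReal.ofReal (qsum (jet f y) fun p => ‖p.2 a‖ ^ 2) ≤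
      ‖a‖ₑ ^ 2 * ∫⁻ y, Φ y ^ 2 := by
  have hRV : Metric.ball x R ⊆ V := (Metric.ball_subset_ball (by linarith)).trans hV
  have key : ∀ N, AEMeasurable (fun y => ENNReal.ofReal (qsum (jet f y) fun p => ‖p.2 a‖ ^ 2))
      (volume.restrict (lipSet V f Φ (Metric.ball x R) N)) ∧
      ∫⁻ y in lipSet V f Φ (Metric.ball x R) N,
        ENNReal.ofReal (qsum (jet f y) fun p => ‖p.2 a‖ ^ 2) ≤ ‖a‖ₑ ^ 2 * ∫⁻ y, Φ y ^ 2 := by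
    intro N
    set A := lipSet V f Φ (Metric.ball x R) N with hAdef
    have hA : NullMeasurableSet A := hf.nullMeasurableSet_lipSet measurableSet_ball hRV N
    have hAsub : A ⊆ Metric.ball x R := fun y hy => hy.1
    -- Only the return of y + s_k a to `A` matters here, so the zero function takes the place of
    -- `g`.
    obtain ⟨s, hs0, hs, hsA, -⟩ := exists_seq_translate hA
      (measure_ne_top_of_subset hAsub measure_ball_lt_top.ne)
      (MemLp.zero' : MemLp (fun _ : E n => (0 : ℝ)) 2 volume) (integrable_zero _ _ _) a
    have h1 : Tendsto (fun k => ‖s k • a‖) atTop (𝓝 0) := by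
      simpa using (hs.smul_const a).norm
    obtain ⟨k0, hk0⟩ := eventually_atTop.1 (h1.eventually_lt_const hR)
    have hmaps : ∀ k, ∀ y ∈ Metric.ball x R, y + s (k + k0) • a ∈ V := by
      intro k y hy
      apply hV
      rw [Metric.mem_ball, dist_eq_norm] at hy ⊢
      have : y + s (k + k0) • a - x = (y - x) + s (k + k0) • a := by abel
      rw [this]
      exact (norm_add_le _ _).trans_lt (by linarith [hk0 (k + k0) (by omega)])
    set w : ℕ → E n → ℝ≥0∞ := fun k y => ENNReal.ofReal ((s (k + k0))⁻¹) ^ 2 *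
      ENNReal.ofReal (gdist (f (y + s (k + k0) • a)) (f y)) ^ 2 with hw
    have hwm : ∀ k, AEMeasurable (w k) (volume.restrict A) := fun k =>
      (((hf.aemeasurable_gdist_translate hRV (hmaps k)).mono_measure
        (Measure.restrict_mono hAsub le_rfl)).pow_const 2).const_mul _
    have hwlim : ∀ᵐ y ∂(volume.restrict A), Tendsto (fun k => w k y) atTop
        (𝓝 (ENNReal.ofReal (qsum (jet f y) fun p => ‖p.2 a‖ ^ 2))) := by
      rw [ae_restrict_iff'₀ hA]
      filter_upwards [hf.ae_isJetOn hV hRV N, hsA] with y hy1 hy2 hyA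
      obtain ⟨v, L, hJ, hj⟩ := hy1 hyA
      have h2 := ((hJ.tendsto_gdist hs0 hs (hy2 hyA)).comp (tendsto_add_atTop_nat k0)).pow 2
      rw [hj, qsum_ofVec]
      rw [ltwo_sq] at h2
      refine ((ENNReal.continuous_ofReal.tendsto _).comp h2).congr fun k => ?_
      simp only [Function.comp_apply, hw]
      rw [mul_pow, ENNReal.ofReal_mul (by positivity),
        ENNReal.ofReal_pow (inv_pos.2 (hs0 _)).le, ENNReal.ofReal_pow (gdist_nonneg _ _)]
    refine ⟨aemeasurable_of_tendsto_metrizable_ae _ hwm hwlim, ?_⟩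
    calc ∫⁻ y in A, ENNReal.ofReal (qsum (jet f y) fun p => ‖p.2 a‖ ^ 2)
        = ∫⁻ y in A, liminf (fun k => w k y) atTop := by
          refine lintegral_congr_ae ?_
          filter_upwards [hwlim] with y hy
          exact hy.liminf_eq.symm
      _ ≤ liminf (fun k => ∫⁻ y in A, w k y) atTop := lintegral_liminf_le' hwm
      _ ≤ ‖a‖ₑ ^ 2 * ∫⁻ y, Φ y ^ 2 := by
          refine liminf_le_of_frequently_le' (.of_forall fun k => ?_)
          simp only [hw]
          rw [lintegral_const_mul' _ _ (by simp)]
          calc _ ≤ ENNReal.ofReal ((s (k + k0))⁻¹) ^ 2 *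
                (‖s (k + k0) • a‖ₑ ^ 2 * ∫⁻ y, Φ y ^ 2) := by
                refine mul_le_mul' le_rfl ((lintegral_mono_set hAsub).trans ?_)
                exact hf.lintegral_gdist_translate_sq_le measurableSet_ball hRV (hmaps k)
            _ = _ := by
                have h3 : ENNReal.ofReal ((s (k + k0))⁻¹) * ‖s (k + k0)‖ₑ = 1 := by
                  rw [Real.enorm_eq_ofReal (hs0 _).le, ← ENNReal.ofReal_mul (inv_pos.2 (hs0 _)).le,
                    inv_mul_cancel₀ (hs0 _).ne', ENNReal.ofReal_one]
                rw [enorm_smul, ← mul_assoc, ← mul_pow, ← mul_assoc, h3, one_mul]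
  -- The bounds are independent of N and the Lipschitz sets increase to the ball up to a null set,
  -- so the estimates pass to the union.
  have hae := hf.iUnion_lipSet_ae_eq hRV
  rw [← Measure.restrict_congr_set hae]
  constructor
  · exact (aemeasurable_iUnion_iff (s := lipSet V f Φ (Metric.ball x R))).2 fun N => (key N).1
  · rw [setLIntegral_iUnion_of_directed _ (lipSet_mono.directed_le)]
    exact iSup_le fun N => (key N).2

/-- The approximate derivative of `|f|²` coincides with its weak derivative. -/
theorem ae_qsum_inner_eq (hf : IsSobolevBounded V f Φ) (hR : 0 < R)
    (hV : Metric.ball x (3 * R) ⊆ V) (a : E n) {g : E n → ℝ} (hg : MemLp g 2) (hg1 : Integrable g)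
    (hinc : ∀ s : ℝ, ∀ᵐ y, y ∈ V → y + s • a ∈ V →
      qnorm (f (y + s • a)) - qnorm (f y) = s * ∫ t, g (y + t • s • a) ∂unitMeasure) :
    ∀ᵐ y, y ∈ Metric.ball x R →
      (qsum (jet f y) fun p => inner ℝ p.1 (p.2 a)) = qnorm (f y) * g y := by
  have hRV : Metric.ball x R ⊆ V := (Metric.ball_subset_ball (by linarith)).trans hV
  have key : ∀ N, ∀ᵐ y, y ∈ lipSet V f Φ (Metric.ball x R) N →
      (qsum (jet f y) fun p => inner ℝ p.1 (p.2 a)) = qnorm (f y) * g y := by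
    intro N
    set A := lipSet V f Φ (Metric.ball x R) N with hAdef
    have hA : NullMeasurableSet A := hf.nullMeasurableSet_lipSet measurableSet_ball hRV N
    have hAsub : A ⊆ Metric.ball x R := fun y hy => hy.1
    obtain ⟨s, hs0, hs, hsA, hsg⟩ := exists_seq_translate hA
      (measure_ne_top_of_subset hAsub measure_ball_lt_top.ne) hg hg1 a
    filter_upwards [hf.ae_isJetOn hV hRV N, hsA, hsg, ae_all_iff.2 fun k => hinc (s k)]
      with y hy1 hy2 hy3 hy4 hyA
    obtain ⟨v, L, hJ, hj⟩ := hy1 hyA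
    have hyA' := hy2 hyA
    have h1 := hJ.tendsto_qnorm_sq hs0 hs hyA'
    have h2 := ((hJ.tendsto_qnorm hs0 hs hyA').add_const (qnorm (f y))).mul hy3
    -- The quotient of |f|² has two limits to compare: one from the jet, and one from factoring a² -
    -- b² and using the line integral for the increment of |f|.
    have h3 := tendsto_nhds_unique h1 (h2.congr' ?_)
    · rw [hj, qsum_ofVec]
      simp only
      linarith
    · filter_upwards [hyA'] with k hk
      have h4 := hy4 k (hRV hyA.1) (hRV hk.1)
      rw [sq_sub_sq, h4]
      have := (hs0 k).ne'
      field_simp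
  filter_upwards [ae_all_iff.2 key, hf.ae_exists_mem_lipSet hRV] with y hy1 hy2 hyR
  obtain ⟨N, hN⟩ := hy2 hyR
  exact hy1 N hN

/-- The weak derivative of `|f|²`. -/
theorem integral_qnorm_sq_mul_fderiv (hf : IsSobolevBounded V f Φ)
    (hV : Metric.ball x (3 * R) ⊆ V) (hu : MemLp (fun y => qnorm (f y)) 2 (volume.restrict V))
    (a : E n) {g : E n → ℝ} (hg : MemLp g 2) (hg1 : Integrable g)
    (hinc : ∀ s : ℝ, ∀ᵐ y, y ∈ V → y + s • a ∈ V →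
      qnorm (f (y + s • a)) - qnorm (f y) = s * ∫ t, g (y + t • s • a) ∂unitMeasure)
    {ζ : E n → ℝ} (hζ : ContDiff ℝ 1 ζ) (hζc : HasCompactSupport ζ)
    (hζs : tsupport ζ ⊆ Metric.ball x R) (hR : 0 < R) :
    ∫ y, qnorm (f y) ^ 2 * fderiv ℝ ζ y a = - ∫ y, 2 * (qnorm (f y) * g y) * ζ y := by
  have hRV : Metric.ball x R ⊆ V := (Metric.ball_subset_ball (by linarith)).trans hV
  have hVm := hf.isOpen.measurableSet
  set u : E n → ℝ := V.indicator fun y => qnorm (f y) with hudef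
  have hu2 : MemLp u 2 := (memLp_indicator_iff_restrict hVm).2 hu
  have hui : Integrable fun y => u y ^ 2 := hu2.integrable_sq
  obtain ⟨C, hC⟩ := hζc.exists_bound_of_continuous hζ.continuous
  have hz : ∀ y, y ∉ V → ζ y = 0 := fun y hy =>
    image_eq_zero_of_notMem_tsupport fun h => hy (hRV (hζs h))
  have hz' : ∀ y, y ∉ V → fderiv ℝ ζ y = 0 := fun y hy =>
    image_eq_zero_of_notMem_tsupport fun h => hy (hRV (hζs (tsupport_fderiv_subset ℝ h)))
  have e1 : ∫ y, qnorm (f y) ^ 2 * fderiv ℝ ζ y a = ∫ y, u y ^ 2 * fderiv ℝ ζ y a := by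
    congr 1
    ext1 y
    by_cases hy : y ∈ V
    · simp [hudef, hy]
    · simp [hz' y hy]
  have e2 : ∫ y, 2 * (qnorm (f y) * g y) * ζ y = ∫ y, (u y + u y) * (ζ y * g y) := by
    congr 1
    ext1 y
    by_cases hy : y ∈ V
    · simp only [hudef, hy, Set.indicator_of_mem]
      ring
    · simp [hz y hy]
  obtain ⟨D, hD⟩ := hζ.lipschitzWith_of_hasCompactSupport hζc one_ne_zero
  -- Discrete integration by parts: the quotient falls on the smooth ζ in direction -a, and
  -- translation later moves it onto |f|².
  have hlim1 := hD.integral_inv_smul_sub_mul_tendsto_integral_lineDeriv_mul hui (-a)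
  have hld : ∀ y, lineDeriv ℝ ζ y (-a) = - fderiv ℝ ζ y a := fun y => by
    rw [((hζ.differentiable one_ne_zero) y).lineDeriv_eq_fderiv, map_neg]
  simp only [hld] at hlim1
  have hlims : Tendsto (fun s : ℝ => s) (𝓝[>] 0) (𝓝 0) := tendsto_id.mono_left nhdsWithin_le_nhds
  have hlima : Tendsto (fun s : ℝ => s • a) (𝓝[>] 0) (𝓝 0) := by
    simpa using hlims.smul_const a
  have hus : ∀ s : ℝ, MemLp (fun y => u (y + s • a)) 2 := fun s =>
    hu2.comp_measurePreserving (measurePreserving_add_right volume (s • a))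
  have hmul : ∀ {w : E n → ℝ}, MemLp w 2 → MemLp (fun y => ζ y * w y) 2 := fun {w} hw =>
    hw.of_le_mul (c := C) (hζ.continuous.aestronglyMeasurable.mul hw.1) (.of_forall fun y => by
      rw [norm_mul]
      exact mul_le_mul_of_nonneg_right (hC y) (norm_nonneg _))
  set M : ℝ → E n → ℝ := fun s y => ∫ t, g (y + t • s • a) ∂unitMeasure with hM
  have hMm : ∀ s, AEStronglyMeasurable (M s) volume := fun s =>
    ((measurePreserving_shear (s • a)).integrable_comp_of_integrable
      hg1).integral_prod_right.aestronglyMeasurable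
  have hMlim := (tendsto_eLpNorm_average hg hg1 a).comp hlims
  have hMev : ∀ᶠ s in 𝓝[>] (0 : ℝ), MemLp (M s) 2 := by
    filter_upwards [hMlim.eventually_lt_const zero_lt_one] with s hs
    have h1 : MemLp (fun y => M s y - g y) 2 := ⟨(hMm s).sub hg.1, hs.trans ENNReal.one_lt_top⟩
    refine (h1.add hg).ae_eq (.of_forall fun y => ?_)
    simp
  have hlim2 : Tendsto (fun s => ∫ y, (u (y + s • a) + u y) *
      (ζ y * (open Classical in if MemLp (M s) 2 then M s else g) y)) (𝓝[>] 0)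
      (𝓝 (∫ y, (u y + u y) * (ζ y * g y))) := by
    classical
    refine tendsto_integral_mul (fun s => (hus s).add hu2) (fun s => hmul ?_) (hu2.add hu2)
      (hmul hg) ?_ ?_
    · split_ifs with h
      · exact h
      · exact hg
    · refine ((tendsto_eLpNorm_translate hu2).comp hlima).congr fun s => ?_
      simp only [Function.comp_apply]
      congr 1
      ext1 y
      simp
    · have h1 : Tendsto (fun s => ENNReal.ofReal C * eLpNorm (fun y => M s y - g y) 2 volume)
          (𝓝[>] 0) (𝓝 0) := by
        have := ENNReal.Tendsto.const_mul (a := ENNReal.ofReal C) hMlim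
          (Or.inr ENNReal.ofReal_ne_top)
        rwa [mul_zero] at this
      refine tendsto_of_tendsto_of_tendsto_of_le_of_le' tendsto_const_nhds h1
        (.of_forall fun _ => zero_le) ?_
      filter_upwards [hMev] with s hs
      rw [if_pos hs]
      refine eLpNorm_le_mul_eLpNorm_of_ae_le_mul (.of_forall fun y => ?_) 2
      simp only [Pi.sub_apply]
      rw [← mul_sub, norm_mul]
      exact mul_le_mul_of_nonneg_right (hC y) (norm_nonneg _)
  rw [e1, e2]
  have h3 : ∫ y, u y ^ 2 * fderiv ℝ ζ y a = - ∫ y, -(fderiv ℝ ζ y a) * u y ^ 2 := by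
    rw [← integral_neg]
    congr 1
    ext1 y
    ring
  rw [h3]
  congr 1
  refine tendsto_nhds_unique hlim1 (hlim2.congr' ?_)
  filter_upwards [hMev, self_mem_nhdsWithin, hlima.norm.eventually_lt_const
    (show ‖(0 : E n)‖ < R by simpa using hR)] with s hs hs0 hsR
  have hs0 : 0 < s := hs0
  rw [if_pos hs]
  have i1 : Integrable fun y => ζ (y + s • -a) * u y ^ 2 :=
    hui.bdd_mul (hζ.continuous.comp (by fun_prop)).aestronglyMeasurable (.of_forall fun y => hC _)
  have i2 : Integrable fun y => ζ y * u y ^ 2 :=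
    hui.bdd_mul hζ.continuous.aestronglyMeasurable (.of_forall hC)
  have i3 : Integrable fun y => ζ y * u (y + s • a) ^ 2 :=
    (hus s).integrable_sq.bdd_mul hζ.continuous.aestronglyMeasurable (.of_forall hC)
  have e3 : ∫ y, ζ (y + s • -a) * u y ^ 2 = ∫ y, ζ y * u (y + s • a) ^ 2 := by
    rw [← integral_add_right_eq_self (fun y => ζ (y + s • -a) * u y ^ 2) (s • a)]
    simp
  have e4 : ∫ y, s⁻¹ • (ζ (y + s • -a) - ζ y) * u y ^ 2 =
      ∫ y, s⁻¹ * (ζ y * u (y + s • a) ^ 2 - ζ y * u y ^ 2) := by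
    simp only [smul_eq_mul, mul_assoc, sub_mul]
    rw [integral_const_mul, integral_const_mul, integral_sub i1 i2, integral_sub i3 i2, e3]
  rw [e4]
  refine integral_congr_ae ?_
  filter_upwards [hinc s] with y hy
  by_cases hyz : ζ y = 0
  · simp [hyz]
  have hyR : y ∈ Metric.ball x R := hζs (subset_tsupport _ hyz)
  have hyV := hRV hyR
  have hyV' : y + s • a ∈ V := by
    apply hV
    rw [Metric.mem_ball, dist_eq_norm] at hyR ⊢
    rw [add_sub_right_comm]
    exact (norm_add_le _ _).trans_lt (by linarith)
  have h4 := hy hyV hyV'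
  simp only [hudef, Set.indicator_of_mem hyV, Set.indicator_of_mem hyV', hM]
  have h5 : ∫ t, g (y + t • s • a) ∂unitMeasure =
      s⁻¹ * (qnorm (f (y + s • a)) - qnorm (f y)) := by
    rw [h4, inv_mul_cancel_left₀ hs0.ne']
  rw [h5]
  ring

end IsSobolevBounded

/-! ### Radial weights -/

/-- A smooth bump supported in `[1, 4]`. -/
def bump (t : ℝ) : ℝ := expNegInvGlue (t - 1) * expNegInvGlue (4 - t)

lemma contDiff_bump : ContDiff ℝ ∞ bump := by
  unfold bump
  have h : ContDiff ℝ ∞ expNegInvGlue := expNegInvGlue.contDiff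
  exact (h.comp (contDiff_id.sub contDiff_const)).mul (h.comp (contDiff_const.sub contDiff_id))

lemma bump_nonneg (t : ℝ) : 0 ≤ bump t :=
  mul_nonneg (expNegInvGlue.nonneg _) (expNegInvGlue.nonneg _)

lemma bump_pos {t : ℝ} (h1 : 1 < t) (h4 : t < 4) : 0 < bump t :=
  mul_pos (expNegInvGlue.pos_of_pos (by linarith)) (expNegInvGlue.pos_of_pos (by linarith))

lemma bump_eq_zero_of_le {t : ℝ} (h : t ≤ 1) : bump t = 0 := by
  rw [bump, expNegInvGlue.zero_of_nonpos (by linarith), zero_mul]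

lemma bump_eq_zero_of_ge {t : ℝ} (h : 4 ≤ t) : bump t = 0 := by
  rw [bump, expNegInvGlue.zero_of_nonpos (x := 4 - t) (by linarith), mul_zero]

lemma support_bump_subset : Function.support bump ⊆ Set.Icc 1 4 := by
  intro t ht
  by_contra h
  rw [Set.mem_Icc, not_and_or, not_le, not_le] at h
  rcases h with h | h
  · exact ht (bump_eq_zero_of_le h.le)
  · exact ht (bump_eq_zero_of_ge h.le)

lemma tsupport_bump_subset : tsupport bump ⊆ Set.Icc 1 4 :=
  closure_minimal support_bump_subset isClosed_Icc

lemma hasDerivAt_bump (t : ℝ) : HasDerivAt bump (deriv bump t) t :=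
  (contDiff_bump.differentiable (by simp) t).hasDerivAt

lemma continuous_bump : Continuous bump := contDiff_bump.continuous

lemma continuous_deriv_bump : Continuous (deriv bump) :=
  contDiff_bump.continuous_deriv (by simp)

lemma deriv_bump_eq_zero {t : ℝ} (h : t ∉ Set.Icc (1 : ℝ) 4) : deriv bump t = 0 := by
  by_contra hne
  exact h (tsupport_bump_subset (support_deriv_subset hne))

/-- A smooth cutoff, constant on `(-∞, 1]` and zero on `[4, ∞)`. -/
def cutoff (t : ℝ) : ℝ := ∫ u in t..4, bump u

lemma hasDerivAt_cutoff (t : ℝ) : HasDerivAt cutoff (-bump t) t :=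
  intervalIntegral.integral_hasDerivAt_left (continuous_bump.intervalIntegrable _ _)
    continuous_bump.stronglyMeasurable.stronglyMeasurableAtFilter continuous_bump.continuousAt

lemma contDiff_cutoff : ContDiff ℝ ∞ cutoff := by
  rw [contDiff_infty_iff_deriv]
  refine ⟨fun t => (hasDerivAt_cutoff t).differentiableAt, ?_⟩
  have : deriv cutoff = fun t => -bump t := funext fun t => (hasDerivAt_cutoff t).deriv
  rw [this]
  exact contDiff_bump.neg

lemma cutoff_eq_zero {t : ℝ} (h : 4 ≤ t) : cutoff t = 0 := by
  rw [cutoff, intervalIntegral.integral_congr (g := fun _ => 0)]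
  · simp
  · intro u hu
    rw [Set.uIcc_of_ge h] at hu
    exact bump_eq_zero_of_ge hu.1

lemma cutoff_nonneg (t : ℝ) : 0 ≤ cutoff t := by
  rcases le_total t 4 with h | h
  · exact intervalIntegral.integral_nonneg h fun u _ => bump_nonneg u
  · exact (cutoff_eq_zero h).ge

lemma exists_abs_bump_le : ∃ C, ∀ t, |bump t| ≤ C :=
  (HasCompactSupport.of_support_subset_isCompact isCompact_Icc
    support_bump_subset).exists_bound_of_continuous continuous_bump

lemma exists_abs_deriv_bump_le : ∃ C, ∀ t, |deriv bump t| ≤ C :=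
  (HasCompactSupport.of_support_subset_isCompact (K := Set.Icc (1 : ℝ) 4) isCompact_Icc fun t ht => by
    by_contra h
    exact ht (deriv_bump_eq_zero h)).exists_bound_of_continuous continuous_deriv_bump

lemma abs_cutoff_le {t : ℝ} (h : 0 ≤ t) : |cutoff t| ≤ cutoff 0 := by
  rw [abs_of_nonneg (cutoff_nonneg t)]
  have : Antitone cutoff := antitone_of_deriv_nonpos (fun t => (hasDerivAt_cutoff t).differentiableAt)
    fun t => by rw [(hasDerivAt_cutoff t).deriv]; linarith [bump_nonneg t]
  exact this h

section Radial

variable {n : ℕ} (x : E n)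

lemma hasFDerivAt_radial {θ : ℝ → ℝ} {θ' : ℝ} {s : ℝ} {y : E n}
    (h : HasDerivAt θ θ' (‖y - x‖ ^ 2 / s)) :
    HasFDerivAt (fun y => θ (‖y - x‖ ^ 2 / s)) ((2 / s * θ') • innerSL ℝ (y - x)) y := by
  have h1 : HasFDerivAt (fun y : E n => ‖y - x‖ ^ 2) (2 • innerSL ℝ (y - x)) y := by
    refine ((hasFDerivAt_id y).sub_const x).norm_sq.congr_fderiv ?_
    ext v
    simp
  have h2 : HasFDerivAt (fun y : E n => ‖y - x‖ ^ 2 / s) (s⁻¹ • 2 • innerSL ℝ (y - x)) y := by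
    simpa [div_eq_inv_mul] using h1.const_mul s⁻¹
  refine (h.comp_hasFDerivAt y h2).congr_fderiv ?_
  ext v
  simp
  ring

lemma contDiff_radial {θ : ℝ → ℝ} {k : ℕ∞} (h : ContDiff ℝ k θ) (s : ℝ) :
    ContDiff ℝ k (fun y : E n => θ (‖y - x‖ ^ 2 / s)) :=
  h.comp (((contDiff_norm_sq ℝ).comp (contDiff_id.sub contDiff_const)).div_const s)

lemma tsupport_radial_subset {θ : ℝ → ℝ} (h : ∀ t, 4 ≤ t → θ t = 0) {s R : ℝ} (hs : 0 < s)
    (hR : 0 < R) (hsR : 4 * s < R ^ 2) :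
    ∃ r < R, tsupport (fun y : E n => θ (‖y - x‖ ^ 2 / s)) ⊆ Metric.closedBall x r := by
  refine ⟨√(4 * s), (Real.sqrt_lt' hR).2 hsR, closure_minimal (fun y hy => ?_)
    Metric.isClosed_closedBall⟩
  rw [Metric.mem_closedBall, dist_eq_norm]
  by_contra hlt
  rw [not_le, Real.sqrt_lt' (norm_nonneg _ |>.lt_of_ne fun h0 => ?_)] at hlt
  · exact hy (h _ (by rw [le_div_iff₀ hs]; exact hlt.le))
  · rw [← h0] at hlt
    exact absurd hlt (not_lt.2 (Real.sqrt_nonneg _))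

/-- Differentiation of radially weighted integrals with respect to the scale. -/
lemma hasDerivAt_integral_radial {B : Set (E n)} {g : E n → ℝ} (hg : IntegrableOn g B)
    {θ θ' : ℝ → ℝ} (hθ : ∀ t, HasDerivAt θ (θ' t) t) (hθ'c : Continuous θ')
    {C C' : ℝ} (hC : ∀ t, 0 ≤ t → |θ t| ≤ C) (hC' : ∀ t, |θ' t| ≤ C')
    (hθ' : ∀ t, t ∉ Set.Icc (1 : ℝ) 4 → θ' t = 0) {s : ℝ} (hs : 0 < s) :
    HasDerivAt (fun s => ∫ y in B, θ (‖y - x‖ ^ 2 / s) * g y)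
      (∫ y in B, θ' (‖y - x‖ ^ 2 / s) * (-(‖y - x‖ ^ 2 / s ^ 2)) * g y) s := by
  have hθc : Continuous θ := continuous_iff_continuousAt.2 fun t => (hθ t).continuousAt
  have hC'0 : 0 ≤ C' := (abs_nonneg _).trans (hC' 0)
  have hpos : ∀ s' ∈ Set.Ioi (s / 2), 0 < s' := fun s' hs' => (half_pos hs).trans hs'
  refine (hasDerivAt_integral_of_dominated_loc_of_deriv_le (μ := volume.restrict B)
    (F := fun s y => θ (‖y - x‖ ^ 2 / s) * g y)
    (F' := fun s y => θ' (‖y - x‖ ^ 2 / s) * (-(‖y - x‖ ^ 2 / s ^ 2)) * g y)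
    (bound := fun y => C' * (4 / (s / 2)) * ‖g y‖) (s := Set.Ioi (s / 2))
    (Ioi_mem_nhds (half_lt_self hs)) ?_ ?_ ?_ ?_ (hg.norm.const_mul _) ?_).2
  · refine .of_forall fun s' => ?_
    exact (hθc.comp (by fun_prop)).aestronglyMeasurable.mul hg.aestronglyMeasurable
  · exact hg.bdd_mul (c := C) (hθc.comp (by fun_prop)).aestronglyMeasurable
      (.of_forall fun y => hC _ (by positivity))
  · exact ((hθ'c.comp (by fun_prop)).aestronglyMeasurable.mul
      (Continuous.aestronglyMeasurable (by fun_prop))).mul hg.aestronglyMeasurable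
  · refine .of_forall fun y s' hs' => ?_
    have hs'0 := hpos s' hs'
    rw [norm_mul]
    refine mul_le_mul_of_nonneg_right ?_ (norm_nonneg _)
    by_cases ht : ‖y - x‖ ^ 2 / s' ∈ Set.Icc (1 : ℝ) 4
    · rw [norm_mul, norm_neg]
      -- Where θ' is nonzero the argument |y-x|²/s' is at most 4, and s' > s/2, which gives a
      -- dominating constant uniform in y.
      have h1 : ‖‖y - x‖ ^ 2 / s' ^ 2‖ ≤ 4 / (s / 2) := by
        rw [Real.norm_of_nonneg (by positivity)]
        calc ‖y - x‖ ^ 2 / s' ^ 2 = (‖y - x‖ ^ 2 / s') / s' := by field_simp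
          _ ≤ 4 / (s / 2) := div_le_div₀ (by norm_num) ht.2 (by linarith) (le_of_lt hs')
      exact mul_le_mul (hC' _) h1 (norm_nonneg _) hC'0
    · rw [hθ' _ ht, zero_mul, norm_zero]
      positivity
  · refine .of_forall fun y s' hs' => ?_
    have hs'0 := hpos s' hs'
    have h1 : HasDerivAt (fun s => ‖y - x‖ ^ 2 / s) (-(‖y - x‖ ^ 2 / s' ^ 2)) s' := by
      have := (hasDerivAt_inv hs'0.ne').const_mul (‖y - x‖ ^ 2)
      simp only [div_eq_mul_inv]
      exact this.congr_deriv (by ring)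
    exact ((hθ _).comp s' h1).mul_const _

end Radial

/-! ### Hilbert-Schmidt algebra and local integrability -/

lemma inner_e {n : ℕ} (a : E n) (j : Fin n) : inner ℝ a (e j) = a j := by
  rw [e, EuclideanSpace.inner_single_right]
  simp

lemma sum_apply_smul_map_e {n m : ℕ} (L : E n →L[ℝ] E m) (a : E n) :
    ∑ j, a j • L (e j) = L a := by
  conv_rhs => rw [← sum_smul_e a]
  simp

lemma hs_self {n m : ℕ} (L : E n →L[ℝ] E m) : hs L L = ∑ j, ‖L (e j)‖ ^ 2 := by
  simp [hs]

/-- Differentiating a radial weight produces a rank-one matrix, whose pairing with `L` sees only the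
radial derivative. -/
lemma hs_smulRight_inner {n m : ℕ} (L : E n →L[ℝ] E m) (c : ℝ) (a : E n) (P : E m) :
    hs L ((c • innerSL ℝ a).smulRight P) = c * inner ℝ P (L a) := by
  rw [← sum_apply_smul_map_e L a, inner_sum, Finset.mul_sum]
  refine Finset.sum_congr rfl fun j _ => ?_
  simp only [ContinuousLinearMap.smulRight_apply, _root_.smul_apply, innerSL_apply_apply, smul_eq_mul,
    inner_smul_right, inner_e, real_inner_comm P]
  ring

lemma hs_add {n m : ℕ} (L A B : E n →L[ℝ] E m) : hs L (A + B) = hs L A + hs L B := by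
  simp [hs, inner_add_right, Finset.sum_add_distrib]

lemma hs_smul {n m : ℕ} (L A : E n →L[ℝ] E m) (c : ℝ) : hs L (c • A) = c * hs L A := by
  simp [hs, inner_smul_right, Finset.mul_sum]

lemma qsum_add {α : Type*} {Q : ℕ} (T : Sym α Q) (g h : α → ℝ) :
    (qsum T fun p => g p + h p) = qsum T g + qsum T h := by
  simp [qsum]

lemma qsum_const_mul {α : Type*} {Q : ℕ} (T : Sym α Q) (c : ℝ) (g : α → ℝ) :
    (qsum T fun p => c * g p) = c * qsum T g := by
  simp [qsum, Multiset.sum_map_mul_left]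

lemma qsum_finsetSum {α ι : Type*} {Q : ℕ} (T : Sym α Q) (s : Finset ι) (g : ι → α → ℝ) :
    (qsum T fun p => ∑ j ∈ s, g j p) = ∑ j ∈ s, qsum T (g j) := by
  obtain ⟨v, rfl⟩ := exists_ofVec T
  simp only [qsum_ofVec]
  exact Finset.sum_comm

/-- Holds at every point, since the default jet also carries the values of `f`. -/
lemma jet_map_fst {n m Q : ℕ} (f : E n → AQ m Q) (y : E n) : (jet f y).map Prod.fst = f y := by
  classical
  rw [jet]
  split_ifs with h
  · exact h.choose_spec.1
  · rw [Sym.map_map]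
    exact Sym.map_id' _ |>.trans rfl

lemma qnorm_sq_eq_jet {n m Q : ℕ} (f : E n → AQ m Q) (y : E n) :
    qnorm (f y) ^ 2 = qsum (jet f y) fun p => ‖p.1‖ ^ 2 := by
  rw [qnorm_sq, ← jet_map_fst f y, qsum_map]
  rfl

/-- The quantities in the variational identities are integrable on `B_R(x)`, and `|f|²` has the
expected weak derivative there. -/
structure HasLocalEnergy {n m Q : ℕ} (f : E n → AQ m Q) (x : E n) (R : ℝ) : Prop where
  integrableOn_qnorm_sq : IntegrableOn (fun y => qnorm (f y) ^ 2) (Metric.ball x R)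
  integrableOn_sq : ∀ a, IntegrableOn (fun y => qsum (jet f y) fun p => ‖p.2 a‖ ^ 2)
    (Metric.ball x R)
  integrableOn_inner : ∀ j, IntegrableOn (fun y => qsum (jet f y) fun p => inner ℝ p.1 (p.2 (e j)))
    (Metric.ball x R)
  weak : ∀ (j : Fin n) (ζ : E n → ℝ), ContDiff ℝ 1 ζ → HasCompactSupport ζ →
    tsupport ζ ⊆ Metric.ball x R → ∫ y in Metric.ball x R, qnorm (f y) ^ 2 * fderiv ℝ ζ y (e j) =
      - ∫ y in Metric.ball x R, 2 * (qsum (jet f y) fun p => inner ℝ p.1 (p.2 (e j))) * ζ y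

/-- Uses the increment formula with T = Q⟦0⟧: its `g j` represents ∂_j|f|, and comparison with the
jet identifies the pairing of values and derivatives with |f| ∂_j|f| almost everywhere. -/
theorem MemW12.hasLocalEnergy {n m Q : ℕ} {Ω : Set (E n)} {f : E n → AQ m Q} (hf : MemW12 Ω f)
    {x : E n} {R : ℝ} (hR : 0 < R) (hΩ : Metric.ball x (3 * R) ⊆ Ω) : HasLocalEnergy f x R := by
  obtain ⟨Φ, hΦ⟩ := hf.exists_isSobolevBounded Metric.isOpen_ball (convex_ball x (3 * R)) hΩ
    measure_ball_lt_top.ne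
  obtain ⟨φ, hφ, hb⟩ := hf.exists_bound
  obtain ⟨g, hgI, hg2, -, hginc⟩ := hf.exists_increment hφ Metric.isOpen_ball
    (convex_ball x (3 * R)) hΩ measure_ball_lt_top.ne (qzero m Q) (hb (qzero m Q))
  have hle : volume.restrict (Metric.ball x (3 * R)) ≤ volume.restrict Ω :=
    Measure.restrict_mono hΩ le_rfl
  have hBV : Metric.ball x R ⊆ Metric.ball x (3 * R) := Metric.ball_subset_ball (by linarith)
  have hu : MemLp (fun y => qnorm (f y)) 2 (volume.restrict (Metric.ball x (3 * R))) :=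
    hf.memL2.mono_measure hle
  have huB : MemLp (fun y => qnorm (f y)) 2 (volume.restrict (Metric.ball x R)) :=
    hu.mono_measure (Measure.restrict_mono hBV le_rfl)
  have hinc : ∀ (j : Fin n) (s : ℝ), ∀ᵐ y, y ∈ Metric.ball x (3 * R) →
      y + s • e j ∈ Metric.ball x (3 * R) → qnorm (f (y + s • e j)) - qnorm (f y) =
        s * ∫ t, g j (y + t • s • e j) ∂unitMeasure := by
    intro j s
    filter_upwards [hginc (s • e j)] with y hy h1 h2
    refine (hy h1 h2).trans ?_
    rw [← integral_const_mul]
    congr 1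
    ext1 t
    rw [Finset.sum_eq_single j]
    · simp [e]
    · intro l _ hl
      simp [e, hl]
    · simp
  have hinner : ∀ j : Fin n, ∀ᵐ y, y ∈ Metric.ball x R →
      (qsum (jet f y) fun p => inner ℝ p.1 (p.2 (e j))) = qnorm (f y) * g j y := fun j =>
    hΦ.ae_qsum_inner_eq hR subset_rfl (e j) (hg2 j) (hgI j) (hinc j)
  refine ⟨huB.integrable_sq, fun a => ?_, fun j => ?_, fun j ζ hζ hζc hζs => ?_⟩
  · obtain ⟨h1, h2⟩ := hΦ.aemeasurable_qsum_sq hR subset_rfl a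
    have hnn : ∀ y, 0 ≤ qsum (jet f y) fun p => ‖p.2 a‖ ^ 2 := fun y =>
      qsum_nonneg _ fun p => sq_nonneg _
    have h3 : AEMeasurable (fun y => qsum (jet f y) fun p => ‖p.2 a‖ ^ 2)
        (volume.restrict (Metric.ball x R)) := by
      refine h1.ennreal_toReal.congr (.of_forall fun y => ?_)
      exact ENNReal.toReal_ofReal (hnn y)
    refine ⟨h3.aestronglyMeasurable, ?_⟩
    rw [hasFiniteIntegral_iff_ofReal (.of_forall hnn)]
    exact h2.trans_lt (ENNReal.mul_lt_top (by simp) hΦ.sq_finite.lt_top)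
  · have h1 : IntegrableOn (fun y => qnorm (f y) * g j y) (Metric.ball x R) :=
      huB.integrable_mul ((hg2 j).restrict _)
    refine h1.congr ?_
    rw [EventuallyEq, ae_restrict_iff' measurableSet_ball]
    filter_upwards [hinner j] with y hy hyB
    exact (hy hyB).symm
  · have h1 := hΦ.integral_qnorm_sq_mul_fderiv subset_rfl hu (e j) (hg2 j) (hgI j) (hinc j)
      hζ hζc hζs hR
    have hz : ∀ y, y ∉ Metric.ball x R → ζ y = 0 := fun y hy =>
      image_eq_zero_of_notMem_tsupport fun h => hy (hζs h)
    have hz' : ∀ y, y ∉ Metric.ball x R → fderiv ℝ ζ y = 0 := fun y hy =>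
      image_eq_zero_of_notMem_tsupport fun h => hy (hζs (tsupport_fderiv_subset ℝ h))
    rw [setIntegral_eq_integral_of_forall_compl_eq_zero (fun y hy => by simp [hz' y hy]), h1,
      ← setIntegral_eq_integral_of_forall_compl_eq_zero (s := Metric.ball x R)
        (fun y hy => by simp [hz y hy])]
    congr 1
    refine setIntegral_congr_ae measurableSet_ball ?_
    filter_upwards [hinner j] with y hy hyB
    rw [hy hyB]

/-! ### Height, energy and the variational identities -/

/-- The energy density `|Df|²`. -/
def dirEnergy {n m Q : ℕ} (f : E n → AQ m Q) (y : E n) : ℝ := qsum (jet f y) fun p => hs p.2 p.2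

/-- The energy density of the derivative in the direction of `y - x`. -/
def radEnergy {n m Q : ℕ} (f : E n → AQ m Q) (x y : E n) : ℝ :=
  qsum (jet f y) fun p => ‖p.2 (y - x)‖ ^ 2

/-- The product of `f` and its derivative in the direction of `y - x`. -/
def radInner {n m Q : ℕ} (f : E n → AQ m Q) (x y : E n) : ℝ :=
  qsum (jet f y) fun p => inner ℝ p.1 (p.2 (y - x))

section Identities

variable {n m Q : ℕ} {f : E n → AQ m Q} {x : E n} {R : ℝ}

lemma dirEnergy_eq_sum (f : E n → AQ m Q) (y : E n) :
    dirEnergy f y = ∑ j, qsum (jet f y) fun p => ‖p.2 (e j)‖ ^ 2 := by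
  simp only [dirEnergy, hs_self, qsum_finsetSum]

lemma dirEnergy_nonneg (f : E n → AQ m Q) (y : E n) : 0 ≤ dirEnergy f y := by
  rw [dirEnergy_eq_sum]
  exact Finset.sum_nonneg fun j _ => qsum_nonneg _ fun _ => sq_nonneg _

lemma radEnergy_nonneg (f : E n → AQ m Q) (x y : E n) : 0 ≤ radEnergy f x y :=
  qsum_nonneg _ fun _ => sq_nonneg _

lemma radInner_eq_sum (f : E n → AQ m Q) (x y : E n) :
    radInner f x y = ∑ j, (y - x) j * qsum (jet f y) fun p => inner ℝ p.1 (p.2 (e j)) := by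
  simp only [radInner, ← qsum_const_mul, ← qsum_finsetSum]
  congr 1
  ext1 p
  rw [← sum_apply_smul_map_e p.2 (y - x), inner_sum]
  simp only [inner_smul_right]

/-- Polarization: only |Df a|² for constant `a` is known to be integrable, so the mixed products are
recovered from e_j + e_l. -/
lemma radEnergy_eq_sum (f : E n → AQ m Q) (x y : E n) :
    radEnergy f x y = ∑ j, ∑ l, (y - x) j * ((y - x) l * (1 / 2 *
      ((qsum (jet f y) fun p => ‖p.2 (e j + e l)‖ ^ 2) +
        (-1 * (qsum (jet f y) fun p => ‖p.2 (e j)‖ ^ 2) +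
        -1 * (qsum (jet f y) fun p => ‖p.2 (e l)‖ ^ 2))))) := by
  simp only [radEnergy, ← qsum_const_mul, ← qsum_add, ← qsum_finsetSum]
  congr 1
  ext1 p
  rw [← real_inner_self_eq_norm_sq, ← sum_apply_smul_map_e p.2 (y - x), sum_inner]
  refine Finset.sum_congr rfl fun j _ => ?_
  rw [inner_sum]
  refine Finset.sum_congr rfl fun l _ => ?_
  rw [inner_smul_left, inner_smul_right, map_add, norm_add_sq_real]
  simp only [conj_trivial]
  ring

namespace HasLocalEnergy

lemma integrableOn_coord_mul {g : E n → ℝ} (hg : IntegrableOn g (Metric.ball x R)) (j : Fin n) :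
    IntegrableOn (fun y => (y - x) j * g y) (Metric.ball x R) := by
  refine Integrable.bdd_mul (c := R) hg (Continuous.aestronglyMeasurable (by fun_prop)) ?_
  filter_upwards [ae_restrict_mem measurableSet_ball] with y hy
  rw [Metric.mem_ball, dist_eq_norm] at hy
  exact (PiLp.norm_apply_le (y - x) j).trans hy.le

lemma integrableOn_dirEnergy (h : HasLocalEnergy f x R) :
    IntegrableOn (dirEnergy f) (Metric.ball x R) := by
  simp only [funext (dirEnergy_eq_sum f)]
  exact integrable_finsetSum _ fun j _ => h.integrableOn_sq (e j)

lemma integrableOn_radEnergy (h : HasLocalEnergy f x R) :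
    IntegrableOn (radEnergy f x) (Metric.ball x R) := by
  simp only [funext (radEnergy_eq_sum f x)]
  refine integrable_finsetSum _ fun j _ => integrable_finsetSum _ fun l _ =>
    integrableOn_coord_mul (integrableOn_coord_mul (Integrable.const_mul ?_ _) l) j
  exact (h.integrableOn_sq _).add (((h.integrableOn_sq _).const_mul _).add
    ((h.integrableOn_sq _).const_mul _))

lemma integrableOn_radInner (h : HasLocalEnergy f x R) :
    IntegrableOn (radInner f x) (Metric.ball x R) := by
  simp only [funext (radInner_eq_sum f x)]
  exact integrable_finsetSum _ fun j _ => integrableOn_coord_mul (h.integrableOn_inner j) j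

end HasLocalEnergy

/-- The weighted height. -/
def height (f : E n → AQ m Q) (x : E n) (R s : ℝ) : ℝ :=
  ∫ y in Metric.ball x R, bump (‖y - x‖ ^ 2 / s) * qnorm (f y) ^ 2

/-- The weighted energy. -/
def energy (f : E n → AQ m Q) (x : E n) (R s : ℝ) : ℝ :=
  ∫ y in Metric.ball x R, cutoff (‖y - x‖ ^ 2 / s) * dirEnergy f y

/-- The weighted radial energy. -/
def radialEnergy (f : E n → AQ m Q) (x : E n) (R s : ℝ) : ℝ :=
  ∫ y in Metric.ball x R, bump (‖y - x‖ ^ 2 / s) * radEnergy f x y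

/-- The weighted product of `f` and its radial derivative. -/
def radialInner (f : E n → AQ m Q) (x : E n) (R s : ℝ) : ℝ :=
  ∫ y in Metric.ball x R, bump (‖y - x‖ ^ 2 / s) * radInner f x y

lemma height_nonneg (s : ℝ) : 0 ≤ height f x R s :=
  integral_nonneg fun _ => mul_nonneg (bump_nonneg _) (sq_nonneg _)

lemma energy_nonneg (s : ℝ) : 0 ≤ energy f x R s :=
  integral_nonneg fun _ => mul_nonneg (cutoff_nonneg _) (dirEnergy_nonneg _ _)

lemma integrable_bump_mul {g : E n → ℝ} {B : Set (E n)} (hg : IntegrableOn g B) (x : E n) (s : ℝ) :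
    IntegrableOn (fun y => bump (‖y - x‖ ^ 2 / s) * g y) B := by
  obtain ⟨C, hC⟩ := exists_abs_bump_le
  exact Integrable.bdd_mul (c := C) hg
    (continuous_bump.comp (by fun_prop)).aestronglyMeasurable (.of_forall fun y => hC _)

lemma integrable_cutoff_mul {g : E n → ℝ} {B : Set (E n)} (hg : IntegrableOn g B) (x : E n) {s : ℝ}
    (hs : 0 < s) : IntegrableOn (fun y => cutoff (‖y - x‖ ^ 2 / s) * g y) B :=
  Integrable.bdd_mul (c := cutoff 0) hg (contDiff_cutoff.continuous.comp (by fun_prop)).aestronglyMeasurable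
    (.of_forall fun y => abs_cutoff_le (by positivity))

lemma four_le_of_notMem_ball (hR : 0 < R) {s : ℝ} (hs : 0 < s) (hsR : 4 * s < R ^ 2) {y : E n}
    (hy : y ∉ Metric.ball x R) : 4 ≤ ‖y - x‖ ^ 2 / s := by
  rw [Metric.mem_ball, dist_eq_norm, not_lt] at hy
  rw [le_div_iff₀ hs]
  nlinarith

namespace HasLocalEnergy

/-- The Cauchy-Schwarz inequality for the weighted integrals. -/
lemma radialInner_sq_le (h : HasLocalEnergy f x R) (s : ℝ) :
    radialInner f x R s ^ 2 ≤ height f x R s * radialEnergy f x R s := by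
  -- The quadratic in τ is the weighted integral of |τ f + Df(y-x)|²; its discriminant gives the
  -- inequality.
  have key : ∀ τ : ℝ, 0 ≤ height f x R s * (τ * τ) + 2 * radialInner f x R s * τ +
      radialEnergy f x R s := by
    intro τ
    have i1 := (integrable_bump_mul h.integrableOn_qnorm_sq x s).mul_const (τ * τ)
    have i2 := (integrable_bump_mul h.integrableOn_radInner x s).mul_const (2 * τ)
    have i3 := integrable_bump_mul h.integrableOn_radEnergy x s
    have e1 : height f x R s * (τ * τ) + 2 * radialInner f x R s * τ + radialEnergy f x R s =
        ∫ y in Metric.ball x R, bump (‖y - x‖ ^ 2 / s) *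
          qsum (jet f y) fun p => ‖τ • p.1 + p.2 (y - x)‖ ^ 2 := by
      rw [show 2 * radialInner f x R s * τ = radialInner f x R s * (2 * τ) by ring, height,
        radialInner, radialEnergy, ← integral_mul_const, ← integral_mul_const, ← integral_add i1 i2]
      have i12 := i1.add i2
      simp only [Pi.add_def] at i12
      rw [← integral_add i12 i3]
      congr 1
      ext1 y
      rw [qnorm_sq_eq_jet, radInner, radEnergy]
      have : (qsum (jet f y) fun p => ‖τ • p.1 + p.2 (y - x)‖ ^ 2) =
          τ * τ * (qsum (jet f y) fun p => ‖p.1‖ ^ 2) +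
            (2 * τ * (qsum (jet f y) fun p => inner ℝ p.1 (p.2 (y - x))) +
              qsum (jet f y) fun p => ‖p.2 (y - x)‖ ^ 2) := by
        rw [← qsum_const_mul, ← qsum_const_mul, ← qsum_add, ← qsum_add]
        congr 1
        ext1 p
        rw [norm_add_sq_real, norm_smul, inner_smul_left, mul_pow, Real.norm_eq_abs, sq_abs]
        simp only [conj_trivial]
        ring
      rw [this]
      ring
    rw [e1]
    exact integral_nonneg fun y => mul_nonneg (bump_nonneg _) (qsum_nonneg _ fun _ => sq_nonneg _)
  have h1 := discrim_le_zero key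
  rw [discrim] at h1
  linarith

/-- The derivative of the weighted height. -/
lemma hasDerivAt_height (h : HasLocalEnergy f x R) (hR : 0 < R) {s : ℝ} (hs : 0 < s)
    (hsR : 4 * s < R ^ 2) :
    HasDerivAt (height f x R) ((n * height f x R s + 2 * radialInner f x R s) / (2 * s)) s := by
  obtain ⟨C, hC⟩ := exists_abs_bump_le
  obtain ⟨C', hC'⟩ := exists_abs_deriv_bump_le
  have h1 := hasDerivAt_integral_radial x h.integrableOn_qnorm_sq hasDerivAt_bump
    continuous_deriv_bump (fun t _ => hC t) hC' (fun t ht => deriv_bump_eq_zero ht) hs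
  refine h1.congr_deriv ?_
  have hη : ContDiff ℝ ∞ (fun y : E n => bump (‖y - x‖ ^ 2 / s)) := contDiff_radial x contDiff_bump s
  obtain ⟨r, hr, hsupp⟩ := tsupport_radial_subset x (fun t ht => bump_eq_zero_of_ge ht) hs hR hsR
  have hcoord : ∀ j : Fin n, ContDiff ℝ ∞ (fun y : E n => (y - x) j) := fun j => by fun_prop
  -- The components of the radial field bump·(y - x); summing the weak identities over j gives the
  -- divergence theorem for |f|² times this field.
  set ζ : Fin n → E n → ℝ := fun j y => bump (‖y - x‖ ^ 2 / s) * (y - x) j with hζ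
  have hζd : ∀ j, ContDiff ℝ 1 (ζ j) := fun j => (hη.mul (hcoord j)).of_le (by simp)
  have hζt : ∀ j, tsupport (ζ j) ⊆ Metric.closedBall x r := fun j =>
    (tsupport_mul_subset_left).trans hsupp
  have hζc : ∀ j, HasCompactSupport (ζ j) := fun j =>
    HasCompactSupport.of_support_subset_isCompact (isCompact_closedBall x r)
      ((subset_tsupport _).trans (hζt j))
  have hζf : ∀ j y, fderiv ℝ (ζ j) y (e j) = bump (‖y - x‖ ^ 2 / s) +
      2 / s * deriv bump (‖y - x‖ ^ 2 / s) * ((y - x) j * (y - x) j) := by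
    intro j y
    have h2 := hasFDerivAt_radial x (hasDerivAt_bump (‖y - x‖ ^ 2 / s))
    have h3 : HasFDerivAt (fun y : E n => (y - x) j) (EuclideanSpace.proj j : E n →L[ℝ] ℝ) y := by
      simpa using (EuclideanSpace.proj j : E n →L[ℝ] ℝ).hasFDerivAt.sub_const (x j)
    have h4 : HasFDerivAt (ζ j) _ y := h2.mul h3
    rw [h4.fderiv]
    simp only [_root_.add_apply, _root_.smul_apply, innerSL_apply_apply, inner_e, smul_eq_mul]
    have : (EuclideanSpace.proj j : E n →L[ℝ] ℝ) (e j) = 1 := by simp [e]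
    rw [this]
    ring
  have hw := fun j => h.weak j (ζ j) (hζd j) (hζc j)
    ((hζt j).trans (Metric.closedBall_subset_ball hr))
  have hsum := Finset.sum_congr (rfl : Finset.univ = Finset.univ) fun j _ => hw j
  have iL : ∀ j, IntegrableOn (fun y => qnorm (f y) ^ 2 * fderiv ℝ (ζ j) y (e j))
      (Metric.ball x R) := by
    intro j
    have hc : Continuous fun y => fderiv ℝ (ζ j) y (e j) :=
      ((hζd j).continuous_fderiv one_ne_zero).clm_apply continuous_const
    obtain ⟨D, hD⟩ := (HasCompactSupport.fderiv_apply (𝕜 := ℝ) (hζc j) (e j)).exists_bound_of_continuous hc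
    exact Integrable.mul_bdd (c := D) h.integrableOn_qnorm_sq hc.aestronglyMeasurable (.of_forall hD)
  have iR : ∀ j, IntegrableOn (fun y => 2 * (qsum (jet f y) fun p => inner ℝ p.1 (p.2 (e j))) *
      ζ j y) (Metric.ball x R) := by
    intro j
    obtain ⟨D, hD⟩ := (hζc j).exists_bound_of_continuous (hζd j).continuous
    exact Integrable.mul_bdd (c := D) ((h.integrableOn_inner j).const_mul 2)
      (hζd j).continuous.aestronglyMeasurable (.of_forall hD)
  rw [Finset.sum_neg_distrib, ← integral_finsetSum _ fun j _ => iL j,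
    ← integral_finsetSum _ fun j _ => iR j] at hsum
  have hnsq : ∀ a : E n, ∑ j, a j * a j = ‖a‖ ^ 2 := fun a => by
    rw [EuclideanSpace.real_norm_sq_eq]
    exact Finset.sum_congr rfl fun j _ => (sq _).symm
  -- The divergence of the field is n·bump plus a term with bump', and the latter is -2s times the
  -- s-derivative of the weight.
  have eL : ∀ y, ∑ j, qnorm (f y) ^ 2 * fderiv ℝ (ζ j) y (e j) =
      n * (bump (‖y - x‖ ^ 2 / s) * qnorm (f y) ^ 2) + (-(2 * s)) *
        (deriv bump (‖y - x‖ ^ 2 / s) * (-(‖y - x‖ ^ 2 / s ^ 2)) * qnorm (f y) ^ 2) := by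
    intro y
    simp only [hζf, ← Finset.mul_sum, Finset.sum_add_distrib, Finset.sum_const, Finset.card_univ,
      Fintype.card_fin, nsmul_eq_mul]
    rw [hnsq]
    field_simp
  have eR : ∀ y, ∑ j, 2 * (qsum (jet f y) fun p => inner ℝ p.1 (p.2 (e j))) * ζ j y =
      2 * (bump (‖y - x‖ ^ 2 / s) * radInner f x y) := by
    intro y
    rw [radInner_eq_sum, Finset.mul_sum, Finset.mul_sum]
    refine Finset.sum_congr rfl fun j _ => ?_
    simp only [hζ]
    ring
  simp only [eL, eR] at hsum
  have i1 := (integrable_bump_mul h.integrableOn_qnorm_sq x s).const_mul (n : ℝ)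
  have i2 : IntegrableOn (fun y => deriv bump (‖y - x‖ ^ 2 / s) * (-(‖y - x‖ ^ 2 / s ^ 2)) *
      qnorm (f y) ^ 2) (Metric.ball x R) := by
    have hc : Continuous fun y => deriv bump (‖y - x‖ ^ 2 / s) * (-(‖y - x‖ ^ 2 / s ^ 2)) :=
      (continuous_deriv_bump.comp (by fun_prop)).mul (by fun_prop)
    refine Integrable.bdd_mul (c := C' * (R ^ 2 / s ^ 2)) h.integrableOn_qnorm_sq
      hc.aestronglyMeasurable ?_
    filter_upwards [ae_restrict_mem measurableSet_ball] with y hy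
    rw [Metric.mem_ball, dist_eq_norm] at hy
    rw [norm_mul, norm_neg]
    refine mul_le_mul (hC' _) ?_ (norm_nonneg _) ((abs_nonneg _).trans (hC' 0))
    rw [Real.norm_of_nonneg (by positivity)]
    gcongr
  rw [integral_add i1 (i2.const_mul _), integral_const_mul, integral_const_mul,
    integral_const_mul] at hsum
  rw [eq_div_iff (by positivity)]
  simp only [height, radialInner]
  linarith

end HasLocalEnergy

variable {Ω : Set (E n)}

/-- The outer variation along `η f`. -/
lemma IsDirStationary.outer_identity (hf : IsDirStationary Ω f) (hΩ : IsOpen Ω)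
    (h : HasLocalEnergy f x R) (hR : 0 < R) (hB : Metric.ball x R ⊆ Ω) {s : ℝ} (hs0 : 0 < s)
    (hsR : 4 * s < R ^ 2) : s * energy f x R s = 2 * radialInner f x R s := by
  set η : E n → ℝ := fun y => cutoff (‖y - x‖ ^ 2 / s) with hη
  have hηd : ContDiff ℝ ∞ η := contDiff_radial x contDiff_cutoff s
  have hη1 : ContDiff ℝ 1 η := hηd.of_le (by simp)
  obtain ⟨r, hr, hsupp⟩ := tsupport_radial_subset x (fun t ht => cutoff_eq_zero ht) hs0 hR hsR
  have hηc : HasCompactSupport η := HasCompactSupport.of_support_subset_isCompact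
    (isCompact_closedBall x r) ((subset_tsupport _).trans hsupp)
  have hηf : ∀ y, HasFDerivAt η ((2 / s * -bump (‖y - x‖ ^ 2 / s)) • innerSL ℝ (y - x)) y :=
    fun y => hasFDerivAt_radial x (hasDerivAt_cutoff _)
  have hψ1 : ∀ (y : E n) (u : E m), fderiv ℝ (fun y => η y • u) y =
      ((2 / s * -bump (‖y - x‖ ^ 2 / s)) • innerSL ℝ (y - x)).smulRight u := fun y u =>
    ((hηf y).smul_const u).fderiv
  have hψ2 : ∀ (y : E n) (u : E m), fderiv ℝ (fun v : E m => η y • v) u =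
      η y • ContinuousLinearMap.id ℝ (E m) := fun y u =>
    ((hasFDerivAt_id u).const_smul (η y)).fderiv
  have hadm : OuterAdmissible Ω (fun y (u : E m) => η y • u) := by
    refine ⟨(hηd.comp contDiff_fst).smul contDiff_snd, ⟨Metric.closedBall x r,
      isCompact_closedBall x r, (Metric.closedBall_subset_ball hr).trans hB, fun y hy u => ?_⟩, ?_⟩
    · have : η y = 0 := image_eq_zero_of_notMem_tsupport fun h => hy (hsupp h)
      simp [this]
    · obtain ⟨C1, hC1⟩ := hηc.exists_bound_of_continuous hηd.continuous
      obtain ⟨C2, hC2⟩ := (hηc.fderiv (𝕜 := ℝ)).exists_bound_of_continuous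
        (hη1.continuous_fderiv one_ne_zero)
      have hC10 := (norm_nonneg _).trans (hC1 x)
      have hC20 := (norm_nonneg _).trans (hC2 x)
      refine ⟨C1 + C2, fun y u => ⟨?_, ?_⟩⟩
      · rw [hψ2, norm_smul]
        calc ‖η y‖ * ‖ContinuousLinearMap.id ℝ (E m)‖ ≤ C1 * 1 :=
              mul_le_mul (hC1 y) ContinuousLinearMap.norm_id_le (norm_nonneg _) hC10
          _ ≤ C1 + C2 := by linarith
      · have h2 : ‖fderiv ℝ (fun y => η y • u) y‖ ≤ C2 * ‖u‖ := by
          rw [hψ1, ← (hηf y).fderiv, ContinuousLinearMap.norm_smulRight_apply]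
          exact mul_le_mul_of_nonneg_right (hC2 y) (norm_nonneg _)
        have h3 : ‖η y • u‖ ≤ C1 * ‖u‖ := by
          rw [norm_smul]
          exact mul_le_mul_of_nonneg_right (hC1 y) (norm_nonneg _)
        nlinarith [norm_nonneg u]
  have h0 := hf.outer _ hadm
  -- D_uψ = η·id yields the energy term; D_xψ is rank one with coefficient -(2/s)·bump, since
  -- cutoff' = -bump, and yields the radial pairing.
  have hint : ∀ y, (qsum (jet f y) fun p => hs p.2 (fderiv ℝ (fun y => η y • p.1) y) +
      hs p.2 ((fderiv ℝ (fun v => η y • v) p.1).comp p.2)) =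
      cutoff (‖y - x‖ ^ 2 / s) * dirEnergy f y +
        (-(2 / s)) * (bump (‖y - x‖ ^ 2 / s) * radInner f x y) := by
    intro y
    simp only [hψ1, hψ2, hs_smulRight_inner, qsum_add, qsum_const_mul, radInner, dirEnergy,
      ContinuousLinearMap.smul_comp, ContinuousLinearMap.id_comp, hs_smul]
    simp only [hη]
    ring
  rw [outerVariation] at h0
  simp only [hint] at h0
  rw [setIntegral_eq_of_subset_of_forall_sdiff_eq_zero hΩ.measurableSet hB, integral_add
    (integrable_cutoff_mul h.integrableOn_dirEnergy x hs0)
    ((integrable_bump_mul h.integrableOn_radInner x s).const_mul _), integral_const_mul] at h0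
  · simp only [energy, radialInner]
    field_simp at h0
    linarith
  · intro y hy
    have := four_le_of_notMem_ball hR hs0 hsR hy.2
    rw [cutoff_eq_zero this, bump_eq_zero_of_ge this]
    ring

/-- The inner variation along `η(y) (y - x)`, in the form of a derivative formula. -/
lemma IsDirStationary.hasDerivAt_energy (hf : IsDirStationary Ω f) (hΩ : IsOpen Ω)
    (h : HasLocalEnergy f x R) (hR : 0 < R) (hB : Metric.ball x R ⊆ Ω) {s : ℝ} (hs0 : 0 < s)
    (hsR : 4 * s < R ^ 2) : HasDerivAt (energy f x R)
      (((n - 2) * energy f x R s + 4 / s * radialEnergy f x R s) / (2 * s)) s := by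
  obtain ⟨C, hC⟩ := exists_abs_bump_le
  have h1 := hasDerivAt_integral_radial x h.integrableOn_dirEnergy hasDerivAt_cutoff
    continuous_bump.neg (fun t ht => abs_cutoff_le ht) (fun t => (abs_neg _).trans_le (hC t))
    (fun t ht => neg_eq_zero.2 (by
      by_contra hne
      exact ht (support_bump_subset hne))) hs0
  refine h1.congr_deriv ?_
  set η : E n → ℝ := fun y => cutoff (‖y - x‖ ^ 2 / s) with hη
  have hηd : ContDiff ℝ ∞ η := contDiff_radial x contDiff_cutoff s
  obtain ⟨r, hr, hsupp⟩ := tsupport_radial_subset x (fun t ht => cutoff_eq_zero ht) hs0 hR hsR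
  have hηf : ∀ y, HasFDerivAt η ((2 / s * -bump (‖y - x‖ ^ 2 / s)) • innerSL ℝ (y - x)) y :=
    fun y => hasFDerivAt_radial x (hasDerivAt_cutoff _)
  set X : E n → E n := fun y => η y • (y - x) with hX
  have hXd : ContDiff ℝ ∞ X := hηd.smul (contDiff_id.sub contDiff_const)
  have hXt : tsupport X ⊆ Metric.closedBall x r := (tsupport_smul_subset_left _ _).trans hsupp
  have hXf : ∀ y, fderiv ℝ X y = η y • ContinuousLinearMap.id ℝ (E n) +
      ((2 / s * -bump (‖y - x‖ ^ 2 / s)) • innerSL ℝ (y - x)).smulRight (y - x) := fun y =>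
    ((hηf y).smul ((hasFDerivAt_id y).sub_const x)).fderiv
  have h0 := hf.inner X hXd (HasCompactSupport.of_support_subset_isCompact
    (isCompact_closedBall x r) ((subset_tsupport _).trans hXt))
    (hXt.trans ((Metric.closedBall_subset_ball hr).trans hB))
  have e1 : ∀ y, (qsum (jet f y) fun p => hs p.2 (p.2.comp (fderiv ℝ X y))) =
      cutoff (‖y - x‖ ^ 2 / s) * dirEnergy f y +
        (-(2 / s)) * (bump (‖y - x‖ ^ 2 / s) * radEnergy f x y) := by
    intro y
    have hcomp : ∀ L : E n →L[ℝ] E m, L.comp (fderiv ℝ X y) = η y • L +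
        ((2 / s * -bump (‖y - x‖ ^ 2 / s)) • innerSL ℝ (y - x)).smulRight (L (y - x)) := by
      intro L
      rw [hXf]
      ext1 v
      simp
    simp only [hcomp, hs_add, hs_smul, hs_smulRight_inner, qsum_add, qsum_const_mul,
      real_inner_self_eq_norm_sq, radEnergy, dirEnergy, hη]
    ring
  -- The derivative of the cutoff in the divergence is proportional to its derivative in s; this is
  -- how the s-derivative of the energy enters.
  have e2 : ∀ y, dirEnergy f y * divergence X y =
      n * (cutoff (‖y - x‖ ^ 2 / s) * dirEnergy f y) + (2 * s) *
        (-bump (‖y - x‖ ^ 2 / s) * (‖y - x‖ ^ 2 / s ^ 2) * dirEnergy f y) := by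
    intro y
    have hdiv : divergence X y = n * η y + (2 / s * -bump (‖y - x‖ ^ 2 / s)) * ‖y - x‖ ^ 2 := by
      have he : ∀ j : Fin n, (e j : E n) j = 1 := fun j => by simp [e]
      simp only [divergence, hXf, _root_.add_apply, _root_.smul_apply, PiLp.add_apply,
        PiLp.smul_apply, ContinuousLinearMap.id_apply, ContinuousLinearMap.smulRight_apply,
        innerSL_apply_apply, inner_e, smul_eq_mul, he, Finset.sum_add_distrib]
      rw [EuclideanSpace.real_norm_sq_eq, Finset.mul_sum]
      simp only [mul_one, Finset.sum_const, Finset.card_univ, Fintype.card_fin, nsmul_eq_mul]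
      congr 1
      refine Finset.sum_congr rfl fun j _ => ?_
      ring
    rw [hdiv]
    simp only [hη]
    field_simp
  rw [innerVariation] at h0
  have i1 := integrable_cutoff_mul h.integrableOn_dirEnergy x hs0
  have i2 := integrable_bump_mul h.integrableOn_radEnergy x s
  have i3 : IntegrableOn (fun y => -bump (‖y - x‖ ^ 2 / s) * (‖y - x‖ ^ 2 / s ^ 2) * dirEnergy f y)
      (Metric.ball x R) := by
    have hc : Continuous fun y => -bump (‖y - x‖ ^ 2 / s) * (‖y - x‖ ^ 2 / s ^ 2) :=
      (continuous_bump.comp (by fun_prop)).neg.mul (by fun_prop)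
    refine Integrable.bdd_mul (c := C * (R ^ 2 / s ^ 2)) h.integrableOn_dirEnergy
      hc.aestronglyMeasurable ?_
    filter_upwards [ae_restrict_mem measurableSet_ball] with y hy
    rw [Metric.mem_ball, dist_eq_norm] at hy
    rw [norm_mul, norm_neg]
    refine mul_le_mul (hC _) ?_ (norm_nonneg _) ((abs_nonneg _).trans (hC 0))
    rw [Real.norm_of_nonneg (by positivity)]
    gcongr
  have e2' : ∀ y, (qsum (jet f y) fun p => hs p.2 p.2) * divergence X y =
      n * (cutoff (‖y - x‖ ^ 2 / s) * dirEnergy f y) + (2 * s) *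
        (-bump (‖y - x‖ ^ 2 / s) * (‖y - x‖ ^ 2 / s ^ 2) * dirEnergy f y) := e2
  simp only [e1, e2'] at h0
  rw [setIntegral_eq_of_subset_of_forall_sdiff_eq_zero hΩ.measurableSet hB,
    setIntegral_eq_of_subset_of_forall_sdiff_eq_zero hΩ.measurableSet hB,
    integral_add i1 (i2.const_mul _), integral_add (i1.const_mul _) (i3.const_mul _),
    integral_const_mul, integral_const_mul, integral_const_mul] at h0
  · rw [eq_div_iff (by positivity)]
    have e3 : ∫ y in Metric.ball x R, -bump (‖y - x‖ ^ 2 / s) * (-(‖y - x‖ ^ 2 / s ^ 2)) *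
        dirEnergy f y = - ∫ y in Metric.ball x R, -bump (‖y - x‖ ^ 2 / s) *
          (‖y - x‖ ^ 2 / s ^ 2) * dirEnergy f y := by
      rw [← integral_neg]
      congr 1
      ext1 y
      ring
    rw [e3]
    simp only [energy, radialEnergy]
    field_simp at h0 ⊢
    linarith
  · intro y hy
    have := four_le_of_notMem_ball hR hs0 hsR hy.2
    rw [cutoff_eq_zero this, bump_eq_zero_of_ge this]
    ring
  · intro y hy
    have := four_le_of_notMem_ball hR hs0 hsR hy.2
    rw [cutoff_eq_zero this, bump_eq_zero_of_ge this]
    ring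

end Identities

/-! ### Monotone frequency and asymptotic slopes -/

/-- The frequency `D / H` of a pair with `2 H' = D` and `D ^ 2 ≤ 2 H D'` is monotone. -/
lemma frequency_mul_le {H D ε : ℝ → ℝ} {T : ℝ}
    (hH : ∀ τ < T, HasDerivAt H (D τ / 2) τ) (hD : ∀ τ < T, HasDerivAt D (2 * ε τ) τ)
    (hcs : ∀ τ < T, (D τ / 2) ^ 2 ≤ H τ * ε τ) (hH0 : ∀ τ < T, 0 ≤ H τ)
    (hε : ∀ τ < T, 0 ≤ ε τ) {τ t : ℝ} (hτ : τ ≤ t) (ht : t < T) :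
    D τ * H t ≤ D t * H τ := by
  -- `H` may vanish, so it is replaced by H + δ. The numerator of the derivative is then at least
  -- 2εδ, and δ → 0 gives the division-free inequality.
  have key : ∀ δ : ℝ, 0 < δ → D τ * (H t + δ) ≤ D t * (H τ + δ) := by
    intro δ hδ
    have hpos : ∀ σ < T, 0 < H σ + δ := fun σ hσ => by linarith [hH0 σ hσ]
    have hder : ∀ σ < T, HasDerivAt (fun σ => D σ / (H σ + δ))
        ((2 * ε σ * (H σ + δ) - D σ * (D σ / 2)) / (H σ + δ) ^ 2) σ := fun σ hσ =>
      (hD σ hσ).div ((hH σ hσ).add_const δ) (hpos σ hσ).ne'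
    have hmono : MonotoneOn (fun σ => D σ / (H σ + δ)) (Set.Iio T) := by
      refine monotoneOn_of_deriv_nonneg (convex_Iio T)
        (fun σ hσ => (hder σ hσ).continuousAt.continuousWithinAt)
        (fun σ hσ => (hder σ (Set.mem_Iio.1 (interior_subset hσ))).differentiableAt.differentiableWithinAt)
        fun σ hσ => ?_
      have hσ := Set.mem_Iio.1 (interior_subset hσ)
      rw [(hder σ hσ).deriv]
      refine div_nonneg ?_ (sq_nonneg _)
      nlinarith [hcs σ hσ, mul_nonneg (hε σ hσ) hδ.le]
    have := hmono (hτ.trans_lt ht) ht hτ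
    rwa [div_le_div_iff₀ (hpos τ (hτ.trans_lt ht)) (hpos t ht)] at this
  have h1 : ∀ a b c : ℝ, Tendsto (fun δ : ℝ => a * (b + δ)) (𝓝[>] c) (𝓝 (a * (b + c))) :=
    fun a b c => ((by fun_prop : Continuous fun δ : ℝ => a * (b + δ)).tendsto c).mono_left
      nhdsWithin_le_nhds
  simpa using le_of_tendsto_of_tendsto (h1 (D τ) (H t) 0) (h1 (D t) (H τ) 0)
    (eventually_nhdsWithin_of_forall fun δ hδ => key δ hδ)

/-- If the frequency is monotone then the height cannot reach zero backwards in time. -/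
lemma height_pos_of_frequency {H D : ℝ → ℝ} {T : ℝ} (hH : ∀ τ < T, HasDerivAt H (D τ / 2) τ)
    (hN : ∀ τ t, τ ≤ t → t < T → D τ * H t ≤ D t * H τ) {τ t : ℝ} (hτ : τ ≤ t) (ht : t < T)
    (hpos : 0 < H t) : 0 < H τ := by
  -- Half of the frequency at `t`. Monotonicity gives H' ≤ cH to the left of `t`, so H·e^{-cσ} is
  -- antitone and stays above its value at `t`.
  set c := D t / H t / 2 with hc
  have hder : ∀ σ < T, HasDerivAt (fun σ => H σ * Real.exp (-c * σ))
      (D σ / 2 * Real.exp (-c * σ) + H σ * (Real.exp (-c * σ) * (-c * 1))) σ := fun σ hσ =>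
    (hH σ hσ).mul ((hasDerivAt_id σ).const_mul (-c)).exp
  have hanti : AntitoneOn (fun σ => H σ * Real.exp (-c * σ)) (Set.Iic t) := by
    refine antitoneOn_of_deriv_nonpos (convex_Iic t)
      (fun σ hσ => (hder σ (lt_of_le_of_lt hσ ht)).continuousAt.continuousWithinAt)
      (fun σ hσ => (hder σ (lt_of_le_of_lt (Set.mem_Iic.1 (interior_subset hσ))
        ht)).differentiableAt.differentiableWithinAt)
      fun σ hσ => ?_
    have hσ : σ ≤ t := Set.mem_Iic.1 (interior_subset hσ)
    rw [(hder σ (hσ.trans_lt ht)).deriv]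
    have h1 : D σ ≤ 2 * c * H σ := by
      rw [hc, mul_div_cancel₀ _ two_ne_zero, div_mul_eq_mul_div, le_div_iff₀ hpos]
      exact hN σ t hσ ht
    nlinarith [Real.exp_pos (-c * σ)]
  have h1 := hanti (Set.mem_Iic.2 hτ) (Set.mem_Iic.2 le_rfl) hτ
  have h2 : 0 < H t * Real.exp (-c * t) := mul_pos hpos (Real.exp_pos _)
  exact pos_of_mul_pos_left (h2.trans_le h1) (Real.exp_pos _).le

/-- A convex and monotone function has an asymptotic slope at `-∞`. -/
lemma exists_tendsto_div_atBot_of_convexOn {F : ℝ → ℝ} {T : ℝ} (hF : ConvexOn ℝ (Set.Iio T) F)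
    (hmono : MonotoneOn F (Set.Iio T)) : ∃ κ, Tendsto (fun τ => F τ / τ) atBot (𝓝 κ) := by
  set a := T - 1 with ha
  have haT : a ∈ Set.Iio T := by simp [ha]
  -- Secant slopes from the base point `a`: monotone by convexity and nonnegative because `F` is
  -- monotone. The minimum with a - 1 avoids the base point and defines them on all of ℝ.
  set φ : ℝ → ℝ := fun σ => (F (min σ (a - 1)) - F a) / (min σ (a - 1) - a) with hφ
  have hlt : ∀ σ, min σ (a - 1) < a := fun σ => (min_le_right _ _).trans_lt (by linarith)
  have hmem : ∀ σ, min σ (a - 1) ∈ Set.Iio T := fun σ => (hlt σ).trans haT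
  have hφm : Monotone φ := fun σ σ' hσ => hF.secant_mono haT (hmem σ) (hmem σ') (hlt σ).ne
    (hlt σ').ne (min_le_min_right _ hσ)
  have hbdd : BddBelow (Set.range φ) := by
    refine ⟨0, ?_⟩
    rintro _ ⟨σ, rfl⟩
    exact div_nonneg_of_nonpos (sub_nonpos.2 (hmono (hmem σ) haT (hlt σ).le))
      (sub_nonpos.2 (hlt σ).le)
  have h1 := tendsto_atBot_ciInf hφm hbdd
  refine ⟨⨅ i, φ i, ?_⟩
  have hinv : Tendsto (fun τ : ℝ => τ⁻¹) atBot (𝓝 0) := tendsto_inv_atBot_zero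
  have h2 : Tendsto (fun τ => φ τ * (1 - a * τ⁻¹) + F a * τ⁻¹) atBot
      (𝓝 ((⨅ i, φ i) * (1 - a * 0) + F a * 0)) :=
    (h1.mul (tendsto_const_nhds.sub (hinv.const_mul a))).add (hinv.const_mul (F a))
  simp only [mul_zero, sub_zero, mul_one, add_zero] at h2
  refine h2.congr' ?_
  filter_upwards [eventually_le_atBot (a - 1), eventually_lt_atBot 0] with τ hτ hτ0
  have h3 : τ - a ≠ 0 := by linarith
  have h4 := hτ0.ne
  simp only [hφ, min_eq_left hτ]
  field_simp
  ring

/-! ### Logarithmic scale and the growth exponent -/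

section Frequency

variable {n m Q : ℕ} {Ω : Set (E n)} {f : E n → AQ m Q} {x : E n} {R : ℝ}

lemma radialEnergy_nonneg (s : ℝ) : 0 ≤ radialEnergy f x R s :=
  integral_nonneg fun _ => mul_nonneg (bump_nonneg _) (radEnergy_nonneg _ _ _)

/-- The scale invariant height in logarithmic scale. -/
def logHeight (f : E n → AQ m Q) (x : E n) (R τ : ℝ) : ℝ :=
  Real.exp (-(n / 2) * τ) * height f x R (Real.exp τ)

/-- The scale invariant energy in logarithmic scale. -/
def logEnergy (f : E n → AQ m Q) (x : E n) (R τ : ℝ) : ℝ :=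
  Real.exp (-(n / 2) * τ) * (Real.exp τ * energy f x R (Real.exp τ))

lemma logHeight_nonneg (τ : ℝ) : 0 ≤ logHeight f x R τ :=
  mul_nonneg (Real.exp_pos _).le (height_nonneg _)

lemma logEnergy_nonneg (τ : ℝ) : 0 ≤ logEnergy f x R τ :=
  mul_nonneg (Real.exp_pos _).le (mul_nonneg (Real.exp_pos _).le (energy_nonneg _))

lemma height_eq_logHeight {s : ℝ} (hs : 0 < s) :
    height f x R s = Real.exp (n / 2 * Real.log s) * logHeight f x R (Real.log s) := by
  rw [logHeight, Real.exp_log hs, ← mul_assoc, ← Real.exp_add]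
  simp

namespace IsDirStationary

/-- The factor e^{-nτ/2} cancels the term with n in the height derivative, and the outer variation
turns the remaining radial pairing into energy. -/
lemma hasDerivAt_logHeight (hf : IsDirStationary Ω f) (hΩ : IsOpen Ω) (h : HasLocalEnergy f x R)
    (hR : 0 < R) (hB : Metric.ball x R ⊆ Ω) {τ : ℝ} (hτ : 4 * Real.exp τ < R ^ 2) :
    HasDerivAt (logHeight f x R) (logEnergy f x R τ / 2) τ := by
  have h0 := Real.exp_pos τ
  have h1 := (((hasDerivAt_id τ).const_mul (-(n / 2 : ℝ))).exp).mul
    ((h.hasDerivAt_height hR h0 hτ).comp τ (Real.hasDerivAt_exp τ))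
  refine h1.congr_deriv ?_
  have h2 := hf.outer_identity hΩ h hR hB h0 hτ
  rw [logEnergy, h2]
  simp only [Function.comp, id]
  field_simp
  ring

/-- The factors e^{-nτ/2} and e^τ together cancel the coefficient n - 2, leaving only the radial
energy. -/
lemma hasDerivAt_logEnergy (hf : IsDirStationary Ω f) (hΩ : IsOpen Ω) (h : HasLocalEnergy f x R)
    (hR : 0 < R) (hB : Metric.ball x R ⊆ Ω) {τ : ℝ} (hτ : 4 * Real.exp τ < R ^ 2) :
    HasDerivAt (logEnergy f x R)
      (2 * (Real.exp (-(n / 2) * τ) * radialEnergy f x R (Real.exp τ))) τ := by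
  have h0 := Real.exp_pos τ
  have h1 := (((hasDerivAt_id τ).const_mul (-(n / 2 : ℝ))).exp).mul ((Real.hasDerivAt_exp τ).mul
    ((hf.hasDerivAt_energy hΩ h hR hB h0 hτ).comp τ (Real.hasDerivAt_exp τ)))
  refine h1.congr_deriv ?_
  simp only [Function.comp, id, Pi.mul_apply]
  field_simp
  ring

/-- By the outer variation half of the energy is the radial pairing, to which the Cauchy-Schwarz
inequality applies. -/
lemma logEnergy_sq_le (hf : IsDirStationary Ω f) (hΩ : IsOpen Ω) (h : HasLocalEnergy f x R)
    (hR : 0 < R) (hB : Metric.ball x R ⊆ Ω) {τ : ℝ} (hτ : 4 * Real.exp τ < R ^ 2) :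
    (logEnergy f x R τ / 2) ^ 2 ≤
      logHeight f x R τ * (Real.exp (-(n / 2) * τ) * radialEnergy f x R (Real.exp τ)) := by
  have h0 := Real.exp_pos τ
  have h1 := mul_le_mul_of_nonneg_left (h.radialInner_sq_le (Real.exp τ))
    (sq_nonneg (Real.exp (-(n / 2) * τ)))
  rw [logEnergy, hf.outer_identity hΩ h hR hB h0 hτ, logHeight]
  linarith

lemma logEnergy_mul_le (hf : IsDirStationary Ω f) (hΩ : IsOpen Ω) (h : HasLocalEnergy f x R)
    (hR : 0 < R) (hB : Metric.ball x R ⊆ Ω) {τ t : ℝ} (hτ : τ ≤ t)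
    (ht : t < Real.log (R ^ 2 / 4)) :
    logEnergy f x R τ * logHeight f x R t ≤ logEnergy f x R t * logHeight f x R τ := by
  have hT : ∀ σ < Real.log (R ^ 2 / 4), 4 * Real.exp σ < R ^ 2 := fun σ hσ => by
    rw [Real.lt_log_iff_exp_lt (by positivity)] at hσ
    linarith
  exact frequency_mul_le (fun σ hσ => hf.hasDerivAt_logHeight hΩ h hR hB (hT σ hσ))
    (fun σ hσ => hf.hasDerivAt_logEnergy hΩ h hR hB (hT σ hσ))
    (fun σ hσ => hf.logEnergy_sq_le hΩ h hR hB (hT σ hσ)) (fun σ _ => logHeight_nonneg σ)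
    (fun σ _ => mul_nonneg (Real.exp_pos _).le (radialEnergy_nonneg _)) hτ ht

lemma monotoneOn_logHeight (hf : IsDirStationary Ω f) (hΩ : IsOpen Ω) (h : HasLocalEnergy f x R)
    (hR : 0 < R) (hB : Metric.ball x R ⊆ Ω) :
    MonotoneOn (logHeight f x R) (Set.Iio (Real.log (R ^ 2 / 4))) := by
  have hder : ∀ σ < Real.log (R ^ 2 / 4),
      HasDerivAt (logHeight f x R) (logEnergy f x R σ / 2) σ := fun σ hσ => by
    rw [Real.lt_log_iff_exp_lt (by positivity)] at hσ
    exact hf.hasDerivAt_logHeight hΩ h hR hB (by linarith)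
  refine monotoneOn_of_deriv_nonneg (convex_Iio _)
    (fun σ hσ => (hder σ hσ).continuousAt.continuousWithinAt)
    (fun σ hσ => (hder σ (Set.mem_Iio.1 (interior_subset hσ))).differentiableAt.differentiableWithinAt)
    fun σ hσ => ?_
  rw [(hder σ (Set.mem_Iio.1 (interior_subset hσ))).deriv]
  exact div_nonneg (logEnergy_nonneg σ) zero_le_two

/-- The height is monotone in the scale. -/
lemma height_mono (hf : IsDirStationary Ω f) (hΩ : IsOpen Ω) (h : HasLocalEnergy f x R)
    (hR : 0 < R) (hB : Metric.ball x R ⊆ Ω) {s t : ℝ} (hs : 0 < s) (hst : s ≤ t)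
    (ht : 4 * t < R ^ 2) : height f x R s ≤ height f x R t := by
  have ht0 := hs.trans_le hst
  have hlog := Real.log_le_log hs hst
  have h1 : Real.log t < Real.log (R ^ 2 / 4) := Real.log_lt_log ht0 (by linarith)
  rw [height_eq_logHeight hs, height_eq_logHeight ht0]
  exact mul_le_mul (Real.exp_le_exp.2 (by gcongr))
    (hf.monotoneOn_logHeight hΩ h hR hB (hlog.trans_lt h1) h1 hlog) (logHeight_nonneg _)
    (Real.exp_pos _).le

/-- If the height is positive at some scale then it is positive at all smaller scales. -/
lemma height_pos (hf : IsDirStationary Ω f) (hΩ : IsOpen Ω) (h : HasLocalEnergy f x R)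
    (hR : 0 < R) (hB : Metric.ball x R ⊆ Ω) {s t : ℝ} (hs : 0 < s) (hst : s ≤ t)
    (ht : 4 * t < R ^ 2) (hpos : 0 < height f x R t) : 0 < height f x R s := by
  have ht0 := hs.trans_le hst
  have hlog := Real.log_le_log hs hst
  have h1 : Real.log t < Real.log (R ^ 2 / 4) := Real.log_lt_log ht0 (by linarith)
  rw [height_eq_logHeight ht0] at hpos
  rw [height_eq_logHeight hs]
  refine mul_pos (Real.exp_pos _) (height_pos_of_frequency (D := logEnergy f x R)
    (T := Real.log (R ^ 2 / 4)) (fun σ hσ => ?_)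
    (fun σ σ' h2 h3 => hf.logEnergy_mul_le hΩ h hR hB h2 h3) hlog h1
    (pos_of_mul_pos_right hpos (Real.exp_pos _).le))
  rw [Real.lt_log_iff_exp_lt (by positivity)] at hσ
  exact hf.hasDerivAt_logHeight hΩ h hR hB (by linarith)

/-- The growth exponent of the height. -/
lemma exists_tendsto_log_height (hf : IsDirStationary Ω f) (hΩ : IsOpen Ω)
    (h : HasLocalEnergy f x R) (hR : 0 < R) (hB : Metric.ball x R ⊆ Ω)
    (hpos : ∀ s, 0 < s → 4 * s < R ^ 2 → 0 < height f x R s) :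
    ∃ κ, Tendsto (fun s => Real.log (height f x R s) / Real.log s) (𝓝[>] 0) (𝓝 κ) := by
  set T := Real.log (R ^ 2 / 4) with hT
  have hlt : ∀ σ < T, 4 * Real.exp σ < R ^ 2 := fun σ hσ => by
    rw [hT, Real.lt_log_iff_exp_lt (by positivity)] at hσ
    linarith
  have hH : ∀ σ < T, 0 < logHeight f x R σ := fun σ hσ =>
    mul_pos (Real.exp_pos _) (hpos _ (Real.exp_pos _) (hlt σ hσ))
  have hder : ∀ σ < T, HasDerivAt (fun σ => Real.log (logHeight f x R σ))
      (logEnergy f x R σ / 2 / logHeight f x R σ) σ := fun σ hσ =>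
    (hf.hasDerivAt_logHeight hΩ h hR hB (hlt σ hσ)).log (hH σ hσ).ne'
  -- The derivative of the logarithm of the height is half of the frequency.
  have hconv : ConvexOn ℝ (Set.Iio T) fun σ => Real.log (logHeight f x R σ) := by
    refine MonotoneOn.convexOn_of_deriv (convex_Iio T)
      (fun σ hσ => (hder σ hσ).continuousAt.continuousWithinAt)
      (fun σ hσ => (hder σ (Set.mem_Iio.1 (interior_subset hσ))).differentiableAt.differentiableWithinAt)
      fun σ hσ σ' hσ' hle => ?_
    have hσ := Set.mem_Iio.1 (interior_subset hσ)
    have hσ' := Set.mem_Iio.1 (interior_subset hσ')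
    rw [(hder σ hσ).deriv, (hder σ' hσ').deriv, div_le_div_iff₀ (hH σ hσ) (hH σ' hσ')]
    have := hf.logEnergy_mul_le hΩ h hR hB hle hσ'
    linarith
  have hmono : MonotoneOn (fun σ => Real.log (logHeight f x R σ)) (Set.Iio T) :=
    fun σ hσ σ' hσ' hle => Real.log_le_log (hH σ hσ)
      (hf.monotoneOn_logHeight hΩ h hR hB hσ hσ' hle)
  obtain ⟨κ, hκ⟩ := exists_tendsto_div_atBot_of_convexOn hconv hmono
  -- The summand n/2 restores the factor s^{n/2} removed in the scale invariant height.
  refine ⟨n / 2 + κ, ((hκ.comp Real.tendsto_log_nhdsGT_zero).const_add (n / 2 : ℝ)).congr' ?_⟩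
  have hev : ∀ᶠ s : ℝ in 𝓝[>] 0, s < min 1 (R ^ 2 / 4) :=
    (eventually_lt_nhds (by positivity)).filter_mono nhdsWithin_le_nhds
  filter_upwards [hev, self_mem_nhdsWithin] with s hs hs0
  have hs0 : 0 < s := hs0
  have hne : Real.log s ≠ 0 := (Real.log_neg hs0 (hs.trans_le (min_le_left _ _))).ne
  have hsT : Real.log s < T := Real.log_lt_log hs0 (hs.trans_le (min_le_right _ _))
  rw [height_eq_logHeight hs0, Real.log_mul (Real.exp_pos _).ne' (hH _ hsT).ne', Real.log_exp]
  simp only [Function.comp]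
  field_simp

end IsDirStationary

end Frequency

/-! ### Unique continuation -/

section UniqueContinuation

variable {n m Q : ℕ} {Ω : Set (E n)} {f : E n → AQ m Q} {x : E n} {R : ℝ}

/-- If the height vanishes at all scales then `f` vanishes. -/
lemma HasLocalEnergy.ae_eq_qzero (h : HasLocalEnergy f x R) (hn : 1 ≤ n)
    (hz : ∀ s, 0 < s → 4 * s < R ^ 2 → height f x R s = 0) :
    ∀ᵐ y, y ∈ Metric.ball x R → f y = qzero m Q := by
  have : Nonempty (Fin n) := ⟨⟨0, hn⟩⟩
  have h1 : ∀ q : ℚ, ∀ᵐ y, y ∈ Metric.ball x R → (0 : ℝ) < q → 4 * (q : ℝ) < R ^ 2 →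
      bump (‖y - x‖ ^ 2 / q) * qnorm (f y) ^ 2 = 0 := by
    intro q
    by_cases hq : (0 : ℝ) < q ∧ 4 * (q : ℝ) < R ^ 2
    · have h2 := (setIntegral_eq_zero_iff_of_nonneg_ae (.of_forall fun y =>
        mul_nonneg (bump_nonneg _) (sq_nonneg _)) (integrable_bump_mul h.integrableOn_qnorm_sq x
          q)).1 (hz q hq.1 hq.2)
      rw [EventuallyEq, ae_restrict_iff' measurableSet_ball] at h2
      filter_upwards [h2] with y hy hyB _ _
      exact hy hyB
    · exact .of_forall fun y _ h3 h4 => absurd ⟨h3, h4⟩ hq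
  filter_upwards [ae_all_iff.2 h1, Measure.ae_ne volume x] with y hy hne hyB
  have hpos : 0 < ‖y - x‖ ^ 2 := pow_pos (norm_pos_iff.2 (sub_ne_zero.2 hne)) 2
  have hlt : ‖y - x‖ ^ 2 < R ^ 2 := by
    rw [Metric.mem_ball, dist_eq_norm] at hyB
    gcongr
  -- A rational scale q with 1 < |y-x|²/q < 4, so the weight is positive at y; countably many scales
  -- keep the exceptional set null.
  obtain ⟨q, hq1, hq2⟩ := exists_rat_btwn (show ‖y - x‖ ^ 2 / 4 < min (‖y - x‖ ^ 2) (R ^ 2 / 4) from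
    lt_min (by linarith) (by linarith))
  have hq0 : (0 : ℝ) < q := lt_trans (by positivity) hq1
  have h2 := hq2.trans_le (min_le_left _ _)
  have h3 := hq2.trans_le (min_le_right _ _)
  have h4 := hy q hyB hq0 (by linarith)
  have h5 : 0 < bump (‖y - x‖ ^ 2 / q) := bump_pos (by rwa [one_lt_div hq0])
    (by rw [div_lt_iff₀ hq0]; linarith)
  exact (qnorm_eq_zero_iff _).1 (pow_eq_zero_iff two_ne_zero |>.1
    ((mul_eq_zero.1 h4).resolve_left h5.ne'))

/-- If the height vanishes at one scale then `f` vanishes. -/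
lemma IsDirStationary.ae_eq_qzero_of_height_eq_zero (hf : IsDirStationary Ω f) (hΩ : IsOpen Ω)
    (hn : 1 ≤ n) (h : HasLocalEnergy f x R) (hR : 0 < R) (hB : Metric.ball x R ⊆ Ω) {s : ℝ}
    (hs : 0 < s) (hsR : 4 * s < R ^ 2) (hz : height f x R s = 0) :
    ∀ᵐ y, y ∈ Metric.ball x R → f y = qzero m Q := by
  refine h.ae_eq_qzero hn fun t ht htR => ?_
  -- Smaller scales follow from monotonicity of the height, larger ones from the backward
  -- propagation of positivity.
  rcases le_total t s with hts | hst
  · exact le_antisymm ((hf.height_mono hΩ h hR hB ht hts hsR).trans_eq hz) (height_nonneg _)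
  · by_contra hne
    exact (hf.height_pos hΩ h hR hB hs hst htR ((height_nonneg _).lt_of_ne' hne)).ne' hz

/-- The height vanishes at small scales around points near which `f` vanishes. -/
lemma height_eq_zero_of_ae_eq_qzero {r : ℝ} (hr : 0 < r)
    (hz : ∀ᵐ y, y ∈ Metric.ball x r → f y = qzero m Q) {s : ℝ} (hs : 0 < s) (hsr : 4 * s < r ^ 2) :
    height f x R s = 0 := by
  refine (integral_congr_ae (ae_restrict_of_ae ?_)).trans (integral_zero _ _)
  filter_upwards [hz] with y hy
  by_cases hyr : y ∈ Metric.ball x r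
  · rw [hy hyr, (qnorm_eq_zero_iff _).2 rfl]
    simp
  · rw [bump_eq_zero_of_ge (four_le_of_notMem_ball hr hs hsr hyr), zero_mul]

/-- Unique continuation for Dir-stationary maps. -/
theorem IsDirStationary.ae_eq_qzero_of_locally (hf : IsDirStationary Ω f) (hΩ : IsOpen Ω)
    (hn : 1 ≤ n) (hconn : IsPreconnected Ω) (hx : x ∈ Ω) {r : ℝ} (hr : 0 < r)
    (hz : ∀ᵐ y, y ∈ Metric.ball x r → f y = qzero m Q) :
    ∀ᵐ y ∂volume.restrict Ω, f y = qzero m Q := by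
  set Z : Set (E n) := {z | ∃ r, 0 < r ∧ ∀ᵐ y, y ∈ Metric.ball z r → f y = qzero m Q} with hZ
  have hmem : ∀ z r, (∀ᵐ y, y ∈ Metric.ball z r → f y = qzero m Q) → Metric.ball z r ⊆ Z := by
    intro z r h w hw
    refine ⟨r - dist w z, sub_pos.2 hw, ?_⟩
    filter_upwards [h] with y hy hyw
    exact hy (Metric.ball_subset (sub_sub_cancel r _).ge hyw)
  have hZo : IsOpen Z := by
    refine Metric.isOpen_iff.2 ?_
    rintro z ⟨r, hr, h⟩
    exact ⟨r, hr, hmem z r h⟩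
  have hsub : Ω ⊆ Z := by
    refine hconn.subset_of_closure_inter_subset hZo ⟨x, hx, r, hr, hz⟩ ?_
    rintro z ⟨hzc, hzΩ⟩
    obtain ⟨ρ, hρ, hρΩ⟩ := Metric.isOpen_iff.1 hΩ z hzΩ
    obtain ⟨w, ⟨r', hr', hw⟩, hzw⟩ := Metric.mem_closure_iff.1 hzc (ρ / 4) (by positivity)
    -- A point w of `Z` within ρ/4 of z has a ball of radius ρ/4 that contains z, and its triple
    -- lies in Ω. Vanishing near w extends to that whole ball, which shows that `Z` is relatively
    -- closed in Ω.
    have hB3 : Metric.ball w (3 * (ρ / 4)) ⊆ Ω := by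
      refine (Metric.ball_subset ?_).trans hρΩ
      rw [dist_comm]
      linarith
    have hB : Metric.ball w (ρ / 4) ⊆ Ω :=
      (Metric.ball_subset_ball (by linarith)).trans hB3
    have hloc := hf.memW12.hasLocalEnergy (by positivity : 0 < ρ / 4) hB3
    set s := min (r' ^ 2) ((ρ / 4) ^ 2) / 8 with hs
    have hmin : 0 < min (r' ^ 2) ((ρ / 4) ^ 2) := by positivity
    have h1 := min_le_left (r' ^ 2) ((ρ / 4) ^ 2)
    have h2 := min_le_right (r' ^ 2) ((ρ / 4) ^ 2)
    have h3 : height f w (ρ / 4) s = 0 :=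
      height_eq_zero_of_ae_eq_qzero hr' hw (by positivity) (by linarith)
    exact hmem w _ (hf.ae_eq_qzero_of_height_eq_zero hΩ hn hloc (by positivity) hB
      (by positivity) (by linarith) h3) hzw
  rw [ae_restrict_iff' hΩ.measurableSet, ae_iff]
  refine measure_null_of_locally_null _ fun z hz => ?_
  have hz : ¬ (z ∈ Ω → f z = qzero m Q) := hz
  push Not at hz
  obtain ⟨r', hr', hw⟩ := hsub hz.1
  refine ⟨_, inter_mem_nhdsWithin _ (Metric.ball_mem_nhds z hr'), measure_mono_null ?_ hw⟩
  rintro y ⟨hy1, hy2⟩ hy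
  exact hy1 fun _ => hy hy2

/-- The height of a nontrivial Dir-stationary map is positive. -/
lemma IsDirStationary.height_pos_of_isNontrivial (hf : IsDirStationary Ω f) (hΩ : IsOpen Ω)
    (hn : 1 ≤ n) (hconn : IsPreconnected Ω) (hnt : IsNontrivial Ω f) (hx : x ∈ Ω)
    (h : HasLocalEnergy f x R) (hR : 0 < R) (hB : Metric.ball x R ⊆ Ω) {s : ℝ}
    (hs : 0 < s) (hsR : 4 * s < R ^ 2) : 0 < height f x R s := by
  refine (height_nonneg _).lt_of_ne' fun hz => hnt ?_
  exact hf.ae_eq_qzero_of_locally hΩ hn hconn hx hR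
    (hf.ae_eq_qzero_of_height_eq_zero hΩ hn h hR hB hs hsR hz)

end UniqueContinuation

/-! ### Comparison with averages over annuli -/

section Annulus

variable {n m Q : ℕ} {Ω : Set (E n)} {f : E n → AQ m Q} {x : E n} {R : ℝ}

/-- The annulus `B_{2r} \ B_r (x)`. -/
def annulus (x : E n) (r : ℝ) : Set (E n) := Metric.ball x (2 * r) \ Metric.ball x r

lemma measurableSet_annulus (x : E n) (r : ℝ) : MeasurableSet (annulus x r) :=
  measurableSet_ball.diff measurableSet_ball

/-- The integral of `|f|²` over an annulus. -/
def annulusHeight (f : E n → AQ m Q) (x : E n) (r : ℝ) : ℝ := ∫ y in annulus x r, qnorm (f y) ^ 2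

lemma mem_annulus_iff {r : ℝ} (hr : 0 < r) {y : E n} :
    y ∈ annulus x r ↔ 1 ≤ ‖y - x‖ ^ 2 / r ^ 2 ∧ ‖y - x‖ ^ 2 / r ^ 2 < 4 := by
  rw [annulus, Set.mem_sdiff, Metric.mem_ball, Metric.mem_ball, dist_eq_norm, not_lt,
    le_div_iff₀ (by positivity), div_lt_iff₀ (by positivity), one_mul,
    show 4 * r ^ 2 = (2 * r) ^ 2 by ring, sq_lt_sq₀ (norm_nonneg _) (by positivity),
    sq_le_sq₀ hr.le (norm_nonneg _), and_comm]

lemma annulus_subset_ball {r : ℝ} (hrR : 2 * r ≤ R) : annulus x r ⊆ Metric.ball x R :=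
  Set.sdiff_subset.trans (Metric.ball_subset_ball hrR)

/-- The weight vanishes at 1 and 4, so one scale cannot control the annulus. The two terms are
positive on (1/2, 2) and (4/3, 16/3), which cover [1, 4]. -/
lemma exists_pos_le_bump_add_bump :
    ∃ c > 0, ∀ t ∈ Set.Icc (1 : ℝ) 4, c ≤ bump (2 * t) + bump (3 / 4 * t) := by
  have hc : Continuous fun t => bump (2 * t) + bump (3 / 4 * t) :=
    (continuous_bump.comp (by fun_prop)).add (continuous_bump.comp (by fun_prop))
  obtain ⟨t, ht, hmin⟩ := isCompact_Icc.exists_isMinOn (Set.nonempty_Icc.2 (by norm_num :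
    (1 : ℝ) ≤ 4)) hc.continuousOn
  refine ⟨bump (2 * t) + bump (3 / 4 * t), ?_, fun u hu => hmin hu⟩
  rcases lt_or_ge t 2 with h | h
  · exact add_pos_of_pos_of_nonneg (bump_pos (by linarith [ht.1]) (by linarith)) (bump_nonneg _)
  · exact add_pos_of_nonneg_of_pos (bump_nonneg _) (bump_pos (by linarith) (by linarith [ht.2]))

/-- The height is controlled by the integral over the annulus. -/
lemma HasLocalEnergy.exists_height_le (h : HasLocalEnergy f x R) :
    ∃ C > 0, ∀ r, 0 < r → 2 * r ≤ R → height f x R (r ^ 2) ≤ C * annulusHeight f x r := by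
  obtain ⟨C, hC⟩ := exists_abs_bump_le
  refine ⟨|C| + 1, by positivity, fun r hr hrR => ?_⟩
  have hsub := annulus_subset_ball (x := x) hrR
  rw [height, annulusHeight, ← integral_const_mul,
    setIntegral_eq_of_subset_of_forall_sdiff_eq_zero measurableSet_ball hsub]
  · refine integral_mono ((integrable_bump_mul h.integrableOn_qnorm_sq x _).mono_set hsub)
      ((h.integrableOn_qnorm_sq.mono_set hsub).const_mul _) fun y => ?_
    exact mul_le_mul_of_nonneg_right ((le_abs_self _).trans ((hC _).trans
      ((le_abs_self C).trans (by linarith)))) (sq_nonneg _)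
  · rintro y ⟨-, hy⟩
    rw [mem_annulus_iff hr, not_and_or, not_le, not_lt] at hy
    rcases hy with hy | hy
    · rw [bump_eq_zero_of_le hy.le, zero_mul]
    · rw [bump_eq_zero_of_ge hy, zero_mul]

/-- The integral over the annulus is controlled by the height at a larger scale. -/
lemma IsDirStationary.exists_annulusHeight_le (hf : IsDirStationary Ω f) (hΩ : IsOpen Ω)
    (h : HasLocalEnergy f x R) (hR : 0 < R) (hB : Metric.ball x R ⊆ Ω) :
    ∃ C > 0, ∀ r, 0 < r → 4 * r ≤ R →
      annulusHeight f x r ≤ C * height f x R (4 / 3 * r ^ 2) := by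
  obtain ⟨c, hc, hcb⟩ := exists_pos_le_bump_add_bump
  refine ⟨2 / c, by positivity, fun r hr hrR => ?_⟩
  have hsub := annulus_subset_ball (x := x) (show 2 * r ≤ R by linarith)
  have hr2 : 0 < r ^ 2 := by positivity
  have hrR2 : 16 * r ^ 2 ≤ R ^ 2 := by nlinarith
  have i1 := integrable_bump_mul h.integrableOn_qnorm_sq x (1 / 2 * r ^ 2)
  have i2 := integrable_bump_mul h.integrableOn_qnorm_sq x (4 / 3 * r ^ 2)
  have h1 : c * annulusHeight f x r ≤
      height f x R (1 / 2 * r ^ 2) + height f x R (4 / 3 * r ^ 2) := by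
    rw [annulusHeight, ← integral_const_mul, height, height, ← integral_add i1 i2]
    calc ∫ y in annulus x r, c * qnorm (f y) ^ 2
        ≤ ∫ y in annulus x r, (bump (‖y - x‖ ^ 2 / (1 / 2 * r ^ 2)) * qnorm (f y) ^ 2 +
          bump (‖y - x‖ ^ 2 / (4 / 3 * r ^ 2)) * qnorm (f y) ^ 2) := by
          refine setIntegral_mono_on ((h.integrableOn_qnorm_sq.mono_set hsub).const_mul _)
            ((i1.add i2).mono_set hsub) (measurableSet_annulus x r) fun y hy => ?_
          have hy := (mem_annulus_iff hr).1 hy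
          have hb := hcb _ ⟨hy.1, hy.2.le⟩
          rw [← add_mul]
          refine mul_le_mul_of_nonneg_right (hb.trans_eq ?_) (sq_nonneg _)
          congr 2 <;> field_simp
      _ ≤ _ := by
          refine setIntegral_mono_set (i1.add i2) (.of_forall fun y => ?_) hsub.eventuallyLE
          exact add_nonneg (mul_nonneg (bump_nonneg _) (sq_nonneg _))
            (mul_nonneg (bump_nonneg _) (sq_nonneg _))
  -- Absorbs the smaller of the two scales into the larger; 4r ≤ R keeps 4·(4/3)r² below R².
  have h2 := hf.height_mono hΩ h hR hB (s := 1 / 2 * r ^ 2) (t := 4 / 3 * r ^ 2) (by positivity)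
    (by linarith) (by linarith)
  rw [div_mul_eq_mul_div, le_div_iff₀ hc]
  linarith

/-- The volume of the annuli. -/
lemma exists_volume_annulus (hn : 1 ≤ n) (x : E n) :
    ∃ v > 0, ∀ r, 0 < r → volume (annulus x r) = ENNReal.ofReal (v * r ^ n) := by
  have hb : ∀ r : ℝ, 0 < r → volume (Metric.ball x r) =
      ENNReal.ofReal (r ^ n * (volume (Metric.ball (0 : E n) 1)).toReal) := fun r hr => by
    rw [Measure.addHaar_ball_of_pos _ _ hr, ENNReal.ofReal_mul (by positivity),
      ENNReal.ofReal_toReal measure_ball_lt_top.ne, finrank_euclideanSpace_fin]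
  set v₁ := (volume (Metric.ball (0 : E n) 1)).toReal with hv
  have hv1 : 0 < v₁ := ENNReal.toReal_pos (Metric.measure_ball_pos _ _ one_pos).ne'
    measure_ball_lt_top.ne
  -- For n = 0 the annulus would be null; n ≥ 1 makes 2ⁿ - 1 positive.
  have h2 : (1 : ℝ) < 2 ^ n := one_lt_pow₀ one_lt_two (by omega)
  refine ⟨(2 ^ n - 1) * v₁, mul_pos (by linarith) hv1, fun r hr => ?_⟩
  rw [annulus, measure_sdiff (Metric.ball_subset_ball (by linarith))
    measurableSet_ball.nullMeasurableSet measure_ball_lt_top.ne, hb r hr, hb _ (by positivity),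
    ← ENNReal.ofReal_sub _ (by positivity)]
  congr 1
  ring

/-- Positivity keeps the extended logarithm finite, so the limit can be computed in ℝ. -/
lemma vanishingQuotient_eq {r v : ℝ} (hf : IntegrableOn (fun y => qnorm (f y) ^ 2) (annulus x r))
    (hv : 0 < v) (hvol : volume (annulus x r) = ENNReal.ofReal v)
    (hpos : 0 < annulusHeight f x r) : vanishingQuotient f x r =
      ((Real.log (annulusHeight f x r / v) / (2 * Real.log r) : ℝ) : EReal) := by
  have h1 : annulusAverage f x r = ENNReal.ofReal (annulusHeight f x r / v) := by
    rw [annulusAverage, setLAverage_eq, ENNReal.ofReal_div_of_pos hv, annulusHeight,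
      ofReal_integral_eq_lintegral_ofReal hf (.of_forall fun y => sq_nonneg _), ← hvol, annulus]
  rw [vanishingQuotient, h1, ENNReal.log_ofReal_of_pos (by positivity), EReal.coe_div]

/-- The growth exponent of the integral over annuli is that of the height. -/
lemma tendsto_log_annulusHeight {H A : ℝ → ℝ} {κ v C₁ C₂ r₀ : ℝ}
    (hκ : Tendsto (fun s => Real.log (H s) / Real.log s) (𝓝[>] 0) (𝓝 κ)) (hv : 0 < v)
    (hC₁ : 0 < C₁) (hC₂ : 0 < C₂) (hr₀ : 0 < r₀)
    (hH : ∀ r, 0 < r → r ≤ r₀ → 0 < H (r ^ 2) ∧ 0 < H (4 / 3 * r ^ 2))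
    (h₁ : ∀ r, 0 < r → r ≤ r₀ → H (r ^ 2) ≤ C₁ * A r)
    (h₂ : ∀ r, 0 < r → r ≤ r₀ → A r ≤ C₂ * H (4 / 3 * r ^ 2)) :
    Tendsto (fun r => Real.log (A r / (v * r ^ n)) / (2 * Real.log r)) (𝓝[>] 0)
      (𝓝 (κ - n / 2)) := by
  have hinv : Tendsto (fun r => (2 * Real.log r)⁻¹) (𝓝[>] 0) (𝓝 0) :=
    tendsto_inv_atBot_zero.comp (Real.tendsto_log_nhdsGT_zero.const_mul_atBot two_pos)
  have hscale : ∀ c : ℝ, 0 < c → Tendsto (fun r : ℝ => c * r ^ 2) (𝓝[>] 0) (𝓝[>] 0) := by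
    intro c hc
    refine tendsto_nhdsWithin_iff.2 ⟨?_, eventually_nhdsWithin_of_forall fun r hr => ?_⟩
    · exact ((by fun_prop : Continuous fun r : ℝ => c * r ^ 2).tendsto' 0 0 (by simp)).mono_left
        nhdsWithin_le_nhds
    · have hr : 0 < r := hr
      exact mul_pos hc (pow_pos hr 2)
  -- Rescaling by c adds only log c to 2 log r, which is negligible as r → 0.
  have hmain : ∀ c : ℝ, 0 < c → Tendsto (fun r => Real.log (H (c * r ^ 2)) * (2 * Real.log r)⁻¹)
      (𝓝[>] 0) (𝓝 κ) := by
    intro c hc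
    have h3 := (hκ.comp (hscale c hc)).mul (((hinv.const_mul (Real.log c)).const_add 1))
    rw [mul_zero, add_zero, mul_one] at h3
    refine h3.congr' ?_
    have hev : ∀ᶠ r : ℝ in 𝓝[>] 0, Real.log (c * r ^ 2) < 0 :=
      (Real.tendsto_log_nhdsGT_zero.comp (hscale c hc)).eventually_lt_atBot 0
    have hev' : ∀ᶠ r : ℝ in 𝓝[>] 0, Real.log r < 0 :=
      Real.tendsto_log_nhdsGT_zero.eventually_lt_atBot 0
    filter_upwards [hev, hev', self_mem_nhdsWithin] with r hr1 hr2 hr0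
    have hr0 : 0 < r := hr0
    have h4 : Real.log (c * r ^ 2) = Real.log c + 2 * Real.log r := by
      rw [Real.log_mul hc.ne' (by positivity), Real.log_pow]
      norm_num
    have h5 : 1 + Real.log c * (2 * Real.log r)⁻¹ = Real.log (c * r ^ 2) * (2 * Real.log r)⁻¹ := by
      have := hr2.ne
      rw [h4]
      field_simp
      ring
    simp only [Function.comp]
    rw [h5, ← mul_assoc, div_mul_cancel₀ _ hr1.ne]
  have hlow := ((hmain (4 / 3) (by norm_num)).add
    (hinv.const_mul (Real.log C₂ - Real.log v))).sub_const (n / 2 : ℝ)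
  have hup := ((hmain 1 one_pos).add
    (hinv.const_mul (-Real.log C₁ - Real.log v))).sub_const (n / 2 : ℝ)
  simp only [mul_zero, add_zero, one_mul] at hlow hup
  have hr₀' : ∀ᶠ r : ℝ in 𝓝[>] 0, r ≤ r₀ :=
    (eventually_le_nhds hr₀).filter_mono nhdsWithin_le_nhds
  have hlog : ∀ᶠ r : ℝ in 𝓝[>] 0, Real.log r < 0 :=
    Real.tendsto_log_nhdsGT_zero.eventually_lt_atBot 0
  have hquot : ∀ r, 0 < r → r ≤ r₀ → Real.log r < 0 →
      Real.log (A r / (v * r ^ n)) / (2 * Real.log r) =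
        (Real.log (A r) - Real.log v) * (2 * Real.log r)⁻¹ - n / 2 := by
    intro r hr hrr hl
    have hA : 0 < A r := pos_of_mul_pos_right ((hH r hr hrr).1.trans_le (h₁ r hr hrr)) hC₁.le
    rw [Real.log_div hA.ne' (by positivity), Real.log_mul hv.ne' (by positivity), Real.log_pow]
    have := hl.ne
    field_simp
    ring
  refine tendsto_of_tendsto_of_tendsto_of_le_of_le' hlow hup ?_ ?_
  · filter_upwards [hr₀', hlog, self_mem_nhdsWithin] with r hrr hl hr
    have hA : 0 < A r := pos_of_mul_pos_right ((hH r hr hrr).1.trans_le (h₁ r hr hrr)) hC₁.le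
    rw [hquot r hr hrr hl, ← add_mul]
    -- Division by the negative number 2 log r reverses inequalities: the upper bound on the annulus
    -- integral gives the lower bound on the quotient.
    refine sub_le_sub_right (mul_le_mul_of_nonpos_right ?_ (inv_nonpos.2 (by linarith))) _
    have := Real.log_le_log hA (h₂ r hr hrr)
    rw [Real.log_mul hC₂.ne' (hH r hr hrr).2.ne'] at this
    linarith
  · filter_upwards [hr₀', hlog, self_mem_nhdsWithin] with r hrr hl hr
    have hA : 0 < A r := pos_of_mul_pos_right ((hH r hr hrr).1.trans_le (h₁ r hr hrr)) hC₁.le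
    rw [hquot r hr hrr hl, ← add_mul]
    refine sub_le_sub_right (mul_le_mul_of_nonpos_right ?_ (inv_nonpos.2 (by linarith))) _
    have := Real.log_le_log (hH r hr hrr).1 (h₁ r hr hrr)
    rw [Real.log_mul hC₁.ne' hA.ne'] at this
    linarith

end Annulus

end QValued

end

/-! ### Conclusion -/

theorem lemma3p3 {n m Q : ℕ} (hn : 1 ≤ n) (Ω : Set (QValued.E n)) (hΩ : IsOpen Ω)
    (hconn : IsConnected Ω) (f : QValued.E n → QValued.AQ m Q)
    (hf : QValued.IsDirStationary Ω f) (hnt : QValued.IsNontrivial Ω f) :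
    ∀ x ∈ Ω, ∃ κ : ℝ, QValued.vanishingOrder f x = (κ : EReal) ∧
      Tendsto (QValued.vanishingQuotient f x) (𝓝[>] 0) (𝓝 (κ : EReal)) := by
  intro x hx
  obtain ⟨ρ, hρ, hρΩ⟩ := Metric.isOpen_iff.1 hΩ x hx
  -- Local integrability on B_R needs the Sobolev hypothesis on B_{3R}.
  set R := ρ / 3 with hR
  have hR0 : 0 < R := by positivity
  have hB3 : Metric.ball x (3 * R) ⊆ Ω := by rwa [hR, mul_div_cancel₀ _ three_ne_zero]
  have hB : Metric.ball x R ⊆ Ω := (Metric.ball_subset_ball (by linarith)).trans hB3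
  have h := hf.memW12.hasLocalEnergy hR0 hB3
  have hpos : ∀ s, 0 < s → 4 * s < R ^ 2 → 0 < QValued.height f x R s := fun s hs hsR =>
    hf.height_pos_of_isNontrivial hΩ hn hconn.isPreconnected hnt hx h hR0 hB hs hsR
  obtain ⟨κ, hκ⟩ := hf.exists_tendsto_log_height hΩ h hR0 hB hpos
  obtain ⟨v, hv, hvol⟩ := QValued.exists_volume_annulus hn x
  obtain ⟨C₁, hC₁, h₁⟩ := h.exists_height_le
  obtain ⟨C₂, hC₂, h₂⟩ := hf.exists_annulusHeight_le hΩ h hR0 hB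
  have hsq : ∀ r, 0 < r → r ≤ R / 4 → 16 * r ^ 2 ≤ R ^ 2 := fun r hr hrR => by nlinarith
  have hH : ∀ r, 0 < r → r ≤ R / 4 → 0 < QValued.height f x R (r ^ 2) ∧
      0 < QValued.height f x R (4 / 3 * r ^ 2) := fun r hr hrR => by
    have h3 := hsq r hr hrR
    have h4 : 0 < r ^ 2 := by positivity
    exact ⟨hpos _ h4 (by linarith), hpos _ (by positivity) (by linarith)⟩
  have hlim := QValued.tendsto_log_annulusHeight (n := n) hκ hv hC₁ hC₂
    (by positivity : 0 < R / 4) hH (fun r hr hrR => h₁ r hr (by linarith))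
    (fun r hr hrR => h₂ r hr (by linarith))
  have hT : Tendsto (QValued.vanishingQuotient f x) (𝓝[>] 0) (𝓝 ((κ - n / 2 : ℝ) : EReal)) := by
    refine ((continuous_coe_real_ereal.tendsto _).comp hlim).congr' ?_
    have hev : ∀ᶠ r : ℝ in 𝓝[>] 0, r ≤ R / 4 :=
      (eventually_le_nhds (by positivity)).filter_mono nhdsWithin_le_nhds
    filter_upwards [hev, self_mem_nhdsWithin] with r hrR hr
    have hr : 0 < r := hr
    refine (QValued.vanishingQuotient_eq (h.integrableOn_qnorm_sq.mono_set
      (QValued.annulus_subset_ball (by linarith))) (by positivity) (hvol r hr)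
      (pos_of_mul_pos_right ((hH r hr hrR).1.trans_le (h₁ r hr (by linarith))) hC₁.le)).symm
  -- The growth exponent of the height minus the n/2 due to the annulus volume; the upper limit is
  -- then read off from the limit.
  exact ⟨κ - n / 2, hT.limsup_eq, hT⟩
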